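/- Let $p,q\ge 1$ be integers and let $x_1,\dots,x_s$ be distinct points of $\mathbb{CP}^1$; put $D=x_1+\dots+x_s$ and let $K$ be the canonical bundle of $\mathbb{CP}^1$. *Definitions.* A parabolic bundle $\mathcal E_\bullet$ is a holomorphic vector bundle $\mathcal E$ on $\mathbb{CP}^1$ with a weighted flag, with weights in $[0,1)$, on the fibre at each $x_j$. The weights at $x_j$, repeated with multiplicity, form its type at $x_j$, and the parabolic degree $\deg\mathcal E_\bullet$ is $\deg\mathcal E$ plus the sum of all weights. Sub-bundles carry the induced weighted flags. A parabolic $\mathrm{SU}(p,q)$ Higgs bundle $(\mathcal U_\bullet\oplus\mathcal V_\bullet,\gamma\oplus\delta)$ of type $(\alpha,\beta)$ consists of parabolic bundles $\mathcal U_\bullet,\mathcal V_\bullet$ of ranks $p,q$ and types $\alpha,\beta$ such that $\det\mathcal U_\bullet\otimes\det\mathcal V_\bullet$ is the trivial line bundle with trivial parabolic structure, and of sections $\gamma\in H^0(K(D)\otimes\mathrm{Hom}(\mathcal U_\bullet,\mathcal V_\bullet))$ and $\delta\in H^0(K(D)\otimes\mathrm{Hom}(\mathcal V_\bullet,\mathcal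 U_\bullet))$, where $\mathrm{Hom}$ denotes strongly parabolic morphisms (at $x_j$, vectors of weight $\ge t$ are mapped to vectors of weight $>t$, for every $t$). It is semistable if $\deg(\mathcal U'_\bullet\oplus\mathcal V'_\bullet)\le 0$ for all holomorphic sub-bundles $\mathcal U'\subset\mathcal U$ and $\mathcal V'\subset\mathcal V$ such that $\mathcal U'\oplus\mathcal V'$ is invariant under $\gamma\oplus\delta$. We write $(\mathcal U_\bullet\oplus\mathcal V_\bullet,\gamma\oplus\delta)\in\mathcal M(\alpha,\beta,d)$ if it is semistable (for instance polystable) of type $(\alpha,\beta)$ and $\deg\mathcal U-\deg\mathcal V=d$. A constant $\mathrm{SU}(p,q)$-multiweight $(\alpha,\beta)$ is given by numbers $\alpha^j,\beta^j\in[0,1)$ with $p\alpha^j+q\beta^j\in\mathbb N$ for $1\le j\le s$: all weights of $\mathcal U_\bullet$ at $x_j$ are $\alpha^j$, and all weights of $\mathcal V_\bullet$ at $x_j$ are $\beta^j$. Put $|\alpha|=\sum_j\alpha^j$, $|\beta|=\sum_j\beta^j$, $\epsilon=|\beta|-|\alpha|$ and $$J_{\alpha,\beta}=\big(q|\beta|-p|\alpha|,\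 q|\beta|-p|\alpha|+2-\epsilon\big).$$ *Statement.* (1) Let $(\alpha,\beta)$ be a constant multiweight with $\alpha^j<\beta^j$ for all $j$ and $\epsilon<2$, and let $d\in J_{\alpha,\beta}$ be an integer. If $(\mathcal U_\bullet\oplus\mathcal V_\bullet,\gamma\oplus\delta)\in\mathcal M(\alpha,\beta,d)$, then $\mathcal V\cong\mathcal O(-a)^{q}$ for some integer $a>0$. (2) Let $a$ be an integer in $\left[\frac{s+p}{p+q},\frac{(p+q-1)s+p}{p+q}\right]$. There is a constant multiweight $(\alpha,\beta)$ such that - (a) $\alpha^j<\beta^j$ for all $j$; - (b) $\epsilon\in\left(\frac{2pq-2p-2q}{2pq-p-q},1\right)$, where for $p=q=1$ the interval is read as $(0,1)$; - (c) $d:=(q-p)a+p\in J_{\alpha,\beta}$; - (n) $p|\alpha|+q|\beta|=(p+q)a-p$. Moreover, for every constant multiweight $(\alpha,\beta)$ satisfying (a), (b), (c) and (n), every $(\mathcal U_\bullet\oplus\mathcal V_\bullet,\gamma\oplus\delta)\in\mathcal M(\alpha,\beta,d)$ has $\mathcal U\cong\mathcal O(-a+1)^{p}$ and $\mathcal V\cong\mathcal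 O(-a)^{q}$. -/

import Mathlib

open scoped Manifold ContDiff Topology
open Set

universe u v

noncomputable section

/-- The Riemann sphere `ℂℙ¹ = ℂ ∪ {∞}`. -/
abbrev RiemannSphere : Type := OnePoint ℂ

namespace RiemannSphere

/-- The affine coordinate `z` (with the junk value `0` at `∞`). -/
def coord (x : RiemannSphere) : ℂ := x.elim 0 id

@[simp] theorem coord_coe (z : ℂ) : coord (z : RiemannSphere) = z := rfl
@[simp] theorem coord_infty : coord (OnePoint.infty : RiemannSphere) = 0 := rfl

/-- The map `z ↦ 1 / z`, exchanging `0` and `∞`. -/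
def invFun (x : RiemannSphere) : RiemannSphere :=
  x.elim ((0 : ℂ) : RiemannSphere) (fun z => if z = 0 then OnePoint.infty else ((z⁻¹ : ℂ) : RiemannSphere))

@[simp] theorem invFun_infty : invFun OnePoint.infty = ((0 : ℂ) : RiemannSphere) := rfl
@[simp] theorem invFun_zero : invFun ((0 : ℂ) : RiemannSphere) = OnePoint.infty := by simp [invFun]
theorem invFun_coe {z : ℂ} (hz : z ≠ 0) :
    invFun (z : RiemannSphere) = ((z⁻¹ : ℂ) : RiemannSphere) := by simp [invFun, hz]

theorem invFun_invFun (x : RiemannSphere) : invFun (invFun x) = x := by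
  induction x using OnePoint.rec with
  | infty => simp
  | coe z =>
    by_cases hz : z = 0
    · subst hz; simp
    · rw [invFun_coe hz, invFun_coe (inv_ne_zero hz), inv_inv]

theorem continuous_invFun : Continuous invFun := by
  rw [continuous_iff_continuousAt]
  intro x
  induction x using OnePoint.rec with
  | infty =>
    rw [OnePoint.continuousAt_infty', Filter.coclosedCompact_eq_cocompact,
      ← Metric.cobounded_eq_cocompact, invFun_infty]
    have h1 : Filter.Tendsto (fun z : ℂ => ((z⁻¹ : ℂ) : RiemannSphere)) (Bornology.cobounded ℂ)
        (𝓝 ((0 : ℂ) : RiemannSphere)) :=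
      (OnePoint.continuous_coe.tendsto 0).comp Filter.tendsto_inv₀_cobounded
    refine h1.congr' ?_
    filter_upwards [Bornology.isBounded_singleton (x := (0 : ℂ))] with z hz
    simp only [Function.comp]
    rw [invFun_coe (by simpa using hz)]
  | coe z =>
    rw [OnePoint.continuousAt_coe]
    by_cases hz : z = 0
    · subst hz
      rw [continuousAt_iff_punctured_nhds]
      have h1 : Filter.Tendsto (fun z : ℂ => ((z⁻¹ : ℂ) : RiemannSphere)) (𝓝[≠] 0)
          (𝓝 (OnePoint.infty : RiemannSphere)) := by
        have := (OnePoint.tendsto_coe_infty (X := ℂ))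
        rw [Filter.coclosedCompact_eq_cocompact, ← Metric.cobounded_eq_cocompact] at this
        exact this.comp Filter.tendsto_inv₀_nhdsNE_zero
      simp only [Function.comp, invFun_zero]
      refine h1.congr' ?_
      filter_upwards [self_mem_nhdsWithin] with z hz
      simp only [Function.comp]
      rw [invFun_coe hz]
    · have h1 : ContinuousAt (fun z : ℂ => ((z⁻¹ : ℂ) : RiemannSphere)) z :=
        OnePoint.continuous_coe.continuousAt.comp (continuousAt_inv₀ hz)
      refine h1.congr ?_
      filter_upwards [isOpen_ne.mem_nhds hz] with w hw
      simp only [Function.comp]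
      rw [invFun_coe hw]

/-- The involution `z ↦ 1 / z` of the sphere. -/
def inversion : RiemannSphere ≃ₜ RiemannSphere where
  toFun := invFun
  invFun := invFun
  left_inv := invFun_invFun
  right_inv := invFun_invFun
  continuous_toFun := continuous_invFun
  continuous_invFun := continuous_invFun

/-- The affine chart `z`, on the complement of `OnePoint.infty`. -/
def chartZero : OpenPartialHomeomorph RiemannSphere ℂ where
  toFun := coord
  invFun := fun z => (z : RiemannSphere)
  source := {OnePoint.infty}ᶜ
  target := univ
  map_source' := fun _ _ => mem_univ _
  map_target' := fun z _ => OnePoint.coe_ne_infty z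
  left_inv' := by
    intro x hx
    induction x using OnePoint.rec with
    | infty => exact absurd rfl hx
    | coe z => rfl
  right_inv' := fun _ _ => rfl
  open_source := isOpen_compl_singleton
  open_target := isOpen_univ
  continuousOn_toFun := by
    intro x hx
    induction x using OnePoint.rec with
    | infty => exact absurd rfl hx
    | coe z =>
      refine ContinuousAt.continuousWithinAt ?_
      rw [OnePoint.continuousAt_coe]
      exact continuousAt_id
  continuousOn_invFun := OnePoint.continuous_coe.continuousOn

/-- The chart `w = 1 / z`, on the complement of `0`. -/
def chartInfty : OpenPartialHomeomorph RiemannSphere ℂ :=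
  inversion.toOpenPartialHomeomorph.trans chartZero

open Classical in
/-- The complex structure: the two charts `z` and `w = 1 / z`. The preferred chart is `z` at the
points of `ℂ` and `w` at `∞`. -/
instance instChartedSpace : ChartedSpace ℂ RiemannSphere where
  atlas := {chartZero, chartInfty}
  chartAt := fun x => if x = OnePoint.infty then chartInfty else chartZero
  mem_chart_source := by
    intro x
    by_cases hx : x = OnePoint.infty
    · subst hx
      simp [chartInfty, chartZero, inversion]
    · simp [hx, chartZero]
  chart_mem_atlas := by
    intro x
    by_cases hx : x = OnePoint.infty <;> simp [hx]

theorem chartInfty_apply (x : RiemannSphere) : chartInfty x = coord (invFun x) := rfl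
theorem chartInfty_symm_apply (z : ℂ) : chartInfty.symm z = invFun (z : RiemannSphere) := rfl

theorem chartInfty_source : chartInfty.source = {((0 : ℂ) : RiemannSphere)}ᶜ := by
  ext x
  have : invFun x = OnePoint.infty ↔ x = ((0 : ℂ) : RiemannSphere) :=
    ⟨fun h => by rw [← invFun_invFun x, h, invFun_infty], fun h => by rw [h, invFun_zero]⟩
  simp [chartInfty, chartZero, inversion, this]

theorem contDiffOn_transition :
    ContDiffOn ℂ ω (fun z : ℂ => coord (invFun (z : RiemannSphere))) {0}ᶜ := by
  have h : ContDiffOn ℂ ω (fun z : ℂ => z⁻¹) {0}ᶜ := contDiffOn_inv ℂ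
  refine h.congr ?_
  intro z hz
  rw [invFun_coe hz, coord_coe]

instance instIsManifold : IsManifold 𝓘(ℂ, ℂ) ω RiemannSphere := by
  refine isManifold_of_contDiffOn _ _ _ ?_
  intro e e' he he'
  have hsub : ∀ z : ℂ, ((z : RiemannSphere) ∈ ({((0 : ℂ) : RiemannSphere)}ᶜ : Set RiemannSphere)) ↔
      z ∈ ({0}ᶜ : Set ℂ) := by
    intro z
    simp only [mem_compl_iff, mem_singleton_iff, OnePoint.coe_eq_coe]
  rcases he with rfl | he <;> rcases he' with rfl | he'
  · exact contDiffOn_id.congr fun z _ => rfl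
  · rw [mem_singleton_iff] at he'
    subst he'
    refine contDiffOn_transition.mono ?_
    intro z hz
    have h1 := hz.1
    simp only [mem_preimage, OpenPartialHomeomorph.trans_source, mem_inter_iff,
      chartInfty_source] at h1
    exact (hsub z).1 h1.2
  · rw [mem_singleton_iff] at he
    subst he
    refine contDiffOn_transition.mono ?_
    intro z hz
    have h1 := hz.1
    simp only [mem_preimage, OpenPartialHomeomorph.trans_source, mem_inter_iff] at h1
    have h2 : invFun (z : RiemannSphere) ≠ OnePoint.infty := h1.2
    intro hz0
    rw [mem_singleton_iff] at hz0
    subst hz0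
    exact h2 invFun_zero
  · rw [mem_singleton_iff] at he he'
    subst he he'
    refine contDiffOn_id.congr ?_
    intro z _
    change coord (invFun (invFun (z : RiemannSphere))) = z
    rw [invFun_invFun, coord_coe]

end RiemannSphere

/-- A holomorphic vector bundle of rank `n` over the Riemann sphere. -/
structure HolBundle (n : ℕ) where
  fiber : RiemannSphere → Type u
  [addCommGroup : ∀ x, AddCommGroup (fiber x)]
  [module : ∀ x, Module ℂ (fiber x)]
  [topology : ∀ x, TopologicalSpace (fiber x)]
  [topologyTotal : TopologicalSpace (Bundle.TotalSpace (Fin n → ℂ) fiber)]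
  [fiberBundle : FiberBundle (Fin n → ℂ) fiber]
  [vectorBundle : VectorBundle ℂ (Fin n → ℂ) fiber]
  [holomorphic : ContMDiffVectorBundle ω (Fin n → ℂ) fiber 𝓘(ℂ, ℂ)]

namespace HolBundle

attribute [instance] addCommGroup module topology topologyTotal fiberBundle vectorBundle
  holomorphic

variable {m n : ℕ}

/-- The (set-theoretic) section `s` of `E` is holomorphic in a neighbourhood of `x`. -/
def SectionHolAt (E : HolBundle.{u} n) (s : ∀ y, E.fiber y) (x : RiemannSphere) : Prop :=
  ContMDiffAt 𝓘(ℂ, ℂ) (𝓘(ℂ, ℂ).prod 𝓘(ℂ, Fin n → ℂ)) ω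
    (fun y => Bundle.TotalSpace.mk' (Fin n → ℂ) y (s y)) x

/-- The bundle map `A : E → F` (over the identity) is holomorphic in a neighbourhood of `x`: it maps
local holomorphic sections to local holomorphic sections. -/
def HomHolAt (E : HolBundle.{u} m) (F : HolBundle.{v} n) (A : ∀ y, E.fiber y →ₗ[ℂ] F.fiber y)
    (x : RiemannSphere) : Prop :=
  ∀ s : ∀ y, E.fiber y, E.SectionHolAt s x → F.SectionHolAt (fun y => A y (s y)) x

/-- Isomorphism of holomorphic vector bundles. -/
def IsIsomorphic (E : HolBundle.{u} m) (F : HolBundle.{v} n) : Prop :=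
  ∃ e : ∀ y, E.fiber y ≃ₗ[ℂ] F.fiber y,
    (∀ x, HomHolAt E F (fun y => (e y).toLinearMap) x) ∧
    (∀ x, HomHolAt F E (fun y => (e y).symm.toLinearMap) x)

open RiemannSphere

/-- Numbering of the two charts: `false` is `z`, `true` is `w`. -/
def chartIndex : Bool → ℤ
  | false => 0
  | true => 1

theorem coord_ne_zero {x : RiemannSphere} (h0 : x ∈ chartZero.source)
    (h1 : x ∈ chartInfty.source) : coord x ≠ 0 := by
  rw [chartInfty_source] at h1
  induction x using OnePoint.rec with
  | infty => exact absurd rfl h0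
  | coe z => exact fun h => h1 (congrArg _ h)

theorem contMDiffOn_coord : ContMDiffOn 𝓘(ℂ, ℂ) 𝓘(ℂ, ℂ) ω coord chartZero.source :=
  contMDiffOn_of_mem_maximalAtlas (e := chartZero)
    (IsManifold.subset_maximalAtlas (by left; rfl))

/-- The diagonal endomorphism of `ℂⁿ` with entries `z ^ (c * d k)`. -/
def diagPow (d : Fin n → ℤ) (c : ℤ) (z : ℂ) : (Fin n → ℂ) →L[ℂ] (Fin n → ℂ) :=
  ContinuousLinearMap.pi fun k => (z ^ (c * d k)) • ContinuousLinearMap.proj k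

theorem diagPow_apply (d : Fin n → ℤ) (c : ℤ) (z : ℂ) (v : Fin n → ℂ) (k : Fin n) :
    diagPow d c z v k = z ^ (c * d k) * v k := rfl

theorem contDiffOn_diagPow (d : Fin n → ℤ) (c : ℤ) :
    ContDiffOn ℂ ω (diagPow d c) {0}ᶜ := by
  have h : diagPow d c = fun z => ∑ k, (z ^ (c * d k)) •
      ((ContinuousLinearMap.single ℂ (fun _ : Fin n => ℂ) k).comp
        (ContinuousLinearMap.proj k : (Fin n → ℂ) →L[ℂ] ℂ)) := by
    funext z
    ext v k
    simp [diagPow, Finset.sum_apply, Pi.single_apply]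
  rw [h]
  refine ContDiffOn.sum fun k _ => ?_
  have h1 : ContDiffOn ℂ ω (fun z : ℂ => z ^ (c * d k)) {0}ᶜ := fun z hz =>
    (analyticAt_id.zpow hz).contDiffAt.contDiffWithinAt
  exact h1.smul contDiffOn_const

theorem contMDiffOn_diagPow (d : Fin n → ℤ) (i j : Bool) :
    ContMDiffOn 𝓘(ℂ, ℂ) 𝓘(ℂ, (Fin n → ℂ) →L[ℂ] (Fin n → ℂ)) ω
      (fun x => diagPow d (chartIndex i - chartIndex j) (coord x))
      ((bif i then chartInfty.source else chartZero.source) ∩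
        (bif j then chartInfty.source else chartZero.source)) := by
  by_cases hij : i = j
  · subst hij
    have h : (fun x => diagPow d (chartIndex i - chartIndex i) (coord x)) =
        fun _ => diagPow d 0 1 := by
      funext x
      ext v k
      simp [diagPow_apply]
    rw [h]
    exact contMDiffOn_const
  · have hs : ((bif i then chartInfty.source else chartZero.source) ∩
        (bif j then chartInfty.source else chartZero.source)) ⊆
        chartZero.source ∩ chartInfty.source := by
      cases i <;> cases j <;> simp_all [Set.inter_comm]
    refine ((contDiffOn_diagPow d _).contMDiffOn.comp
      (contMDiffOn_coord.mono (hs.trans Set.inter_subset_left)) ?_)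
    intro x hx
    exact coord_ne_zero (hs hx).1 (hs hx).2

/-- The gluing data of `𝒪(d₁) ⊕ ⋯ ⊕ 𝒪(dₙ)`: the coordinates `f` over the chart `z` and `g` over the
chart `w = 1 / z` are related by `g k = z ^ (-d k) * f k`. -/
def splitCore (d : Fin n → ℤ) : VectorBundleCore ℂ RiemannSphere (Fin n → ℂ) Bool where
  baseSet i := bif i then chartInfty.source else chartZero.source
  isOpen_baseSet i := by cases i <;> exact OpenPartialHomeomorph.open_source _
  indexAt := open Classical in fun x => decide (x = OnePoint.infty)
  mem_baseSet_at := by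
    intro x
    by_cases hx : x = OnePoint.infty
    · simp [hx, chartInfty_source]
    · simp [hx, chartZero]
  coordChange i j x := diagPow d (chartIndex i - chartIndex j) (coord x)
  coordChange_self := by
    intro i x _ v
    ext k
    simp [diagPow_apply]
  continuousOn_coordChange i j := (contMDiffOn_diagPow d i j).continuousOn
  coordChange_comp := by
    intro i j k x hx v
    ext l
    simp only [diagPow_apply]
    rw [← mul_assoc]
    congr 1
    by_cases hij : i = j
    · subst hij; simp
    by_cases hjk : j = k
    · subst hjk; simp
    have h0 : coord x ≠ 0 := by
      obtain ⟨⟨h1, h2⟩, -⟩ := hx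
      cases i <;> cases j <;>
        first
        | exact absurd rfl hij
        | exact coord_ne_zero h1 h2
        | exact coord_ne_zero h2 h1
    rw [← zpow_add₀ h0]
    congr 1
    ring

instance splitCore_isContMDiff (d : Fin n → ℤ) :
    (splitCore d).IsContMDiff 𝓘(ℂ, ℂ) ω where
  contMDiffOn_coordChange i j := contMDiffOn_diagPow d i j

/-- The holomorphic vector bundle `𝒪(d₁) ⊕ ⋯ ⊕ 𝒪(dₙ)` over the Riemann sphere. -/
def split (d : Fin n → ℤ) : HolBundle.{0} n where
  fiber := (splitCore d).Fiber

/-- `f` is a holomorphic frame, near `x`, of the family of subspaces `L` of the fibres of `E`. -/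
structure IsFrameAt (E : HolBundle.{u} n) (L : ∀ y, Submodule ℂ (E.fiber y)) {r : ℕ}
    (f : Fin r → ∀ y, E.fiber y) (x : RiemannSphere) : Prop where
  hol : ∀ i, E.SectionHolAt (f i) x
  linearIndependent : ∀ᶠ y in 𝓝 x, LinearIndependent ℂ fun i => f i y
  span_eq : ∀ᶠ y in 𝓝 x, Submodule.span ℂ (Set.range fun i => f i y) = L y

/-- A holomorphic sub-bundle of rank `r`: a family of subspaces of the fibres that has, near each
point, a holomorphic frame (linearly independent at every point). -/
structure Subbundle (E : HolBundle.{u} n) (r : ℕ) where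
  toSubmodule : ∀ y, Submodule ℂ (E.fiber y)
  exists_frame : ∀ x, ∃ f : Fin r → ∀ y, E.fiber y, E.IsFrameAt toSubmodule f x

/-- The function `g` is meromorphic at `x`. -/
def MerAt (g : RiemannSphere → ℂ) (x : RiemannSphere) : Prop :=
  MeromorphicAt (g ∘ (chartAt ℂ x).symm) (chartAt ℂ x x)

/-- The order of vanishing at `x` of a meromorphic function (`⊤` if it vanishes near `x`). -/
def orderAt (g : RiemannSphere → ℂ) (x : RiemannSphere) : WithTop ℤ :=
  meromorphicOrderAt (g ∘ (chartAt ℂ x).symm) (chartAt ℂ x x)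

/-- The sections `s 0, …, s (r - 1)` of `L` are meromorphic at `x`, and the meromorphic section
`s 0 ∧ ⋯ ∧ s (r - 1)` of `det L` has order `k` at `x` (in particular it does not vanish
identically): in a local holomorphic frame `f` of `L` their coefficients form a meromorphic matrix
whose determinant has order `k`. -/
def HasDetOrderAt (E : HolBundle.{u} n) (L : ∀ y, Submodule ℂ (E.fiber y)) {r : ℕ}
    (s : Fin r → ∀ y, E.fiber y) (x : RiemannSphere) (k : ℤ) : Prop :=
  ∃ (f : Fin r → ∀ y, E.fiber y) (M : RiemannSphere → Matrix (Fin r) (Fin r) ℂ),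
    E.IsFrameAt L f x ∧ (∀ i j, MerAt (fun y => M y i j) x) ∧
    (∀ᶠ y in 𝓝[≠] x, ∀ i, s i y = ∑ j, M y i j • f j y) ∧
    orderAt (fun y => (M y).det) x = k

/-- `D` is the divisor of a nonzero meromorphic section `s 0 ∧ ⋯ ∧ s (r - 1)` of the determinant line
bundle of `L`, a sub-bundle of rank `r`. -/
def IsDetDivisor (E : HolBundle.{u} n) (L : ∀ y, Submodule ℂ (E.fiber y)) (r : ℕ)
    (D : RiemannSphere →₀ ℤ) : Prop :=
  ∃ s : Fin r → ∀ y, E.fiber y, ∀ x, E.HasDetOrderAt L s x (D x)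

open Classical in
/-- The degree of a sub-bundle `L` of rank `r`: the degree of the line bundle `det L`, i.e. the number
of zeros minus the number of poles of a nonzero meromorphic section of it. -/
def subDegree (E : HolBundle.{u} n) (L : ∀ y, Submodule ℂ (E.fiber y)) (r : ℕ) : ℤ :=
  if h : ∃ D, E.IsDetDivisor L r D then h.choose.sum fun _ k => k else 0

/-- The degree of a holomorphic vector bundle. -/
def degree (E : HolBundle.{u} n) : ℤ := E.subDegree (fun _ => ⊤) n

end HolBundle

/-- A weighted flag on a vector space `W`, written as a decreasing left-continuous filtration indexed
by the weights: `filt t` is the space of vectors of weight at least `t`, and all weights lie in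
`[0, 1)`. A parabolic structure on a bundle at a point is a weighted flag on the fibre. -/
structure WeightedFlag (W : Type u) [AddCommGroup W] [Module ℂ W] where
  filt : ℝ → Submodule ℂ W
  antitone : Antitone filt
  left_cont : ∀ t, ∃ ε > 0, filt (t - ε) = filt t
  filt_zero : filt 0 = ⊤
  filt_one : filt 1 = ⊥

namespace WeightedFlag
variable {W : Type u} [AddCommGroup W] [Module ℂ W]

/-- The vectors of weight greater than `t`. -/
def above (F : WeightedFlag W) (t : ℝ) : Submodule ℂ W := ⨆ t' : Set.Ioi t, F.filt t'

/-- The weights, repeated with multiplicity, are `w 0, …, w (n - 1)`. -/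
def HasType (F : WeightedFlag W) {n : ℕ} (w : Fin n → ℝ) : Prop :=
  ∀ t, Module.finrank ℂ (F.filt t) = Nat.card {i // t ≤ w i}

/-- The sum, with multiplicity, of the weights of the flag induced on the subspace `L`: the weight `t`
has multiplicity `dim (F_t ∩ L) - dim (F_{>t} ∩ L)`. -/
def weight (F : WeightedFlag W) (L : Submodule ℂ W) : ℝ :=
  ∑ᶠ t : ℝ, t * ((Module.finrank ℂ (F.filt t ⊓ L : Submodule ℂ W) : ℝ)
    - Module.finrank ℂ (F.above t ⊓ L : Submodule ℂ W))

end WeightedFlag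

/-- The differential at `y` of the preferred coordinate centred at `x`, as a linear form on the
tangent space at `y`. -/
def dCoord (x y : RiemannSphere) (v : TangentSpace 𝓘(ℂ, ℂ) y) : ℂ :=
  NormedSpace.fromTangentSpace _ (mfderiv 𝓘(ℂ, ℂ) 𝓘(ℂ, ℂ) (chartAt ℂ x) y v)

/-- `φ` is a holomorphic section of `K(D) ⊗ Hom(E_•, F_•)`, where `D` is the sum of the points `pt j`
and `Hom(E_•, F_•)` is the bundle of (strongly) parabolic morphisms: a `Hom(E, F)`-valued `1`-form,
equal to `A dz` with `A` holomorphic near each point outside `D`, and to `A dz / z` near each point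
of `D` (where `z` is a coordinate centred at the point), the residue `A` at the point mapping vectors
of weight at least `t` to vectors of weight greater than `t`. The value of `φ` at the points of `D`
itself plays no role. -/
structure IsParabolicLogForm {m n s : ℕ} (pt : Fin s → RiemannSphere)
    (E : HolBundle.{u} m) (F : HolBundle.{v} n)
    (parE : ∀ j, WeightedFlag (E.fiber (pt j))) (parF : ∀ j, WeightedFlag (F.fiber (pt j)))
    (φ : ∀ y, TangentSpace 𝓘(ℂ, ℂ) y →ₗ[ℂ] E.fiber y →ₗ[ℂ] F.fiber y) : Prop where
  holomorphic : ∀ x, x ∉ Set.range pt → ∃ A : ∀ y, E.fiber y →ₗ[ℂ] F.fiber y,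
    E.HomHolAt F A x ∧ ∀ᶠ y in 𝓝 x, ∀ v, φ y v = dCoord x y v • A y
  residue : ∀ j, ∃ A : ∀ y, E.fiber y →ₗ[ℂ] F.fiber y,
    E.HomHolAt F A (pt j) ∧
    (∀ᶠ y in 𝓝[≠] (pt j), ∀ v, φ y v =
      (dCoord (pt j) y v / (chartAt ℂ (pt j) y - chartAt ℂ (pt j) (pt j))) • A y) ∧
    ∀ t, (parE j).filt t ≤ ((parF j).above t).comap (A (pt j))

/-- The data `(U_• ⊕ V_•, γ ⊕ δ)` of a parabolic `SU(p,q)` Higgs bundle over the sphere punctured at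
the points `pt j` (the condition on the determinant is `ParabolicHiggs.HasTrivialDet`). -/
structure ParabolicHiggs {s : ℕ} (p q : ℕ) (pt : Fin s → RiemannSphere) where
  U : HolBundle.{u} p
  V : HolBundle.{u} q
  parU : ∀ j, WeightedFlag (U.fiber (pt j))
  parV : ∀ j, WeightedFlag (V.fiber (pt j))
  γ : ∀ y, TangentSpace 𝓘(ℂ, ℂ) y →ₗ[ℂ] U.fiber y →ₗ[ℂ] V.fiber y
  δ : ∀ y, TangentSpace 𝓘(ℂ, ℂ) y →ₗ[ℂ] V.fiber y →ₗ[ℂ] U.fiber y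
  isParabolicLogForm_γ : IsParabolicLogForm pt U V parU parV γ
  isParabolicLogForm_δ : IsParabolicLogForm pt V U parV parU δ

namespace ParabolicHiggs

variable {s p q : ℕ} {pt : Fin s → RiemannSphere}

/-- The parabolic types of `U_•` and `V_•` are `α` and `β`. -/
def HasType (H : ParabolicHiggs.{u} p q pt) (α : Fin s → Fin p → ℝ) (β : Fin s → Fin q → ℝ) :
    Prop :=
  ∀ j, (H.parU j).HasType (α j) ∧ (H.parV j).HasType (β j)

open Classical in
/-- For a Higgs bundle of type `(α, β)`: `det U_• ⊗ det V_•` has trivial parabolic structure and is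
isomorphic to `𝒪`. The weight of this parabolic line bundle at `pt j` is the sum `k j` of all `α j i`
and `β j i`; so this says that the `k j` are integers and that the line bundle
`det U ⊗ det V ⊗ 𝒪(∑ k j • pt j)` has a nowhere vanishing holomorphic section, i.e. that
`det U ⊗ det V` has a meromorphic section with divisor `-∑ k j • pt j`. -/
def HasTrivialDet (H : ParabolicHiggs.{u} p q pt) (α : Fin s → Fin p → ℝ)
    (β : Fin s → Fin q → ℝ) : Prop :=
  ∃ D₁ D₂ : RiemannSphere →₀ ℤ,
    H.U.IsDetDivisor (fun _ => ⊤) p D₁ ∧ H.V.IsDetDivisor (fun _ => ⊤) q D₂ ∧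
    (∀ j, ∃ k : ℤ, ∑ i, α j i + ∑ i, β j i = k) ∧
    ∀ x, ((D₁ x + D₂ x : ℤ) : ℝ) =
      -∑ j, if pt j = x then ∑ i, α j i + ∑ i, β j i else 0

/-- The sub-bundle `U' ⊕ V'` is invariant under `γ ⊕ δ`. -/
def IsInvariant (H : ParabolicHiggs.{u} p q pt) {m n : ℕ} (U' : H.U.Subbundle m)
    (V' : H.V.Subbundle n) : Prop :=
  ∀ y, y ∉ Set.range pt → ∀ v : TangentSpace 𝓘(ℂ, ℂ) y,
    U'.toSubmodule y ≤ (V'.toSubmodule y).comap (H.γ y v) ∧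
    V'.toSubmodule y ≤ (U'.toSubmodule y).comap (H.δ y v)

/-- The parabolic degree of the sub-bundle `U' ⊕ V'`, with the induced parabolic structure. -/
def parDegree (H : ParabolicHiggs.{u} p q pt) {m n : ℕ} (U' : H.U.Subbundle m)
    (V' : H.V.Subbundle n) : ℝ :=
  H.U.subDegree U'.toSubmodule m + H.V.subDegree V'.toSubmodule n +
    ∑ j, ((H.parU j).weight (U'.toSubmodule (pt j)) + (H.parV j).weight (V'.toSubmodule (pt j)))

/-- Semistability. -/
def IsSemistable (H : ParabolicHiggs.{u} p q pt) : Prop :=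
  ∀ (m n : ℕ) (U' : H.U.Subbundle m) (V' : H.V.Subbundle n),
    H.IsInvariant U' V' → H.parDegree U' V' ≤ 0

/-- `H` is a semistable parabolic `SU(p,q)` Higgs bundle of type `(α, β)` with
`deg U - deg V = d`. The moduli space `ℳ(α, β, d)` parametrizes these objects; each of its points is
the class of a polystable (hence semistable) one. -/
structure RepresentsPointOfModuli (H : ParabolicHiggs.{u} p q pt) (α : Fin s → Fin p → ℝ)
    (β : Fin s → Fin q → ℝ) (d : ℤ) : Prop where
  hasType : H.HasType α β
  hasTrivialDet : H.HasTrivialDet α β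
  isSemistable : H.IsSemistable
  degree_sub : H.U.degree - H.V.degree = d

end ParabolicHiggs

/-- The `SU(p,q)`-multiweights at `s` points. -/
structure IsMultiweight {s p q : ℕ} (α : Fin s → Fin p → ℝ) (β : Fin s → Fin q → ℝ) : Prop where
  mem_left : ∀ j i, α j i ∈ Set.Ico (0 : ℝ) 1
  mem_right : ∀ j i, β j i ∈ Set.Ico (0 : ℝ) 1
  monotone_left : ∀ j, Monotone (α j)
  monotone_right : ∀ j, Monotone (β j)
  sum_mem : ∀ j, ∃ k : ℕ, ∑ i, α j i + ∑ i, β j i = k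

/-- The system of weights that are all equal to `a j` at the `j`-th point. -/
def constWeight {s : ℕ} (n : ℕ) (a : Fin s → ℝ) : Fin s → Fin n → ℝ := fun j _ => a j

/-- `‖α‖`, the sum of all weights. -/
def weightNorm {s n : ℕ} (α : Fin s → Fin n → ℝ) : ℝ := ∑ j, ∑ i, α j i

/-- For constant weights, `ε = |β| - |α|`. -/
def weightGap {s : ℕ} (α β : Fin s → ℝ) : ℝ := ∑ j, β j - ∑ j, α j

/-- The interval `J = (‖β‖ - ‖α‖, ‖β‖ - ‖α‖ + 2 - ε)` for the constant multiweight `(α, β)`. -/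
def intervalJ {s : ℕ} (p q : ℕ) (α β : Fin s → ℝ) : Set ℝ :=
  Set.Ioo (weightNorm (constWeight q β) - weightNorm (constWeight p α))
    (weightNorm (constWeight q β) - weightNorm (constWeight p α) + 2 - weightGap α β)

/-- `(α, β)` is a constant `SU(p,q)`-multiweight with `α j < β j`, with `ε` in
`((2pq - 2p - 2q) / (2pq - p - q), 1)` (for `p = q = 1` the lower end is read as `0`), with
`(q - p) a + p ∈ J`, and with `‖α‖ + ‖β‖ = (p + q) a - p`. -/
structure IsAdapted {s : ℕ} (p q : ℕ) (a : ℤ) (α β : Fin s → ℝ) : Prop where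
  isMultiweight : IsMultiweight (constWeight p α) (constWeight q β)
  lt : ∀ j, α j < β j
  gap_mem : weightGap α β ∈
    Set.Ioo ((2 * p * q - 2 * p - 2 * q : ℝ) / (2 * p * q - p - q)) 1
  mem_intervalJ : ((((q : ℤ) - p) * a + p : ℤ) : ℝ) ∈ intervalJ p q α β
  norm_add_norm : weightNorm (constWeight p α) + weightNorm (constWeight q β) = (p + q) * a - p

end

/-! Let `N ⊆ V` and `I ⊆ U` be the saturations of the kernel and of the image of `δ`. As
`α j < β j`, a strongly parabolic `δ` has no residues, so it maps sections of `V` with poles at `∞`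
to sections of `I ⊗ K`, and counting such sections gives `deg V ≤ deg N + deg I - 2 rk I`. Added to
the semistability inequalities of `0 ⊕ N` and `I ⊕ V`, this forces `rk I < 1` on the interval `J`;
hence `δ = 0`.

By Grothendieck's theorem `U` and `V` split into line bundles, and now `0 ⊕ L` for every summand `L`
of `V` and `L ⊕ V` for every summand `L` of `U` are invariant. Semistability bounds the degree of
every summand from above. For `V` the total degree is within `1` of the sum of these bounds, so that
all summands have the same degree; under the conditions of (2) the bound for `U`, rounded down, is
attained by the average. -/

namespace RiemannSphere

/-- The inverse of the preferred chart at `x`, defined on all of `ℂ`. -/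
noncomputable def chartInv (x : RiemannSphere) (z : ℂ) : RiemannSphere := (chartAt ℂ x).symm z

/-- The position of `x` in the preferred chart at `x`. -/
noncomputable def chartCenter (x : RiemannSphere) : ℂ := chartAt ℂ x x

/-- The preferred coordinate at `x`, normalized to vanish at `x`. -/
noncomputable def localCoord (x y : RiemannSphere) : ℂ := chartAt ℂ x y - chartCenter x

theorem chartAt_coe (z : ℂ) : chartAt ℂ (z : RiemannSphere) = chartZero := by
  classical
  exact if_neg (OnePoint.coe_ne_infty z)

theorem chartAt_infty : chartAt ℂ (OnePoint.infty : RiemannSphere) = chartInfty := by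
  classical
  exact if_pos rfl

theorem chartInv_coe (z w : ℂ) : chartInv (z : RiemannSphere) w = (w : RiemannSphere) := by
  rw [chartInv, chartAt_coe]; rfl

theorem chartInv_infty (w : ℂ) : chartInv OnePoint.infty w = invFun (w : RiemannSphere) := by
  rw [chartInv, chartAt_infty]; rfl

@[simp] theorem chartCenter_coe (z : ℂ) : chartCenter (z : RiemannSphere) = z := by
  rw [chartCenter, chartAt_coe]; rfl

@[simp] theorem chartCenter_infty : chartCenter OnePoint.infty = 0 := by
  rw [chartCenter, chartAt_infty]; rfl

@[simp] theorem localCoord_self (x : RiemannSphere) : localCoord x x = 0 := sub_self _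

theorem localCoord_coe_coe (z w : ℂ) : localCoord (z : RiemannSphere) w = w - z := by
  rw [localCoord, chartAt_coe, chartCenter_coe]; rfl

theorem localCoord_infty_coe (z : ℂ) : localCoord OnePoint.infty (z : RiemannSphere) = z⁻¹ := by
  rw [localCoord, chartAt_infty, chartCenter_infty, sub_zero, chartInfty_apply]
  rcases eq_or_ne z 0 with rfl | hz
  · simp
  · rw [invFun_coe hz, coord_coe]

theorem chartAt_target (x : RiemannSphere) : (chartAt ℂ x).target = univ := by
  induction x using OnePoint.rec with
  | infty =>
    rw [chartAt_infty]
    simp [chartInfty, chartZero, inversion]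
  | coe z => rw [chartAt_coe]; rfl

theorem chartInv_chartCenter (x : RiemannSphere) : chartInv x (chartCenter x) = x :=
  (chartAt ℂ x).left_inv (mem_chart_source ℂ x)

theorem chartAt_chartInv (x : RiemannSphere) (z : ℂ) : chartAt ℂ x (chartInv x z) = z :=
  (chartAt ℂ x).right_inv (by rw [chartAt_target]; trivial)

theorem localCoord_chartInv (x : RiemannSphere) (z : ℂ) :
    localCoord x (chartInv x z) = z - chartCenter x := by
  rw [localCoord, chartAt_chartInv]

theorem chartInv_injective (x : RiemannSphere) : Function.Injective (chartInv x) :=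
  Function.LeftInverse.injective (chartAt_chartInv x)

theorem chartInv_eq_iff {x : RiemannSphere} {z : ℂ} : chartInv x z = x ↔ z = chartCenter x :=
  ⟨fun h => chartInv_injective x (h.trans (chartInv_chartCenter x).symm),
    fun h => h ▸ chartInv_chartCenter x⟩

theorem map_chartInv_nhds (x : RiemannSphere) :
    Filter.map (chartInv x) (𝓝 (chartCenter x)) = 𝓝 x := by
  have h := (chartAt ℂ x).symm.map_nhds_eq (x := chartCenter x)
    (by rw [OpenPartialHomeomorph.symm_source, chartAt_target]; trivial)
  rwa [show (chartAt ℂ x).symm (chartCenter x) = x from chartInv_chartCenter x] at h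

theorem eventually_nhds_iff {x : RiemannSphere} {P : RiemannSphere → Prop} :
    (∀ᶠ y in 𝓝 x, P y) ↔ ∀ᶠ z in 𝓝 (chartCenter x), P (chartInv x z) := by
  rw [← map_chartInv_nhds]; rfl

theorem eventually_nhdsNE_iff {x : RiemannSphere} {P : RiemannSphere → Prop} :
    (∀ᶠ y in 𝓝[≠] x, P y) ↔ ∀ᶠ z in 𝓝[≠] (chartCenter x), P (chartInv x z) := by
  rw [eventually_nhdsWithin_iff, eventually_nhdsWithin_iff, eventually_nhds_iff]
  simp only [mem_compl_iff, mem_singleton_iff, chartInv_eq_iff]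

theorem eventually_nhds_coe_iff {z : ℂ} {P : RiemannSphere → Prop} :
    (∀ᶠ y in 𝓝 (z : RiemannSphere), P y) ↔ ∀ᶠ w : ℂ in 𝓝 z, P w := by
  simp only [eventually_nhds_iff, chartInv_coe, chartCenter_coe]

theorem eventually_nhds_infty_of_coe_ne_zero {P : RiemannSphere → Prop} (h : P OnePoint.infty)
    (h' : ∀ z : ℂ, z ≠ 0 → P z) : ∀ᶠ y in 𝓝 (OnePoint.infty : RiemannSphere), P y := by
  filter_upwards [isOpen_ne.mem_nhds (OnePoint.infty_ne_coe (0 : ℂ))] with y hy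
  induction y using OnePoint.rec with
  | infty => exact h
  | coe z => exact h' z fun hz => hy (congrArg _ hz)

theorem eventually_cofinite_coe {P : RiemannSphere → Prop} (h : ∀ z : ℂ, P z) :
    ∀ᶠ y in Filter.cofinite, P y := by
  filter_upwards [(Set.finite_singleton (OnePoint.infty : RiemannSphere)).compl_mem_cofinite]
    with y hy
  induction y using OnePoint.rec with
  | infty => exact absurd rfl hy
  | coe z => exact h z

instance nhdsNE_neBot (x : RiemannSphere) : (𝓝[≠] x).NeBot := by
  refine ⟨fun h => ?_⟩
  have hfalse : ∀ᶠ _ in 𝓝[≠] x, False := by rw [h]; trivial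
  exact (eventually_nhdsNE_iff.1 hfalse).exists.elim fun _ h => h

/-- Holomorphy of a vector-valued function near a point of the Riemann sphere. -/
abbrev HolAt {F : Type*} [NormedAddCommGroup F] [NormedSpace ℂ F] (g : RiemannSphere → F)
    (x : RiemannSphere) : Prop :=
  ContMDiffAt 𝓘(ℂ, ℂ) 𝓘(ℂ, F) ω g x

section HolAt

variable {F G : Type*} [NormedAddCommGroup F] [NormedSpace ℂ F] [NormedAddCommGroup G]
  [NormedSpace ℂ G] {ι : Type*} {x : RiemannSphere}

theorem holAt_iff [CompleteSpace F] {g : RiemannSphere → F} :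
    HolAt g x ↔ AnalyticAt ℂ (fun z => g (chartInv x z)) (chartCenter x) := by
  rw [HolAt, contMDiffAt_iff_source]
  simp only [mfld_simps, range_id, contMDiffWithinAt_univ, contMDiffAt_iff_contDiffAt]
  rw [ContDiffAt, contDiffWithinAt_omega_iff_analyticWithinAt, analyticWithinAt_univ]
  rfl

namespace HolAt

theorem eventually {g : RiemannSphere → F} (h : HolAt g x) : ∀ᶠ y in 𝓝 x, HolAt g y :=
  (contMDiffAt_iff_contMDiffAt_nhds (by simp)).1 h

theorem linearMap_comp [FiniteDimensional ℂ F] (B : F →ₗ[ℂ] G) {g : RiemannSphere → F}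
    (h : HolAt g x) : HolAt (fun y => B (g y)) x :=
  B.toContinuousLinearMap.contMDiff.contMDiffAt.comp x h

theorem smul {c : RiemannSphere → ℂ} {g : RiemannSphere → F} (hc : HolAt c x) (hg : HolAt g x) :
    HolAt (fun y => c y • g y) x :=
  ContMDiffAt.smul hc hg

theorem mul {g h : RiemannSphere → ℂ} (hg : HolAt g x) (hh : HolAt h x) :
    HolAt (fun y => g y * h y) x :=
  hg.smul hh

theorem add {g h : RiemannSphere → F} (hg : HolAt g x) (hh : HolAt h x) :
    HolAt (fun y => g y + h y) x :=
  ContMDiffAt.add hg hh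

theorem inv {g : RiemannSphere → ℂ} (h : HolAt g x) (h0 : g x ≠ 0) :
    HolAt (fun y => (g y)⁻¹) x := by
  rw [holAt_iff] at h ⊢
  exact h.inv (by rwa [chartInv_chartCenter])

theorem det [Fintype ι] [DecidableEq ι] {M : RiemannSphere → Matrix ι ι ℂ}
    (h : ∀ i j, HolAt (fun y => M y i j) x) : HolAt (fun y => (M y).det) x := by
  simp only [Matrix.det_apply']
  exact ContMDiffAt.sum fun σ _ =>
    HolAt.mul contMDiffAt_const (ContMDiffAt.prod fun i _ => h (σ i) i)

theorem adjugate [Fintype ι] [DecidableEq ι] {M : RiemannSphere → Matrix ι ι ℂ}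
    (h : ∀ i j, HolAt (fun y => M y i j) x) (i j : ι) :
    HolAt (fun y => (M y).adjugate i j) x := by
  simp only [Matrix.adjugate_apply]
  refine HolAt.det fun k l => ?_
  rcases eq_or_ne k j with rfl | hk
  · simpa only [Matrix.updateRow_self] using contMDiffAt_const
  · simpa only [Matrix.updateRow_ne hk] using h k l

theorem matrix_inv [Fintype ι] [DecidableEq ι] {M : RiemannSphere → Matrix ι ι ℂ}
    (h : ∀ i j, HolAt (fun y => M y i j) x) (h0 : (M x).det ≠ 0) (i j : ι) :
    HolAt (fun y => (M y)⁻¹ i j) x := by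
  simp only [Matrix.inv_def, Ring.inverse_eq_inv', Matrix.smul_apply]
  exact HolAt.mul ((HolAt.det h).inv h0) (HolAt.adjugate h i j)

theorem eq_zero_of_nhdsNE {g : RiemannSphere → F} (h : HolAt g x)
    (h0 : ∀ᶠ y in 𝓝[≠] x, g y = 0) : g x = 0 :=
  tendsto_nhds_unique ((h.continuousAt.mono_left nhdsWithin_le_nhds).congr' h0) tendsto_const_nhds

theorem exists_eq_localCoord_smul [CompleteSpace F] {g : RiemannSphere → F} (h : HolAt g x)
    (h0 : g x = 0) : ∃ g', HolAt g' x ∧ ∀ᶠ y in 𝓝 x, g y = localCoord x y • g' y := by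
  rw [holAt_iff] at h
  have hord : (1 : ℕ) ≤ analyticOrderAt (fun z => g (chartInv x z)) (chartCenter x) := by
    rw [Nat.cast_one, Order.one_le_iff_ne_zero, analyticOrderAt_ne_zero]
    exact ⟨h, by rwa [chartInv_chartCenter]⟩
  obtain ⟨k, hk, hgk⟩ := (natCast_le_analyticOrderAt h).1 hord
  refine ⟨fun y => k (chartAt ℂ x y), ?_, ?_⟩
  · rw [holAt_iff]
    simpa only [chartAt_chartInv] using hk
  · rw [eventually_nhds_iff]
    filter_upwards [hgk] with z hz
    rw [hz, localCoord_chartInv, chartAt_chartInv, pow_one]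

end HolAt

theorem holAt_coord (z : ℂ) : HolAt coord (z : RiemannSphere) := by
  rw [holAt_iff]
  simp only [chartInv_coe, coord_coe]
  exact analyticAt_id

theorem holAt_localCoord (x : RiemannSphere) : HolAt (localCoord x) x := by
  rw [holAt_iff]
  simp only [localCoord_chartInv]
  exact analyticAt_id.sub analyticAt_const

end HolAt

end RiemannSphere

namespace HolBundle

open RiemannSphere

variable {n r : ℕ}

theorem exists_sectionHolAt_iff_holAt (E : HolBundle.{u} n) (x : RiemannSphere) :
    ∃ Φ : ∀ y, E.fiber y ≃ₗ[ℂ] (Fin n → ℂ), ∀ᶠ x' in 𝓝 x, ∀ s : ∀ y, E.fiber y,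
      E.SectionHolAt s x' ↔ HolAt (fun y => Φ y (s y)) x' := by
  classical
  set e := trivializationAt (Fin n → ℂ) E.fiber x
  have hx : x ∈ e.baseSet := FiberBundle.mem_baseSet_trivializationAt' x
  refine ⟨fun y => if hy : y ∈ e.baseSet then (e.continuousLinearEquivAt ℂ y hy).toLinearEquiv else
    ((trivializationAt (Fin n → ℂ) E.fiber y).continuousLinearEquivAt ℂ y
      (FiberBundle.mem_baseSet_trivializationAt' y)).toLinearEquiv, ?_⟩
  filter_upwards [e.open_baseSet.mem_nhds hx] with x' hx' s
  rw [SectionHolAt, e.contMDiffAt_section_iff hx']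
  refine Filter.EventuallyEq.contMDiffAt_iff ?_
  filter_upwards [e.open_baseSet.mem_nhds hx'] with y hy
  simp [hy]

instance (E : HolBundle.{u} n) (x : RiemannSphere) : FiniteDimensional ℂ (E.fiber x) :=
  (E.exists_sectionHolAt_iff_holAt x).choose x |>.symm.finiteDimensional

theorem finrank_fiber (E : HolBundle.{u} n) (x : RiemannSphere) :
    Module.finrank ℂ (E.fiber x) = n := by
  rw [((E.exists_sectionHolAt_iff_holAt x).choose x).finrank_eq, Module.finrank_fin_fun]

variable {E : HolBundle.{u} n} {x : RiemannSphere}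

namespace SectionHolAt

theorem congr {s s' : ∀ y, E.fiber y} (h : E.SectionHolAt s x) (h' : ∀ᶠ y in 𝓝 x, s' y = s y) :
    E.SectionHolAt s' x := by
  obtain ⟨Φ, hΦ⟩ := E.exists_sectionHolAt_iff_holAt x
  rw [hΦ.self_of_nhds] at h ⊢
  refine h.congr_of_eventuallyEq ?_
  filter_upwards [h'] with y hy
  rw [hy]

theorem eventually {s : ∀ y, E.fiber y} (h : E.SectionHolAt s x) :
    ∀ᶠ y in 𝓝 x, E.SectionHolAt s y := by
  obtain ⟨Φ, hΦ⟩ := E.exists_sectionHolAt_iff_holAt x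
  rw [hΦ.self_of_nhds] at h
  filter_upwards [HolAt.eventually h, hΦ] with y hy hΦy
  exact (hΦy s).2 hy

theorem smul {c : RiemannSphere → ℂ} {s : ∀ y, E.fiber y} (hc : HolAt c x)
    (h : E.SectionHolAt s x) : E.SectionHolAt (fun y => c y • s y) x := by
  obtain ⟨Φ, hΦ⟩ := E.exists_sectionHolAt_iff_holAt x
  rw [hΦ.self_of_nhds] at h ⊢
  simpa only [map_smul] using HolAt.smul hc h

theorem const_smul (c : ℂ) {s : ∀ y, E.fiber y} (h : E.SectionHolAt s x) :
    E.SectionHolAt (fun y => c • s y) x :=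
  smul contMDiffAt_const h

theorem add {s s' : ∀ y, E.fiber y} (h : E.SectionHolAt s x)
    (h' : E.SectionHolAt s' x) : E.SectionHolAt (fun y => s y + s' y) x := by
  obtain ⟨Φ, hΦ⟩ := E.exists_sectionHolAt_iff_holAt x
  rw [hΦ.self_of_nhds] at h h' ⊢
  simpa only [map_add] using HolAt.add h h'

theorem zero : E.SectionHolAt (fun _ => 0) x := by
  obtain ⟨Φ, hΦ⟩ := E.exists_sectionHolAt_iff_holAt x
  rw [hΦ.self_of_nhds]
  simpa only [map_zero] using contMDiffAt_const

theorem sub {s s' : ∀ y, E.fiber y} (h : E.SectionHolAt s x)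
    (h' : E.SectionHolAt s' x) : E.SectionHolAt (fun y => s y - s' y) x := by
  simpa only [neg_one_smul, ← sub_eq_add_neg] using h.add (h'.const_smul (-1))

theorem sum {ι : Type*} {t : Finset ι} {s : ι → ∀ y, E.fiber y}
    (h : ∀ i ∈ t, E.SectionHolAt (s i) x) : E.SectionHolAt (fun y => ∑ i ∈ t, s i y) x := by
  obtain ⟨Φ, hΦ⟩ := E.exists_sectionHolAt_iff_holAt x
  rw [hΦ.self_of_nhds]
  simp only [hΦ.self_of_nhds] at h
  simpa only [map_sum] using ContMDiffAt.sum h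

theorem eq_zero_of_nhdsNE {s : ∀ y, E.fiber y} (h : E.SectionHolAt s x)
    (h0 : ∀ᶠ y in 𝓝[≠] x, s y = 0) : s x = 0 := by
  obtain ⟨Φ, hΦ⟩ := E.exists_sectionHolAt_iff_holAt x
  rw [hΦ.self_of_nhds] at h
  have hΦ0 := HolAt.eq_zero_of_nhdsNE h (by filter_upwards [h0] with y hy; rw [hy, map_zero])
  exact (Φ x).map_eq_zero_iff.1 hΦ0

theorem eq_of_nhdsNE {s s' : ∀ y, E.fiber y} (h : E.SectionHolAt s x) (h' : E.SectionHolAt s' x)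
    (heq : ∀ᶠ y in 𝓝[≠] x, s y = s' y) : s x = s' x :=
  sub_eq_zero.1 <| (h.sub h').eq_zero_of_nhdsNE <| by
    filter_upwards [heq] with y hy using sub_eq_zero.2 hy

theorem exists_eq_localCoord_smul {s : ∀ y, E.fiber y} (h : E.SectionHolAt s x) (h0 : s x = 0) :
    ∃ s', E.SectionHolAt s' x ∧ ∀ᶠ y in 𝓝 x, s y = localCoord x y • s' y := by
  obtain ⟨Φ, hΦ⟩ := E.exists_sectionHolAt_iff_holAt x
  rw [hΦ.self_of_nhds] at h
  obtain ⟨g, hg, hsg⟩ := HolAt.exists_eq_localCoord_smul h (by rw [h0, map_zero])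
  refine ⟨fun y => (Φ y).symm (g y), ?_, ?_⟩
  · rw [hΦ.self_of_nhds]
    simpa only [LinearEquiv.apply_symm_apply] using hg
  · filter_upwards [hsg] with y hy
    rw [← map_smul, ← hy, LinearEquiv.symm_apply_apply]

end SectionHolAt

theorem exists_sectionHolAt_eq (v : E.fiber x) : ∃ s, E.SectionHolAt s x ∧ s x = v := by
  obtain ⟨Φ, hΦ⟩ := E.exists_sectionHolAt_iff_holAt x
  refine ⟨fun y => (Φ y).symm (Φ x v), ?_, LinearEquiv.symm_apply_apply _ _⟩
  rw [hΦ.self_of_nhds]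
  simpa only [LinearEquiv.apply_symm_apply] using contMDiffAt_const

theorem exists_holAt_projection {f : Fin r → ∀ y, E.fiber y} (hf : ∀ i, E.SectionHolAt (f i) x)
    (hli : LinearIndependent ℂ fun i => f i x) :
    ∃ P : ∀ y, E.fiber y →ₗ[ℂ] (Fin r → ℂ),
      (∀ᶠ x' in 𝓝 x, ∀ s, E.SectionHolAt s x' → HolAt (fun y => P y (s y)) x') ∧
      (∀ᶠ x' in 𝓝 x, ∀ i, HolAt (fun y => P y (f i y)) x') ∧
      ∀ i, P x (f i x) = Pi.single i 1 := by
  obtain ⟨Φ, hΦ⟩ := E.exists_sectionHolAt_iff_holAt x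
  have hli' : LinearIndependent ℂ fun i => Φ x (f i x) := hli.map' _ (Φ x).ker
  obtain ⟨B, hB⟩ := (Fintype.linearCombination ℂ
    fun i => Φ x (f i x)).exists_leftInverse_of_injective (LinearMap.ker_eq_bot.2
      (linearIndependent_iff_injective_fintypeLinearCombination.1 hli'))
  have hhol : ∀ᶠ x' in 𝓝 x, ∀ s, E.SectionHolAt s x' → HolAt (fun y => B (Φ y (s y))) x' := by
    filter_upwards [hΦ] with x' hΦx s hs using HolAt.linearMap_comp B ((hΦx s).1 hs)
  refine ⟨fun y => B ∘ₗ (Φ y).toLinearMap, hhol, ?_, fun i => ?_⟩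
  · filter_upwards [hhol, Filter.eventually_all.2 fun i => (hf i).eventually] with x' hx' hfx i
      using hx' _ (hfx i)
  · simpa using LinearMap.congr_fun hB (Pi.single i 1)

theorem exists_coordinates {f : Fin r → ∀ y, E.fiber y} (hf : ∀ i, E.SectionHolAt (f i) x)
    (hli : LinearIndependent ℂ fun i => f i x) :
    ∃ κ : ∀ y, E.fiber y →ₗ[ℂ] (Fin r → ℂ),
      (∀ᶠ y in 𝓝 x, ∀ c : Fin r → ℂ, κ y (∑ i, c i • f i y) = c) ∧
      ∀ᶠ x' in 𝓝 x, ∀ s, E.SectionHolAt s x' → HolAt (fun y => κ y (s y)) x' := by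
  obtain ⟨P, hP, hPf, hPx⟩ := exists_holAt_projection hf hli
  set M : RiemannSphere → Matrix (Fin r) (Fin r) ℂ :=
    fun y => Matrix.of fun i => P y (f i y) with hM
  have hMhol : ∀ᶠ x' in 𝓝 x, ∀ i j, HolAt (fun y => M y i j) x' := by
    filter_upwards [hPf] with x' hx' i using contMDiffAt_pi_space.1 (hx' i)
  have hMx : M x = 1 := by
    ext i j
    change P x (f i x) j = _
    rw [hPx, Pi.single_apply, Matrix.one_apply]
    simp only [eq_comm]
  have hdet : ∀ᶠ y in 𝓝 x, (M y).det ≠ 0 :=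
    (HolAt.det hMhol.self_of_nhds).continuousAt.eventually_ne
      (by rw [hMx, Matrix.det_one]; exact one_ne_zero)
  refine ⟨fun y => (M y)⁻¹.vecMulLinear ∘ₗ P y, ?_, ?_⟩
  · filter_upwards [hdet] with y hy c
    have hPc : P y (∑ i, c i • f i y) = Matrix.vecMul c (M y) := by
      ext j
      simp only [map_sum, map_smul, Finset.sum_apply, Pi.smul_apply, smul_eq_mul, Matrix.vecMul,
        dotProduct, hM, Matrix.of_apply]
    rw [LinearMap.comp_apply, hPc, Matrix.vecMulLinear_apply, Matrix.vecMul_vecMul,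
      Matrix.mul_nonsing_inv _ (isUnit_iff_ne_zero.2 hy), Matrix.vecMul_one]
  · filter_upwards [hdet, hMhol, hP] with x' hdet' hM' hP' s hs
    refine contMDiffAt_pi_space.2 fun j => ?_
    simp only [LinearMap.comp_apply, Matrix.vecMulLinear_apply, Matrix.vecMul, dotProduct]
    exact ContMDiffAt.sum fun k _ =>
      HolAt.mul (contMDiffAt_pi_space.1 (hP' s hs) k) (HolAt.matrix_inv hM' hdet' k j)

theorem eventually_linearIndependent {f : Fin r → ∀ y, E.fiber y}
    (hf : ∀ i, E.SectionHolAt (f i) x) (hli : LinearIndependent ℂ fun i => f i x) :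
    ∀ᶠ y in 𝓝 x, LinearIndependent ℂ fun i => f i y := by
  obtain ⟨κ, hκ, -⟩ := exists_coordinates hf hli
  filter_upwards [hκ] with y hy
  refine Fintype.linearIndependent_iff.2 fun g hg i => ?_
  rw [← hy g, hg, map_zero, Pi.zero_apply]

theorem mem_span_of_nhdsNE {f : Fin r → ∀ y, E.fiber y} (hf : ∀ i, E.SectionHolAt (f i) x)
    (hli : LinearIndependent ℂ fun i => f i x) {s : ∀ y, E.fiber y} (hs : E.SectionHolAt s x)
    (h : ∀ᶠ y in 𝓝[≠] x, s y ∈ Submodule.span ℂ (Set.range fun i => f i y)) :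
    s x ∈ Submodule.span ℂ (Set.range fun i => f i x) := by
  obtain ⟨κ, hκ, hκhol⟩ := exists_coordinates hf hli
  have hsum : E.SectionHolAt (fun y => ∑ i, κ y (s y) i • f i y) x := SectionHolAt.sum fun i _ =>
    SectionHolAt.smul (contMDiffAt_pi_space.1 (hκhol.self_of_nhds s hs) i) (hf i)
  have hsx : s x = ∑ i, κ x (s x) i • f i x := hs.eq_of_nhdsNE hsum (by
    filter_upwards [h, hκ.filter_mono nhdsWithin_le_nhds] with y hy hκy
    obtain ⟨c, hc⟩ := (Submodule.mem_span_range_iff_exists_fun ℂ).1 hy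
    rw [← hc, hκy])
  exact (Submodule.mem_span_range_iff_exists_fun ℂ).2 ⟨_, hsx.symm⟩

namespace IsFrameAt

variable {L : ∀ y, Submodule ℂ (E.fiber y)} {f : Fin r → ∀ y, E.fiber y}

theorem of_linearIndependent (hol : ∀ i, E.SectionHolAt (f i) x)
    (hli : LinearIndependent ℂ fun i => f i x)
    (h : ∀ᶠ y in 𝓝 x, Submodule.span ℂ (Set.range fun i => f i y) = L y) : E.IsFrameAt L f x :=
  ⟨hol, eventually_linearIndependent hol hli, h⟩

theorem mem_of_nhdsNE (h : E.IsFrameAt L f x) {s : ∀ y, E.fiber y} (hs : E.SectionHolAt s x)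
    (h' : ∀ᶠ y in 𝓝[≠] x, s y ∈ L y) : s x ∈ L x := by
  rw [← h.span_eq.self_of_nhds]
  refine mem_span_of_nhdsNE h.hol h.linearIndependent.self_of_nhds hs ?_
  filter_upwards [h', h.span_eq.filter_mono nhdsWithin_le_nhds] with y hy hspan
  rwa [hspan]

theorem eventually (h : E.IsFrameAt L f x) : ∀ᶠ y in 𝓝 x, E.IsFrameAt L f y := by
  filter_upwards [Filter.eventually_all.2 fun i => (h.hol i).eventually,
    h.linearIndependent.eventually_nhds, h.span_eq.eventually_nhds] with y hol hli hspan
  exact ⟨hol, hli, hspan⟩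

end IsFrameAt

end HolBundle

section LinearAlgebra

variable {K F ι : Type*}

theorem exists_coeff_of_mem_span_image [Semiring K] [AddCommMonoid F] [Module K F] [Fintype ι]
    {ℓ : ι → F} {S : Set ι} {v : F} (h : v ∈ Submodule.span K (ℓ '' S)) :
    ∃ c : ι → K, (∀ i, i ∉ S → c i = 0) ∧ v = ∑ i, c i • ℓ i := by
  obtain ⟨c, hc, rfl⟩ := Finsupp.mem_span_image_iff_linearCombination K |>.1 h
  exact ⟨c, (Finsupp.mem_supported' K c).1 hc,
    (Finsupp.linearCombination_apply K c).trans (c.sum_fintype _ fun _ => zero_smul K _)⟩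

theorem coeff_eq_zero_of_mem_span_image [Ring K] [AddCommGroup F] [Module K F] [Fintype ι]
    {ℓ : ι → F} (hℓ : LinearIndependent K ℓ) {S : Set ι} {c : ι → K}
    (h : ∑ i, c i • ℓ i ∈ Submodule.span K (ℓ '' S)) {i : ι} (hi : i ∉ S) : c i = 0 := by
  obtain ⟨c', hc', heq⟩ := exists_coeff_of_mem_span_image h
  rw [linearIndependent_iff_injective_fintypeLinearCombination.1 hℓ heq, hc' i hi]

variable [Field K] [AddCommGroup F] [Module K F]

theorem finrank_span_image [Fintype ι] {ℓ : ι → F} (hℓ : LinearIndependent K ℓ) (S : Set ι)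
    [DecidablePred (· ∈ S)] :
    Module.finrank K (Submodule.span K (ℓ '' S)) = (Finset.univ.filter (· ∈ S)).card := by
  have hS : LinearIndependent K fun i : S => ℓ i := hℓ.comp _ Subtype.val_injective
  rw [Set.image_eq_range, finrank_span_eq_card hS, Fintype.card_subtype]

/-- The linearly independent family `ℓ`, whose member `ℓ i` has level `d i`, spans the filtration
`Λ` in all levels from `e₁` on. -/
structure IsFiltrationBasisFrom (Λ : ℤ → Submodule K F) (e₁ : ℤ) (ℓ : ι → F) (d : ι → ℤ) :
    Prop where
  linearIndependent : LinearIndependent K ℓ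
  le : ∀ i, e₁ ≤ d i
  eq_span : ∀ e, e₁ ≤ e → Λ e = Submodule.span K (ℓ '' {i | e ≤ d i})

namespace IsFiltrationBasisFrom

variable {Λ : ℤ → Submodule K F} {e₁ : ℤ} {ℓ : ι → F} {d : ι → ℤ}

theorem eq_span_range (h : IsFiltrationBasisFrom Λ e₁ ℓ d) :
    Λ e₁ = Submodule.span K (Set.range ℓ) := by
  rw [h.eq_span e₁ le_rfl, Set.eq_univ_of_forall (s := {i | e₁ ≤ d i}) h.le, Set.image_univ]

theorem eq_span_of_eventually_eq (h : IsFiltrationBasisFrom Λ e₁ ℓ d)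
    (hstab : ∀ e, e ≤ e₁ → Λ e = Λ e₁) (e : ℤ) :
    Λ e = Submodule.span K (ℓ '' {i | e ≤ d i}) := by
  rcases le_total e₁ e with he | he
  · exact h.eq_span e he
  · rw [hstab e he, h.eq_span_range, Set.eq_univ_of_forall (s := {i | e ≤ d i})
      fun i => he.trans (h.le i), Set.image_univ]

theorem le_sumElim {κ : Type*} (h : IsFiltrationBasisFrom Λ e₁ ℓ d) :
    ∀ i : ι ⊕ κ, e₁ - 1 ≤ Sum.elim d (fun _ => e₁ - 1) i
  | Sum.inl i => (sub_one_lt e₁).le.trans (h.le i)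
  | Sum.inr _ => le_rfl

theorem sumElim {κ : Type*} (h : IsFiltrationBasisFrom Λ e₁ ℓ d) {c : κ → F}
    (hc : LinearIndependent K c) (hdisj : Disjoint (Λ e₁) (Submodule.span K (Set.range c)))
    (hsup : Λ e₁ ⊔ Submodule.span K (Set.range c) = Λ (e₁ - 1)) :
    IsFiltrationBasisFrom Λ (e₁ - 1) (Sum.elim ℓ c) (Sum.elim d fun _ => e₁ - 1) where
  linearIndependent := h.linearIndependent.sum_type hc (h.eq_span_range ▸ hdisj)
  le := h.le_sumElim
  eq_span e he := by
    rcases he.eq_or_lt with rfl | he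
    · rw [Set.eq_univ_of_forall (s := {i | e₁ - 1 ≤ Sum.elim d (fun _ => e₁ - 1) i}) h.le_sumElim,
        Set.image_univ, Set.Sum.elim_range, Submodule.span_union, ← h.eq_span_range, hsup]
    · rw [h.eq_span e (by lia)]
      congr 1
      ext v
      simp only [mem_image, mem_ofPred_eq, Sum.exists, Sum.elim_inl, Sum.elim_inr, he.not_ge,
        false_and, exists_false, or_false]

end IsFiltrationBasisFrom

theorem exists_isFiltrationBasisFrom [FiniteDimensional K F] {Λ : ℤ → Submodule K F}
    (hΛ : Antitone Λ) {e₀ : ℤ} (h0 : Λ e₀ = ⊥) (e : ℤ) (he : e ≤ e₀) :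
    ∃ (ι : Type) (_ : Fintype ι) (ℓ : ι → F) (d : ι → ℤ), IsFiltrationBasisFrom Λ e ℓ d := by
  induction e, he using Int.leInductionDown with
  | base =>
    refine ⟨Empty, inferInstance, Empty.elim, Empty.elim, linearIndependent_empty_type,
      fun i => i.elim, fun e' he' => ?_⟩
    rw [Set.eq_empty_of_isEmpty {i : Empty | _}, Set.image_empty, Submodule.span_empty]
    exact eq_bot_mono (hΛ he') h0
  | pred e _ ih =>
    obtain ⟨ι, _, ℓ, d, h⟩ := ih
    obtain ⟨Q, hQ⟩ := Submodule.exists_isCompl (Λ e)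
    set C := Q ⊓ Λ (e - 1) with hC
    have hsup : Λ e ⊔ C = Λ (e - 1) := by
      rw [hC, ← sup_inf_assoc_of_le _ (hΛ (sub_one_lt e).le), hQ.sup_eq_top, top_inf_eq]
    obtain ⟨c, -, hspan, hc⟩ := Submodule.exists_fun_fin_finrank_span_eq K (C : Set F)
    replace hspan := hspan.trans C.span_eq
    exact ⟨_, inferInstance, _, _, h.sumElim hc
      (by rw [hspan]; exact hQ.disjoint.mono_right inf_le_left) (by rw [hspan, hsup])⟩

theorem exists_filtration_basis [FiniteDimensional K F] {Λ : ℤ → Submodule K F} (hΛ : Antitone Λ)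
    {e₀ : ℤ} (h0 : Λ e₀ = ⊥) :
    ∃ (r : ℕ) (ℓ : Fin r → F) (d : Fin r → ℤ), LinearIndependent K ℓ ∧
      ∀ e, Λ e = Submodule.span K (ℓ '' {i | e ≤ d i}) := by
  obtain ⟨k, hk⟩ := WellFoundedGT.monotone_chain_condition
    ⟨fun k : ℕ => Λ (e₀ - k), fun a b hab => hΛ (by lia)⟩
  obtain ⟨ι, _, ℓ, d, h⟩ := exists_isFiltrationBasisFrom hΛ h0 (e₀ - k) (by lia)
  let σ := (Fintype.equivFin ι).symm
  refine ⟨Fintype.card ι, ℓ ∘ σ, d ∘ σ, h.linearIndependent.comp _ σ.injective, fun e => ?_⟩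
  have hstab : ∀ e, e ≤ e₀ - k → Λ e = Λ (e₀ - k) := fun e he => by
    have hke : Λ (e₀ - k) = Λ (e₀ - (e₀ - e).toNat) := hk _ (by lia)
    rw [hke, show e₀ - ((e₀ - e).toNat : ℤ) = e by lia]
  rw [h.eq_span_of_eventually_eq hstab, Set.image_comp]
  exact congrArg (fun S => Submodule.span K (ℓ '' S))
    (Set.image_preimage_eq {i | e ≤ d i} σ.surjective).symm

end LinearAlgebra

theorem forall_int_of_forall_ge_of_succ {P : ℤ → Prop} {e₀ : ℤ} (h0 : ∀ e, e₀ ≤ e → P e)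
    (hsucc : ∀ e, P (e + 1) → P e) (e : ℤ) : P e := by
  rcases le_total e₀ e with he | he
  · exact h0 e he
  · induction e, he using Int.leInductionDown with
    | base => exact h0 e₀ le_rfl
    | pred e _ ih => exact hsucc _ (by rwa [sub_add_cancel])

namespace RiemannSphere

/-- The function `z ^ e` on `ℂ`, with the value `1` at `∞`. -/
noncomputable def twistFactor (e : ℤ) (x : RiemannSphere) : ℂ := x.elim 1 fun z => z ^ e

@[simp] theorem twistFactor_infty (e : ℤ) : twistFactor e OnePoint.infty = 1 := rfl

@[simp] theorem twistFactor_coe (e : ℤ) (z : ℂ) : twistFactor e (z : RiemannSphere) = z ^ e := rfl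

theorem twistFactor_ne_zero (e : ℤ) {x : RiemannSphere} (hx : x ≠ ((0 : ℂ) : RiemannSphere)) :
    twistFactor e x ≠ 0 := by
  induction x using OnePoint.rec with
  | infty => exact one_ne_zero
  | coe z => exact zpow_ne_zero _ fun h => hx (congrArg _ h)

theorem twistFactor_add (e e' : ℤ) {x : RiemannSphere} (hx : x ≠ ((0 : ℂ) : RiemannSphere)) :
    twistFactor (e + e') x = twistFactor e x * twistFactor e' x := by
  induction x using OnePoint.rec with
  | infty => exact (one_mul 1).symm
  | coe z => exact zpow_add₀ (fun h => hx (congrArg _ h)) _ _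

theorem eventually_ne_zero_infty :
    ∀ᶠ y in 𝓝 (OnePoint.infty : RiemannSphere), y ≠ ((0 : ℂ) : RiemannSphere) :=
  isOpen_ne.mem_nhds (OnePoint.infty_ne_coe 0)

theorem holAt_twistFactor_natCast (k : ℕ) (z : ℂ) :
    HolAt (twistFactor k) (z : RiemannSphere) := by
  rw [holAt_iff]
  simp only [chartInv_coe, twistFactor_coe, zpow_natCast]
  exact analyticAt_id.pow k

theorem holAt_localCoord_pow (x : RiemannSphere) (k : ℕ) :
    HolAt (fun y => localCoord x y ^ k) x := by
  rw [holAt_iff]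
  simp only [localCoord_chartInv]
  exact (analyticAt_id.sub analyticAt_const).pow k

end RiemannSphere

namespace HolBundle

open RiemannSphere

variable {n r : ℕ} {E : HolBundle.{u} n} {W : ∀ y, Submodule ℂ (E.fiber y)} {e : ℤ}
  {m : ∀ y, E.fiber y}

/-- The section `z ^ e • m` on `ℂ`, with the value of `m` at `∞`. -/
noncomputable def twist (e : ℤ) (m : ∀ y, E.fiber y) : ∀ y, E.fiber y :=
  fun y => twistFactor e y • m y

theorem twist_apply (e : ℤ) (m : ∀ y, E.fiber y) (y : RiemannSphere) :
    twist e m y = twistFactor e y • m y := rfl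

theorem twist_coe (e : ℤ) (m : ∀ y, E.fiber y) (z : ℂ) : twist e m z = z ^ e • m z := rfl

@[simp] theorem twist_infty (e : ℤ) (m : ∀ y, E.fiber y) :
    twist e m OnePoint.infty = m OnePoint.infty := one_smul ℂ _

variable (E W e) in
/-- The holomorphic sections of `E` on `ℂ` that have order at least `e` at `∞` and generically lie
in `W`; the value at `∞` is the leading coefficient. -/
def sectionSpace : Submodule ℂ (∀ y, E.fiber y) where
  carrier := {m | (∀ z : ℂ, E.SectionHolAt m z) ∧ E.SectionHolAt (twist e m) OnePoint.infty ∧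
    ∀ᶠ y in Filter.cofinite, m y ∈ W y}
  add_mem' := by
    rintro a b ⟨hol, hinf, hW⟩ ⟨hol', hinf', hW'⟩
    refine ⟨fun z => (hol z).add (hol' z), ?_, ?_⟩
    · refine (hinf.add hinf').congr (Filter.Eventually.of_forall fun y => ?_)
      simp only [twist_apply, Pi.add_apply, smul_add]
    · filter_upwards [hW, hW'] with y h h' using add_mem h h'
  zero_mem' := by
    refine ⟨fun z => SectionHolAt.zero, ?_, Filter.Eventually.of_forall fun y => zero_mem _⟩
    exact SectionHolAt.zero.congr (Filter.Eventually.of_forall fun y => smul_zero _)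
  smul_mem' := by
    rintro c a ⟨hol, hinf, hW⟩
    refine ⟨fun z => (hol z).const_smul c, ?_, ?_⟩
    · refine (hinf.const_smul c).congr (Filter.Eventually.of_forall fun y => ?_)
      simp only [twist_apply, Pi.smul_apply, smul_comm c]
    · filter_upwards [hW] with y h using Submodule.smul_mem _ _ h

open Classical in
theorem update_infty_mem_sectionSpace {e' : ℤ} (h : m ∈ E.sectionSpace W e)
    {v : E.fiber OnePoint.infty}
    (h' : E.SectionHolAt (twist e' (Function.update m OnePoint.infty v)) OnePoint.infty) :
    Function.update m OnePoint.infty v ∈ E.sectionSpace W e' := by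
  refine ⟨fun z => (h.1 z).congr ?_, h', ?_⟩
  · rw [eventually_nhds_coe_iff]
    exact Filter.Eventually.of_forall fun w => Function.update_of_ne (OnePoint.coe_ne_infty w) _ _
  · filter_upwards [h.2.2, (Set.finite_singleton OnePoint.infty).compl_mem_cofinite] with y hy hne
    rwa [Function.update_of_ne hne]

open Classical in
theorem exists_mem_sectionSpace_succ (h : m ∈ E.sectionSpace W e) (h0 : m OnePoint.infty = 0) :
    ∃ m' ∈ E.sectionSpace W (e + 1), ∀ z : ℂ, m' z = m z := by
  obtain ⟨s, hs, hms⟩ := h.2.1.exists_eq_localCoord_smul (by rwa [twist_infty])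
  refine ⟨_, update_infty_mem_sectionSpace (v := s OnePoint.infty) h (hs.congr ?_),
    fun z => Function.update_of_ne (OnePoint.coe_ne_infty z) _ _⟩
  filter_upwards [hms, eventually_ne_zero_infty] with y hy h0
  induction y using OnePoint.rec with
  | infty => rw [twist_infty, Function.update_self]
  | coe z =>
    have hz : z ≠ 0 := fun h => h0 (congrArg _ h)
    rw [localCoord_infty_coe, twist_coe] at hy
    rw [twist_coe, Function.update_of_ne (OnePoint.coe_ne_infty z), zpow_add_one₀ hz, mul_comm,
      mul_smul, hy, smul_inv_smul₀ hz]

open Classical in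
theorem update_zero_pow_mem_sectionSpace (k : ℕ) (h : m ∈ E.sectionSpace W (e + k)) :
    Function.update m OnePoint.infty ((0 : ℂ) ^ k • m OnePoint.infty) ∈ E.sectionSpace W e := by
  refine update_infty_mem_sectionSpace h
    ((SectionHolAt.smul (holAt_localCoord_pow OnePoint.infty k) h.2.1).congr ?_)
  refine eventually_nhds_infty_of_coe_ne_zero ?_ fun z hz => ?_
  · rw [twist_infty, twist_infty, Function.update_self, localCoord_self]
  · rw [twist_coe, twist_coe, Function.update_of_ne (OnePoint.coe_ne_infty z),
      localCoord_infty_coe, smul_smul, mul_comm, zpow_add₀ hz, zpow_natCast, mul_assoc, inv_pow,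
      mul_inv_cancel₀ (pow_ne_zero _ hz), mul_one]

theorem twist_mem_sectionSpace (k : ℕ) (h : m ∈ E.sectionSpace W (e + k)) :
    twist k m ∈ E.sectionSpace W e := by
  refine ⟨fun z => SectionHolAt.smul (holAt_twistFactor_natCast k z) (h.1 z), h.2.1.congr ?_, ?_⟩
  · filter_upwards [eventually_ne_zero_infty] with y h0
    rw [twist_apply, twist_apply, twist_apply, twistFactor_add _ _ h0, mul_smul]
  · filter_upwards [h.2.2] with y hy using Submodule.smul_mem _ _ hy

theorem SectionHolAt.inv_coord_sub_smul {z z₀ : ℂ} (hz : z ≠ z₀) (h : E.SectionHolAt m z) :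
    E.SectionHolAt (fun y => (coord y - z₀)⁻¹ • m y) z :=
  SectionHolAt.smul (HolAt.inv (ContMDiffAt.sub (holAt_coord z) contMDiffAt_const)
    (sub_ne_zero.2 hz)) h

open Classical in
theorem SectionHolAt.twist_succ_inv_coord_sub_smul (z₀ : ℂ)
    (h : E.SectionHolAt (twist e m) OnePoint.infty) :
    E.SectionHolAt (twist (e + 1) (Function.update (fun y => (coord y - z₀)⁻¹ • m y) OnePoint.infty
      (m OnePoint.infty))) OnePoint.infty := by
  have hfactor : HolAt (fun y => (1 + -z₀ * localCoord OnePoint.infty y)⁻¹) OnePoint.infty :=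
    HolAt.inv (HolAt.add contMDiffAt_const (HolAt.mul contMDiffAt_const (holAt_localCoord _)))
      (by rw [localCoord_self, mul_zero, add_zero]; exact one_ne_zero)
  refine (SectionHolAt.smul hfactor h).congr
    (eventually_nhds_infty_of_coe_ne_zero ?_ fun z hz => ?_)
  · rw [twist_infty, twist_infty, Function.update_self, localCoord_self, mul_zero, add_zero,
      inv_one, one_smul]
  · have hid : 1 + -z₀ * z⁻¹ = (z - z₀) * z⁻¹ := by
      rw [sub_mul, mul_inv_cancel₀ hz, neg_mul, sub_eq_add_neg]
    rw [twist_coe, twist_coe, Function.update_of_ne (OnePoint.coe_ne_infty z), coord_coe,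
      localCoord_infty_coe, hid, smul_smul, smul_smul, mul_inv, inv_inv, zpow_add_one₀ hz]
    congr 1
    ring

open Classical in
theorem exists_div_mem_sectionSpace {z₀ : ℂ} (h : m ∈ E.sectionSpace W e) (h0 : m z₀ = 0) :
    ∃ m' ∈ E.sectionSpace W (e + 1), m' OnePoint.infty = m OnePoint.infty := by
  obtain ⟨s, hs, hms⟩ := (h.1 z₀).exists_eq_localCoord_smul h0
  set m₁ : ∀ y, E.fiber y :=
    Function.update (fun y => (coord y - z₀)⁻¹ • m y) OnePoint.infty (m OnePoint.infty) with hm₁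
  have hm₁coe : ∀ w : ℂ, m₁ w = (w - z₀)⁻¹ • m w :=
    fun w => Function.update_of_ne (OnePoint.coe_ne_infty w) _ _
  have hinf : (OnePoint.infty : RiemannSphere) ≠ z₀ := OnePoint.infty_ne_coe z₀
  refine ⟨Function.update m₁ z₀ (s z₀), ⟨fun z => ?_, ?_, ?_⟩, ?_⟩
  · rcases eq_or_ne z z₀ with rfl | hz
    · refine hs.congr (eventually_nhds_coe_iff.2 ?_)
      filter_upwards [eventually_nhds_coe_iff.1 hms] with w hw
      rcases eq_or_ne w z with rfl | hwz
      · rw [Function.update_self]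
      · rw [Function.update_of_ne (by simpa using hwz), hm₁coe, hw, localCoord_coe_coe,
          inv_smul_smul₀ (sub_ne_zero.2 hwz)]
    · refine ((h.1 z).inv_coord_sub_smul hz).congr (eventually_nhds_coe_iff.2 ?_)
      filter_upwards [isOpen_ne.mem_nhds hz] with w hw
      rw [Function.update_of_ne (by simpa using hw), hm₁coe, coord_coe]
  · refine (h.2.1.twist_succ_inv_coord_sub_smul z₀).congr ?_
    filter_upwards [isOpen_ne.mem_nhds hinf] with y hy
    rw [twist_apply, twist_apply, Function.update_of_ne hy]
  · filter_upwards [h.2.2, (Set.finite_singleton OnePoint.infty).compl_mem_cofinite,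
      (Set.finite_singleton (z₀ : RiemannSphere)).compl_mem_cofinite] with y hy hne hne'
    rw [Function.update_of_ne hne', hm₁, Function.update_of_ne hne]
    exact Submodule.smul_mem _ _ hy
  · rw [Function.update_of_ne hinf, hm₁, Function.update_self]

theorem sectionSpace_eq_zero (h : m ∈ E.sectionSpace W e)
    (h0 : ∀ᶠ y in Filter.cofinite, m y = 0) : m = 0 := by
  funext y
  have hy : ∀ᶠ y' in 𝓝[≠] y, m y' = 0 := h0.filter_mono (nhdsNE_le_cofinite y)
  induction y using OnePoint.rec with
  | infty =>
    rw [← twist_infty e m]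
    refine h.2.1.eq_zero_of_nhdsNE ?_
    filter_upwards [hy] with y hy
    rw [twist_apply, hy, smul_zero]
  | coe z => exact (h.1 z).eq_zero_of_nhdsNE hy

theorem sectionSpace_eq_zero_of_coe (h : m ∈ E.sectionSpace W e) (h0 : ∀ z : ℂ, m z = 0) :
    m = 0 :=
  sectionSpace_eq_zero h (eventually_cofinite_coe h0)

end HolBundle

namespace HolBundle

open RiemannSphere

/-- `b` is a holomorphic frame of `L` on `ℂ`, and the sections `z ^ d i • b i` form one at `∞`: so
`L` is the direct sum of the line bundles `𝒪(d i)` spanned by the `b i`. -/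
structure IsSplitFrame {n r : ℕ} (E : HolBundle.{u} n) (L : ∀ y, Submodule ℂ (E.fiber y))
    (b : Fin r → ∀ y, E.fiber y) (d : Fin r → ℤ) : Prop where
  coe : ∀ z : ℂ, E.IsFrameAt L b z
  infty : E.IsFrameAt L (fun i => twist (d i) (b i)) OnePoint.infty

variable {n r : ℕ} {E : HolBundle.{u} n} {L W : ∀ y, Submodule ℂ (E.fiber y)}
  {b : Fin r → ∀ y, E.fiber y} {d : Fin r → ℤ} {e : ℤ}

theorem mem_span_range_apply (b : Fin r → ∀ y, E.fiber y) (i : Fin r) (y : RiemannSphere) :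
    b i y ∈ Submodule.span ℂ (Set.range fun i => b i y) :=
  Submodule.subset_span ⟨i, rfl⟩

theorem span_range_twist (b : Fin r → ∀ y, E.fiber y) (d : Fin r → ℤ) {y : RiemannSphere}
    (hy : y ≠ ((0 : ℂ) : RiemannSphere)) :
    Submodule.span ℂ (Set.range fun i => twist (d i) (b i) y) =
      Submodule.span ℂ (Set.range fun i => b i y) := by
  refine le_antisymm (Submodule.span_le.2 ?_) (Submodule.span_le.2 ?_)
  · rintro _ ⟨i, rfl⟩
    exact Submodule.smul_mem _ _ (mem_span_range_apply b i y)
  · rintro _ ⟨i, rfl⟩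
    rw [SetLike.mem_coe, ← Submodule.smul_mem_iff _ (twistFactor_ne_zero (d i) hy)]
    exact mem_span_range_apply (fun i => twist (d i) (b i)) i y

theorem isSplitFrame_span (hcoe : ∀ i (z : ℂ), E.SectionHolAt (b i) z)
    (hinf : ∀ i, E.SectionHolAt (twist (d i) (b i)) OnePoint.infty)
    (hli : ∀ y, LinearIndependent ℂ fun i => b i y) :
    E.IsSplitFrame (fun y => Submodule.span ℂ (Set.range fun i => b i y)) b d where
  coe z := IsFrameAt.of_linearIndependent (fun i => hcoe i z) (hli z)
    (Filter.Eventually.of_forall fun y => rfl)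
  infty := by
    refine IsFrameAt.of_linearIndependent hinf (by simpa using hli OnePoint.infty) ?_
    filter_upwards [eventually_ne_zero_infty] with y hy using span_range_twist b d hy

theorem isSplitFrame_bot (E : HolBundle.{u} n) :
    E.IsSplitFrame (fun _ => ⊥) (fun i : Fin 0 => i.elim0) (fun i => i.elim0) := by
  simpa using isSplitFrame_span (E := E) (b := fun i : Fin 0 => i.elim0) (d := fun i => i.elim0)
    (fun i => i.elim0) (fun i => i.elim0) (fun y => linearIndependent_empty_type)

namespace IsSplitFrame

theorem linearIndependent (h : E.IsSplitFrame L b d) (y : RiemannSphere) :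
    LinearIndependent ℂ fun i => b i y := by
  induction y using OnePoint.rec with
  | infty => simpa using h.infty.linearIndependent.self_of_nhds
  | coe z => exact (h.coe z).linearIndependent.self_of_nhds

theorem span_eq (h : E.IsSplitFrame L b d) (y : RiemannSphere) :
    Submodule.span ℂ (Set.range fun i => b i y) = L y := by
  induction y using OnePoint.rec with
  | infty => simpa using h.infty.span_eq.self_of_nhds
  | coe z => exact (h.coe z).span_eq.self_of_nhds

theorem finrank_eq (h : E.IsSplitFrame L b d) (y : RiemannSphere) :
    Module.finrank ℂ (L y) = r := by
  rw [← h.span_eq, finrank_span_eq_card (h.linearIndependent y), Fintype.card_fin]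

theorem single (h : E.IsSplitFrame L b d) (i : Fin r) :
    E.IsSplitFrame (fun y => Submodule.span ℂ (Set.range fun _ : Fin 1 => b i y))
      (fun _ : Fin 1 => b i) (fun _ => d i) :=
  isSplitFrame_span (fun _ z => (h.coe z).hol i) (fun _ => h.infty.hol i) fun y =>
    (h.linearIndependent y).comp (fun _ : Fin 1 => i) (Function.injective_of_subsingleton _)

/-- The sub-bundle with a given split frame. -/
def subbundle (h : E.IsSplitFrame L b d) : E.Subbundle r where
  toSubmodule := L
  exists_frame x := by
    induction x using OnePoint.rec with
    | infty => exact ⟨_, h.infty⟩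
    | coe z => exact ⟨_, h.coe z⟩

end IsSplitFrame

variable (E W e) in
/-- The leading coefficients at `∞` of the sections of order at least `e`. -/
def leadingSpace : Submodule ℂ (E.fiber OnePoint.infty) :=
  (E.sectionSpace W e).map (LinearMap.proj OnePoint.infty)

theorem mem_leadingSpace {m : ∀ y, E.fiber y} (hm : m ∈ E.sectionSpace W e) :
    m OnePoint.infty ∈ E.leadingSpace W e :=
  ⟨m, hm, rfl⟩

theorem antitone_leadingSpace : Antitone (E.leadingSpace W) := by
  rintro e e' he _ ⟨m, hm, rfl⟩
  refine ⟨twist (e' - e).toNat m, twist_mem_sectionSpace _ ?_, twist_infty _ _⟩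
  rwa [show e + ((e' - e).toNat : ℤ) = e' by lia]

theorem leadingSpace_eq_bot (h : E.sectionSpace W e = ⊥) : E.leadingSpace W e = ⊥ := by
  rw [leadingSpace, h, Submodule.map_bot]

variable (E W e) in
open Classical in
/-- The inclusion of the sections of order at least `e + 1` in those of order at least `e`; it
resets the value at `∞`, since that value encodes the coefficient of order exactly `e`. -/
noncomputable def sectionInclusion : E.sectionSpace W (e + 1) →ₗ[ℂ] E.sectionSpace W e where
  toFun m := ⟨Function.update m.1 OnePoint.infty 0, by
    simpa using update_zero_pow_mem_sectionSpace (m := m.1) (e := e) 1 (by simp)⟩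
  map_add' a b := Subtype.ext <| by
    simpa using Function.update_add a.1 b.1 OnePoint.infty 0 0
  map_smul' c a := Subtype.ext <| by
    simpa using Function.update_smul c a.1 OnePoint.infty 0

open Classical in
theorem sectionInclusion_coe (m : E.sectionSpace W (e + 1)) (z : ℂ) :
    (E.sectionInclusion W e m).1 z = m.1 z :=
  Function.update_of_ne (OnePoint.coe_ne_infty z) _ _

open Classical in
theorem sectionInclusion_infty (m : E.sectionSpace W (e + 1)) :
    (E.sectionInclusion W e m).1 OnePoint.infty = 0 :=
  Function.update_self OnePoint.infty _ m.1

theorem sectionInclusion_injective : Function.Injective (E.sectionInclusion W e) := by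
  rw [← LinearMap.ker_eq_bot, LinearMap.ker_eq_bot']
  intro m hm
  refine Subtype.ext (sectionSpace_eq_zero_of_coe m.2 fun z => ?_)
  rw [← sectionInclusion_coe, hm]
  rfl

variable (E W e) in
/-- The leading coefficient at `∞` of a section of order at least `e`. -/
def leadingCoeff : E.sectionSpace W e →ₗ[ℂ] E.fiber OnePoint.infty :=
  (LinearMap.proj OnePoint.infty).comp (E.sectionSpace W e).subtype

theorem range_leadingCoeff : LinearMap.range (E.leadingCoeff W e) = E.leadingSpace W e := by
  rw [leadingCoeff, LinearMap.range_comp, Submodule.range_subtype]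
  rfl

theorem ker_leadingCoeff :
    LinearMap.ker (E.leadingCoeff W e) = LinearMap.range (E.sectionInclusion W e) := by
  ext m
  rw [LinearMap.mem_range, LinearMap.mem_ker]
  constructor
  · intro h0
    obtain ⟨m', hm', heq⟩ := exists_mem_sectionSpace_succ m.2 h0
    refine ⟨⟨m', hm'⟩, Subtype.ext (funext fun y => ?_)⟩
    induction y using OnePoint.rec with
    | infty => exact (sectionInclusion_infty _).trans h0.symm
    | coe z => exact (sectionInclusion_coe _ _).trans (heq z)
  · rintro ⟨m', rfl⟩
    exact sectionInclusion_infty m'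

theorem finiteDimensional_sectionSpace_of_succ
    [FiniteDimensional ℂ (E.sectionSpace W (e + 1))] :
    FiniteDimensional ℂ (E.sectionSpace W e) := by
  have hker : FiniteDimensional ℂ (LinearMap.ker (E.leadingCoeff W e)) := by
    rw [ker_leadingCoeff]
    infer_instance
  have hquot : FiniteDimensional ℂ (E.sectionSpace W e ⧸ LinearMap.ker (E.leadingCoeff W e)) :=
    (E.leadingCoeff W e).quotKerEquivRange.symm.finiteDimensional
  exact Module.Finite.of_submodule_quotient (LinearMap.ker (E.leadingCoeff W e))

theorem finrank_sectionSpace_of_succ [FiniteDimensional ℂ (E.sectionSpace W (e + 1))] :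
    Module.finrank ℂ (E.sectionSpace W e) =
      Module.finrank ℂ (E.sectionSpace W (e + 1)) + Module.finrank ℂ (E.leadingSpace W e) := by
  have := finiteDimensional_sectionSpace_of_succ (E := E) (W := W) (e := e)
  rw [← (E.leadingCoeff W e).finrank_range_add_finrank_ker, range_leadingCoeff, ker_leadingCoeff,
    LinearMap.finrank_range_of_inj sectionInclusion_injective, add_comm]

/-- Sections `b i` of order at least `d i` whose leading coefficients form a basis adapted to the
filtration of the fibre at `∞` by the leading spaces. -/
structure IsLeadingBasis (E : HolBundle.{u} n) (W : ∀ y, Submodule ℂ (E.fiber y))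
    (b : Fin r → ∀ y, E.fiber y) (d : Fin r → ℤ) : Prop where
  mem : ∀ i, b i ∈ E.sectionSpace W (d i)
  linearIndependent_infty : LinearIndependent ℂ fun i => b i OnePoint.infty
  leadingSpace_eq : ∀ e,
    E.leadingSpace W e = Submodule.span ℂ ((fun i => b i OnePoint.infty) '' {i | e ≤ d i})

theorem exists_isLeadingBasis {e₀ : ℤ} (h0 : E.sectionSpace W e₀ = ⊥) :
    ∃ (r : ℕ) (b : Fin r → ∀ y, E.fiber y) (d : Fin r → ℤ), E.IsLeadingBasis W b d := by
  obtain ⟨r, ℓ, d, hℓ, hspan⟩ :=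
    exists_filtration_basis (E.antitone_leadingSpace (W := W)) (leadingSpace_eq_bot h0)
  have hmem : ∀ i, ℓ i ∈ E.leadingSpace W (d i) := fun i => by
    rw [hspan]
    exact Submodule.subset_span ⟨i, le_refl (d i), rfl⟩
  choose b hb hbℓ using hmem
  obtain rfl : (fun i => b i OnePoint.infty) = ℓ := funext hbℓ
  exact ⟨r, b, d, hb, hℓ, hspan⟩

namespace IsLeadingBasis

open Classical in
theorem exists_sum_mem_sectionSpace (h : E.IsLeadingBasis W b d) {c : Fin r → ℂ} {k : Fin r → ℕ}
    (hk : ∀ i, c i ≠ 0 → d i = e + k i) :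
    ∃ s ∈ E.sectionSpace W e, (∀ z : ℂ, s z = ∑ i, c i • b i z) ∧
      s OnePoint.infty = ∑ i, (c i * 0 ^ k i) • b i OnePoint.infty := by
  set b' : Fin r → ∀ y, E.fiber y := fun i =>
    Function.update (b i) OnePoint.infty ((0 : ℂ) ^ k i • b i OnePoint.infty) with hb'
  refine ⟨∑ i, c i • b' i, Submodule.sum_mem _ fun i _ => ?_, fun z => ?_, ?_⟩
  · rcases eq_or_ne (c i) 0 with hi | hi
    · rw [hi, zero_smul]
      exact zero_mem _
    · exact Submodule.smul_mem _ _
        (update_zero_pow_mem_sectionSpace _ (hk i hi ▸ h.mem i))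
  · simp only [hb', Finset.sum_apply, Pi.smul_apply,
      Function.update_of_ne (OnePoint.coe_ne_infty z)]
  · simp only [hb', Finset.sum_apply, Pi.smul_apply, Function.update_self, mul_smul]

/-- A linear relation between the `b i z` gives a section of the lowest order `d i₀` involved that
vanishes at `z`. Dividing by the coordinate raises its order without changing its leading
coefficient, which therefore lies in the next leading space and has no `i₀` component. -/
theorem linearIndependent_coe (h : E.IsLeadingBasis W b d) (z : ℂ) :
    LinearIndependent ℂ fun i => b i z := by
  rw [Fintype.linearIndependent_iff]
  by_contra! hcon
  obtain ⟨c, hc, i₁, hi₁⟩ := hcon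
  obtain ⟨i₀, hi₀, hmin⟩ := Finset.exists_min_image (Finset.univ.filter fun i => c i ≠ 0) d
    ⟨i₁, by simpa using hi₁⟩
  simp only [Finset.mem_filter, Finset.mem_univ, true_and] at hi₀ hmin
  obtain ⟨s, hs, hsz, hsinf⟩ := h.exists_sum_mem_sectionSpace (e := d i₀) (c := c)
    (k := fun i => (d i - d i₀).toNat) fun i hi => by have := hmin i hi; lia
  obtain ⟨m, hm, hminf⟩ := exists_div_mem_sectionSpace hs ((hsz z).trans hc)
  have hlead := mem_leadingSpace hm
  rw [hminf, hsinf, h.leadingSpace_eq] at hlead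
  have hzero := coeff_eq_zero_of_mem_span_image h.linearIndependent_infty hlead (i := i₀) (by simp)
  rw [sub_self, Int.toNat_zero, pow_zero, mul_one] at hzero
  exact hi₀ hzero

theorem isSplitFrame (h : E.IsLeadingBasis W b d) :
    E.IsSplitFrame (fun y => Submodule.span ℂ (Set.range fun i => b i y)) b d := by
  refine isSplitFrame_span (fun i => (h.mem i).1) (fun i => (h.mem i).2.1) fun y => ?_
  induction y using OnePoint.rec with
  | infty => exact h.linearIndependent_infty
  | coe z => exact h.linearIndependent_coe z

theorem exists_twist_sum (h : E.IsLeadingBasis W b d) {v : E.fiber OnePoint.infty}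
    (hv : v ∈ E.leadingSpace W e) :
    ∃ s ∈ E.sectionSpace W e, s OnePoint.infty = v ∧
      ∀ y, s y ∈ Submodule.span ℂ (Set.range fun i => b i y) := by
  rw [h.leadingSpace_eq] at hv
  obtain ⟨c, hc, rfl⟩ := exists_coeff_of_mem_span_image hv
  refine ⟨∑ i, c i • twist (d i - e).toNat (b i), Submodule.sum_mem _ fun i _ => ?_, ?_,
    fun y => ?_⟩
  · by_cases hi : e ≤ d i
    · refine Submodule.smul_mem _ _ (twist_mem_sectionSpace _ ?_)
      rw [show e + ((d i - e).toNat : ℤ) = d i by lia]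
      exact h.mem i
    · rw [hc i hi, zero_smul]
      exact zero_mem _
  · simp only [Finset.sum_apply, Pi.smul_apply, twist_infty]
  · rw [Finset.sum_apply]
    exact Submodule.sum_mem _ fun i _ =>
      Submodule.smul_mem _ _ (Submodule.smul_mem _ _ (mem_span_range_apply b i y))

theorem apply_mem_span {e₀ : ℤ} (h : E.IsLeadingBasis W b d)
    (h0 : ∀ e, e₀ ≤ e → E.sectionSpace W e = ⊥) (e : ℤ) :
    ∀ m ∈ E.sectionSpace W e, ∀ y, m y ∈ Submodule.span ℂ (Set.range fun i => b i y) := by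
  induction e using forall_int_of_forall_ge_of_succ (e₀ := e₀) with
  | h0 e he =>
    intro m hm y
    rw [h0 e he, Submodule.mem_bot] at hm
    rw [hm]
    exact zero_mem _
  | hsucc e ih =>
    intro m hm y
    obtain ⟨s, hs, hsinf, hspan⟩ := h.exists_twist_sum (mem_leadingSpace hm)
    have hsub : (m - s) OnePoint.infty = 0 := by rw [Pi.sub_apply, hsinf, sub_self]
    obtain ⟨m', hm', heq⟩ := exists_mem_sectionSpace_succ (sub_mem hm hs) hsub
    rw [← Submodule.sub_mem_iff_left _ (hspan y), ← Pi.sub_apply]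
    induction y using OnePoint.rec with
    | infty => rw [hsub]; exact zero_mem _
    | coe z => rw [← heq]; exact ih m' hm' z

theorem lt_of_sectionSpace_eq_bot {e₀ : ℤ} (h : E.IsLeadingBasis W b d)
    (h0 : ∀ e, e₀ ≤ e → E.sectionSpace W e = ⊥) (i : Fin r) : d i < e₀ := by
  by_contra! hle
  have hmem := mem_leadingSpace (h.mem i)
  rw [leadingSpace_eq_bot (h0 _ hle), Submodule.mem_bot] at hmem
  exact h.linearIndependent_infty.ne_zero i hmem

theorem finrank_leadingSpace (h : E.IsLeadingBasis W b d) (e : ℤ) :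
    Module.finrank ℂ (E.leadingSpace W e) = ∑ i, if e ≤ d i then 1 else 0 := by
  classical
  rw [h.leadingSpace_eq, finrank_span_image h.linearIndependent_infty, Finset.card_filter]
  rfl

theorem finiteDimensional_and_finrank {e₀ : ℤ} (h : E.IsLeadingBasis W b d)
    (h0 : ∀ e, e₀ ≤ e → E.sectionSpace W e = ⊥) (e : ℤ) :
    FiniteDimensional ℂ (E.sectionSpace W e) ∧
      Module.finrank ℂ (E.sectionSpace W e) = ∑ i, (d i - e + 1).toNat := by
  induction e using forall_int_of_forall_ge_of_succ (e₀ := e₀) with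
  | h0 e he =>
    rw [h0 e he, finrank_bot]
    refine ⟨inferInstance, (Finset.sum_eq_zero fun i _ => ?_).symm⟩
    have := h.lt_of_sectionSpace_eq_bot h0 i
    lia
  | hsucc e ih =>
    obtain ⟨_, ih⟩ := ih
    refine ⟨finiteDimensional_sectionSpace_of_succ, ?_⟩
    rw [finrank_sectionSpace_of_succ, ih, h.finrank_leadingSpace, ← Finset.sum_add_distrib]
    refine Finset.sum_congr rfl fun i _ => ?_
    split_ifs <;> lia

end IsLeadingBasis

theorem exists_isSplitFrame {e₀ : ℤ} (h0 : ∀ e, e₀ ≤ e → E.sectionSpace W e = ⊥) :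
    ∃ (r : ℕ) (b : Fin r → ∀ y, E.fiber y) (d : Fin r → ℤ) (L : ∀ y, Submodule ℂ (E.fiber y)),
      E.IsSplitFrame L b d ∧ (∀ i, b i ∈ E.sectionSpace W (d i)) ∧
      (∀ e, ∀ m ∈ E.sectionSpace W e, ∀ y, m y ∈ L y) ∧
      (∀ e, FiniteDimensional ℂ (E.sectionSpace W e)) ∧
      ∀ e, Module.finrank ℂ (E.sectionSpace W e) = ∑ i, (d i - e + 1).toNat := by
  obtain ⟨r, b, d, h⟩ := exists_isLeadingBasis (h0 e₀ le_rfl)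
  exact ⟨r, b, d, _, h.isSplitFrame, h.mem, h.apply_mem_span h0,
    fun e => (h.finiteDimensional_and_finrank h0 e).1,
    fun e => (h.finiteDimensional_and_finrank h0 e).2⟩

end HolBundle

section Liouville

theorem tendsto_cobounded_of_eventuallyEq_nhdsNE {f g : ℂ → ℂ} {a : ℂ} (hf : Continuous f)
    (hfg : ∀ z, f =ᶠ[𝓝[≠] z] g) (hg : Filter.Tendsto g (Bornology.cobounded ℂ) (𝓝 a)) :
    Filter.Tendsto f (Bornology.cobounded ℂ) (𝓝 a) := by
  refine Metric.nhds_basis_closedBall.tendsto_right_iff.2 fun ε hε => ?_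
  obtain ⟨R, -, hR⟩ := (Metric.hasBasis_cobounded_compl_closedBall (0 : ℂ)).eventually_iff.1
    (hg.eventually (Metric.closedBall_mem_nhds a hε))
  refine (Metric.hasBasis_cobounded_compl_closedBall (0 : ℂ)).eventually_iff.2
    ⟨R, trivial, fun z hz => ?_⟩
  have hlim : Filter.Tendsto f (𝓝[≠] z) (𝓝 (f z)) := hf.continuousAt.mono_left nhdsWithin_le_nhds
  refine Metric.isClosed_closedBall.mem_of_tendsto hlim ?_
  filter_upwards [hfg z, nhdsWithin_le_nhds (Metric.isClosed_closedBall.isOpen_compl.mem_nhds hz)]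
    with w hw hwR
  rw [hw]
  exact hR hwR

theorem meromorphicOrderAt_eq_top_of_nonneg {h : ℂ → ℂ} (hm : ∀ z, MeromorphicAt h z)
    (h0 : ∀ z, 0 ≤ meromorphicOrderAt h z)
    (hinf : 0 < meromorphicOrderAt (fun w => h w⁻¹) 0) (z : ℂ) : meromorphicOrderAt h z = ⊤ := by
  set k := toMeromorphicNFOn h univ
  have hkh : ∀ z, k =ᶠ[𝓝[≠] z] h := fun z =>
    MeromorphicOn.toMeromorphicNFOn_eq_self_on_nhdsNE (fun z _ => hm z) (mem_univ z)
  have hdiff : Differentiable ℂ k := fun z => by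
    have hNF : MeromorphicNFAt k z := meromorphicNFOn_toMeromorphicNFOn h univ (mem_univ z)
    refine (hNF.meromorphicOrderAt_nonneg_iff_analyticAt.1 ?_).differentiableAt
    rw [meromorphicOrderAt_congr (hkh z)]
    exact h0 z
  have hlim : Filter.Tendsto h (Bornology.cobounded ℂ) (𝓝 0) := by
    simpa only [Function.comp_def, inv_inv] using
      (tendsto_zero_of_meromorphicOrderAt_pos hinf).comp (Filter.tendsto_inv₀_cobounded' (α := ℂ))
  have hklim := tendsto_cobounded_of_eventuallyEq_nhdsNE hdiff.continuous hkh hlim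
  rw [Metric.cobounded_eq_cocompact] at hklim
  rw [meromorphicOrderAt_eq_top_iff]
  filter_upwards [hkh z] with w hw
  rw [← hw, hdiff.apply_eq_of_tendsto_cocompact w hklim]

theorem meromorphicOrderAt_inv_sub (x : ℂ) :
    meromorphicOrderAt (fun w : ℂ => w⁻¹ - x) 0 = (-1 : ℤ) := by
  rw [meromorphicOrderAt_eq_int_iff (by fun_prop)]
  refine ⟨fun w => 1 - x * w, by fun_prop, by simp, ?_⟩
  filter_upwards [self_mem_nhdsWithin] with w (hw : w ≠ 0)
  rw [sub_zero, zpow_neg_one, smul_eq_mul, mul_sub, mul_one, mul_left_comm, inv_mul_cancel₀ hw,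
    mul_one]

theorem meromorphicAt_inv_sub_zpow (x : ℂ) (n : ℤ) :
    MeromorphicAt (fun w : ℂ => (w⁻¹ - x) ^ n) 0 :=
  MeromorphicAt.zpow (f := fun w : ℂ => w⁻¹ - x) (by fun_prop) n

theorem meromorphicOrderAt_inv_sub_zpow (x : ℂ) (n : ℤ) :
    meromorphicOrderAt (fun w : ℂ => (w⁻¹ - x) ^ n) 0 = (-n : ℤ) := by
  rw [fun_meromorphicOrderAt_zpow (by fun_prop), meromorphicOrderAt_inv_sub, ← WithTop.coe_mul,
    mul_neg_one]

theorem exists_meromorphic_of_divisor (k : ℂ →₀ ℤ) :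
    ∃ f : ℂ → ℂ, (∀ z, MeromorphicAt f z) ∧ (∀ z, meromorphicOrderAt f z = k z) ∧
      MeromorphicAt (fun w => f w⁻¹) 0 ∧
      meromorphicOrderAt (fun w => f w⁻¹) 0 = (-(k.sum fun _ n => n) : ℤ) := by
  have hprod : ∏ᶠ u, (fun z : ℂ => z - u) ^ k u = fun z => ∏ u ∈ k.support, (z - u) ^ k u := by
    rw [finprod_eq_prod_of_mulSupport_subset (s := k.support) _
      (by rw [Function.FactorizedRational.mulSupport, Finsupp.fun_support_eq])]
    ext z
    rw [Finset.prod_apply]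
    rfl
  refine ⟨∏ᶠ u, (· - u) ^ k u, fun z => Function.FactorizedRational.meromorphicNFOn_univ k
    |>.meromorphicOn z (mem_univ z), fun z => Function.FactorizedRational.meromorphicOrderAt_eq k
      k.hasFiniteSupport, ?_, ?_⟩
  · rw [hprod]
    exact MeromorphicAt.fun_prod fun x _ => meromorphicAt_inv_sub_zpow x _
  · rw [hprod, meromorphicOrderAt_fun_prod fun x _ => meromorphicAt_inv_sub_zpow x _]
    simp only [meromorphicOrderAt_inv_sub_zpow, Finsupp.sum, ← Finset.sum_neg_distrib]
    norm_cast

theorem meromorphicOrderAt_eq_top_of_divisor {g : ℂ → ℂ} (hm : ∀ z, MeromorphicAt g z)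
    (k : ℂ →₀ ℤ) (hk : ∀ z, ((-k z : ℤ) : WithTop ℤ) ≤ meromorphicOrderAt g z)
    (hminf : MeromorphicAt (fun w => g w⁻¹) 0)
    (hinf : ((k.sum fun _ n => n : ℤ) : WithTop ℤ) < meromorphicOrderAt (fun w => g w⁻¹) 0)
    (z : ℂ) : meromorphicOrderAt g z = ⊤ := by
  obtain ⟨f, hf, hford, hfinf, hfinford⟩ := exists_meromorphic_of_divisor k
  have hmul := meromorphicOrderAt_eq_top_of_nonneg (h := fun z => g z * f z)
    (fun z => (hm z).mul (hf z)) (fun z => ?_) ?_ z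
  · rw [fun_meromorphicOrderAt_mul (hm z) (hf z), hford, WithTop.add_eq_top] at hmul
    exact hmul.resolve_right WithTop.coe_ne_top
  · rw [fun_meromorphicOrderAt_mul (hm z) (hf z), hford]
    calc (0 : WithTop ℤ) = ((-k z : ℤ) : WithTop ℤ) + (k z : ℤ) := by norm_cast; simp
      _ ≤ _ := by gcongr; exact hk z
  · rw [fun_meromorphicOrderAt_mul hminf hfinf, hfinford]
    calc (0 : WithTop ℤ) = (k.sum fun _ n => n : ℤ) + (-(k.sum fun _ n => n) : ℤ) := by
          norm_cast; simp
      _ < _ := WithTop.add_lt_add_right WithTop.coe_ne_top hinf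

end Liouville

namespace HolBundle

open RiemannSphere

theorem merAt_coe_iff {g : RiemannSphere → ℂ} {z : ℂ} :
    MerAt g z ↔ MeromorphicAt (fun w : ℂ => g w) z := by
  change MeromorphicAt (fun w => g (chartInv z w)) (chartCenter z) ↔ _
  simp only [chartInv_coe, chartCenter_coe]

theorem orderAt_coe (g : RiemannSphere → ℂ) (z : ℂ) :
    orderAt g z = meromorphicOrderAt (fun w : ℂ => g w) z := by
  change meromorphicOrderAt (fun w => g (chartInv z w)) (chartCenter z) = _
  simp only [chartInv_coe, chartCenter_coe]

theorem comp_chartInv_infty_eventuallyEq (g : RiemannSphere → ℂ) :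
    (fun w => g (chartInv OnePoint.infty w)) =ᶠ[𝓝[≠] 0]
      fun w : ℂ => g ((w⁻¹ : ℂ) : RiemannSphere) := by
  filter_upwards [self_mem_nhdsWithin] with w hw
  rw [chartInv_infty, invFun_coe hw]

theorem merAt_infty_iff {g : RiemannSphere → ℂ} :
    MerAt g OnePoint.infty ↔ MeromorphicAt (fun w : ℂ => g ((w⁻¹ : ℂ) : RiemannSphere)) 0 := by
  change MeromorphicAt (fun w => g (chartInv OnePoint.infty w)) (chartCenter OnePoint.infty) ↔ _
  rw [chartCenter_infty]
  exact MeromorphicAt.meromorphicAt_congr (comp_chartInv_infty_eventuallyEq g)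

theorem orderAt_infty (g : RiemannSphere → ℂ) :
    orderAt g OnePoint.infty =
      meromorphicOrderAt (fun w : ℂ => g ((w⁻¹ : ℂ) : RiemannSphere)) 0 := by
  change meromorphicOrderAt (fun w => g (chartInv OnePoint.infty w))
    (chartCenter OnePoint.infty) = _
  rw [chartCenter_infty]
  exact meromorphicOrderAt_congr (comp_chartInv_infty_eventuallyEq g)

theorem sum_comapDomain_coe_add (k : RiemannSphere →₀ ℤ) :
    ((k.comapDomain ((↑) : ℂ → RiemannSphere) OnePoint.coe_injective.injOn).sum fun _ n => n) +
      k OnePoint.infty = k.sum fun _ n => n := by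
  classical
  have hk : k = Finsupp.single OnePoint.infty (k OnePoint.infty) +
      (k.comapDomain ((↑) : ℂ → RiemannSphere) OnePoint.coe_injective.injOn).mapDomain (↑) := by
    ext x
    rw [Finsupp.add_apply]
    induction x using OnePoint.rec with
    | infty =>
      rw [Finsupp.single_eq_same, Finsupp.mapDomain_of_notMem_range _ _ (by simp), add_zero]
    | coe z =>
      rw [Finsupp.single_eq_of_ne (by simp), Finsupp.mapDomain_apply OnePoint.coe_injective,
        zero_add]
      rfl
  conv_rhs => rw [hk]
  rw [Finsupp.sum_add_index' (by simp) (by simp), Finsupp.sum_single_index rfl,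
    Finsupp.sum_mapDomain_index (by simp) (by simp), add_comm]

theorem orderAt_eq_top_of_divisor {g : RiemannSphere → ℂ} (hm : ∀ x, MerAt g x)
    (k : RiemannSphere →₀ ℤ) (hk : ∀ x, ((-k x : ℤ) : WithTop ℤ) ≤ orderAt g x)
    (hsum : (k.sum fun _ n => n) < 0) (z : ℂ) : orderAt g z = ⊤ := by
  rw [orderAt_coe]
  refine meromorphicOrderAt_eq_top_of_divisor (g := fun w : ℂ => g w)
    (fun w => merAt_coe_iff.1 (hm w)) (k.comapDomain (↑) OnePoint.coe_injective.injOn)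
    (fun w => ?_) (merAt_infty_iff.1 (hm _)) ?_ z
  · rw [← orderAt_coe]
    exact hk w
  · rw [← orderAt_infty]
    refine (WithTop.coe_lt_coe.2 ?_).trans_le (hk OnePoint.infty)
    linarith [sum_comapDomain_coe_add k]

theorem sum_nonneg_of_orderAt_eq {g : RiemannSphere → ℂ} (hm : ∀ x, MerAt g x)
    (D : RiemannSphere →₀ ℤ) (hD : ∀ x, orderAt g x = (-D x : ℤ)) : 0 ≤ D.sum fun _ n => n := by
  by_contra! hlt
  have htop := orderAt_eq_top_of_divisor hm D (fun x => (hD x).ge) hlt 0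
  rw [hD] at htop
  exact WithTop.coe_ne_top htop

theorem sum_orderAt_eq_zero {g : RiemannSphere → ℂ} (hm : ∀ x, MerAt g x)
    (D : RiemannSphere →₀ ℤ) (hD : ∀ x, orderAt g x = D x) : (D.sum fun _ n => n) = 0 := by
  have hle := sum_nonneg_of_orderAt_eq hm (-D) fun x => by
    rw [hD, Finsupp.neg_apply, neg_neg]
  have hge := sum_nonneg_of_orderAt_eq (g := g⁻¹) (fun x => (hm x).inv) D fun x => by
    have hinv : orderAt g⁻¹ x = -orderAt g x := meromorphicOrderAt_inv
    rw [hinv, hD, WithTop.LinearOrderedAddCommGroup.coe_neg]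
  rw [Finsupp.sum_neg_index fun _ => rfl, Finsupp.sum, Finset.sum_neg_distrib] at hle
  exact le_antisymm (neg_nonneg.1 hle) hge

end HolBundle

namespace HolBundle

open RiemannSphere

section Meromorphic

variable {x : RiemannSphere} {g g' : RiemannSphere → ℂ}

theorem HolAt.merAt (h : HolAt g x) : MerAt g x := (holAt_iff.1 h).meromorphicAt

theorem merAt_const (c : ℂ) (x : RiemannSphere) : MerAt (fun _ => c) x :=
  HolAt.merAt contMDiffAt_const

theorem MerAt.congr (h : MerAt g x) (h' : ∀ᶠ y in 𝓝[≠] x, g y = g' y) : MerAt g' x :=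
  MeromorphicAt.congr h (eventually_nhdsNE_iff.1 h')

theorem orderAt_congr (h' : ∀ᶠ y in 𝓝[≠] x, g y = g' y) : orderAt g x = orderAt g' x :=
  meromorphicOrderAt_congr (eventually_nhdsNE_iff.1 h')

theorem orderAt_mul (h : MerAt g x) (h' : MerAt g' x) :
    orderAt (fun y => g y * g' y) x = orderAt g x + orderAt g' x :=
  fun_meromorphicOrderAt_mul h h'

theorem orderAt_inv (g : RiemannSphere → ℂ) (x : RiemannSphere) :
    orderAt (fun y => (g y)⁻¹) x = -orderAt g x :=
  fun_meromorphicOrderAt_inv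

theorem orderAt_prod {ι : Type*} {s : Finset ι} {g : ι → RiemannSphere → ℂ}
    (h : ∀ i ∈ s, MerAt (g i) x) :
    orderAt (fun y => ∏ i ∈ s, g i y) x = ∑ i ∈ s, orderAt (g i) x :=
  meromorphicOrderAt_fun_prod h

theorem MerAt.mul (h : MerAt g x) (h' : MerAt g' x) : MerAt (fun y => g y * g' y) x :=
  MeromorphicAt.mul h h'

theorem MerAt.inv (h : MerAt g x) : MerAt (fun y => (g y)⁻¹) x :=
  MeromorphicAt.inv h

theorem MerAt.sum {ι : Type*} {s : Finset ι} {g : ι → RiemannSphere → ℂ}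
    (h : ∀ i ∈ s, MerAt (g i) x) : MerAt (fun y => ∑ i ∈ s, g i y) x :=
  MeromorphicAt.fun_sum h

theorem MerAt.prod {ι : Type*} {s : Finset ι} {g : ι → RiemannSphere → ℂ}
    (h : ∀ i ∈ s, MerAt (g i) x) : MerAt (fun y => ∏ i ∈ s, g i y) x :=
  MeromorphicAt.fun_prod h

theorem MerAt.det {n : ℕ} {M : RiemannSphere → Matrix (Fin n) (Fin n) ℂ}
    (h : ∀ i j, MerAt (fun y => M y i j) x) : MerAt (fun y => (M y).det) x := by
  simp only [Matrix.det_apply']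
  exact MerAt.sum fun σ _ => (merAt_const _ x).mul (MerAt.prod fun i _ => h _ _)

theorem MerAt.adjugate {n : ℕ} {M : RiemannSphere → Matrix (Fin n) (Fin n) ℂ}
    (h : ∀ i j, MerAt (fun y => M y i j) x) (i j : Fin n) :
    MerAt (fun y => (M y).adjugate i j) x := by
  simp only [Matrix.adjugate_apply]
  refine MerAt.det fun k l => ?_
  rcases eq_or_ne k j with rfl | hk
  · simpa only [Matrix.updateRow_self] using merAt_const _ x
  · simpa only [Matrix.updateRow_ne hk] using h k l

theorem MerAt.matrix_inv {n : ℕ} {M : RiemannSphere → Matrix (Fin n) (Fin n) ℂ}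
    (h : ∀ i j, MerAt (fun y => M y i j) x) (i j : Fin n) : MerAt (fun y => (M y)⁻¹ i j) x := by
  simp only [Matrix.inv_def, Matrix.smul_apply, Ring.inverse_eq_inv', smul_eq_mul]
  exact (MerAt.det h).inv.mul (MerAt.adjugate h i j)

theorem HolAt.orderAt_eq_zero (h : HolAt g x) (h0 : g x ≠ 0) : orderAt g x = 0 :=
  (holAt_iff.1 h).meromorphicNFAt.meromorphicOrderAt_eq_zero_iff.2
    (by simpa only [chartInv_chartCenter] using h0)

theorem HolAt.orderAt_nonneg (h : HolAt g x) : 0 ≤ orderAt g x :=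
  (holAt_iff.1 h).meromorphicOrderAt_nonneg

theorem orderAt_const_one (x : RiemannSphere) : orderAt (fun _ => 1) x = 0 :=
  HolAt.orderAt_eq_zero contMDiffAt_const one_ne_zero

theorem MerAt.eventually_ne_zero (h : MerAt g x) (h0 : orderAt g x ≠ ⊤) :
    ∀ᶠ y in 𝓝[≠] x, g y ≠ 0 :=
  eventually_nhdsNE_iff.2 ((meromorphicOrderAt_ne_top_iff_eventually_ne_zero h).1 h0)

theorem MerAt.exists_holAt_pow_mul (h : MerAt g x) :
    ∃ k : ℕ, HolAt (fun y => localCoord x y ^ k * g y) x := by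
  obtain ⟨k, hk⟩ := h
  refine ⟨k, holAt_iff.2 ?_⟩
  simp only [localCoord_chartInv]
  exact hk

theorem exists_forall_holAt_pow_mul {ι : Type*} [Finite ι] {g : ι → RiemannSphere → ℂ}
    (h : ∀ i, MerAt (g i) x) : ∃ k : ℕ, ∀ i, HolAt (fun y => localCoord x y ^ k * g i y) x := by
  have := Fintype.ofFinite ι
  choose k hk using fun i => (h i).exists_holAt_pow_mul
  refine ⟨∑ i, k i, fun i => ?_⟩
  obtain ⟨l, hl⟩ := exists_add_of_le
    (Finset.single_le_sum (f := k) (fun _ _ => Nat.zero_le _) (Finset.mem_univ i))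
  simp only [hl, add_comm (k i) l, pow_add, mul_assoc]
  exact HolAt.mul (holAt_localCoord_pow x l) (hk i)

theorem eventually_localCoord_ne_zero (x : RiemannSphere) :
    ∀ᶠ y in 𝓝[≠] x, localCoord x y ≠ 0 := by
  rw [eventually_nhdsNE_iff]
  filter_upwards [self_mem_nhdsWithin] with z hz
  rw [localCoord_chartInv]
  exact sub_ne_zero.2 hz

theorem orderAt_localCoord_pow (x : RiemannSphere) (k : ℕ) :
    orderAt (fun y => localCoord x y ^ k) x = (k : ℤ) := by
  change meromorphicOrderAt (fun z => localCoord x (chartInv x z) ^ k) (chartCenter x) = _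
  simp only [localCoord_chartInv]
  simpa only [zpow_natCast] using
    fun_meromorphicOrderAt_zpow_id_sub_const (x := chartCenter x) (n := (k : ℤ))

theorem twistFactor_coe_inv (e : ℤ) (w : ℂ) :
    twistFactor e ((w⁻¹ : ℂ) : RiemannSphere) = (w - 0) ^ (-e) := by
  rw [twistFactor_coe, inv_zpow', sub_zero]

theorem orderAt_twistFactor (e : ℤ) : orderAt (twistFactor e) OnePoint.infty = (-e : ℤ) := by
  simp only [orderAt_infty, twistFactor_coe_inv]
  exact fun_meromorphicOrderAt_zpow_id_sub_const

theorem merAt_twistFactor (e : ℤ) : MerAt (twistFactor e) OnePoint.infty := by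
  simp only [merAt_infty_iff, twistFactor_coe_inv]
  exact MeromorphicAt.zpow (f := fun w : ℂ => w - 0) (by fun_prop) _

end Meromorphic

section Matrix

variable {F : Type*} [AddCommGroup F] [Module ℂ F] {r : ℕ}

theorem sum_matrix_mul_smul (M H : Matrix (Fin r) (Fin r) ℂ) (f : Fin r → F) (i : Fin r) :
    ∑ j, (M * H) i j • f j = ∑ l, M i l • ∑ j, H l j • f j := by
  simp only [Matrix.mul_apply, Finset.sum_smul, Finset.smul_sum, mul_smul]
  exact Finset.sum_comm

theorem sum_diagonal_smul (c : Fin r → ℂ) (f : Fin r → F) (i : Fin r) :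
    ∑ j, Matrix.diagonal c i j • f j = c i • f i := by
  simp only [Matrix.diagonal_apply, ite_smul, zero_smul, Finset.sum_ite_eq, Finset.mem_univ,
    if_true]

theorem det_ne_zero_of_linearIndependent {f f' : Fin r → F} {H : Matrix (Fin r) (Fin r) ℂ}
    (hf' : LinearIndependent ℂ f') (h : ∀ i, f' i = ∑ j, H i j • f j) : H.det ≠ 0 := by
  have hrow : LinearIndependent ℂ H.row :=
    .of_comp (Fintype.linearCombination ℂ f) (by convert hf' using 1; exact (funext h).symm)
  exact ((Matrix.isUnit_iff_isUnit_det H).1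
    (Matrix.linearIndependent_rows_iff_isUnit.1 hrow)).ne_zero

theorem exists_leftInverse_family {b : Fin r → F} (h : LinearIndependent ℂ b) :
    ∃ κ : F →ₗ[ℂ] (Fin r → ℂ), ∀ c, κ (∑ i, c i • b i) = c := by
  obtain ⟨κ, hκ⟩ := (Fintype.linearCombination ℂ b).exists_leftInverse_of_injective
    (LinearMap.ker_eq_bot.2 (linearIndependent_iff_injective_fintypeLinearCombination.1 h))
  exact ⟨κ, LinearMap.congr_fun hκ⟩

end Matrix

variable {n r : ℕ} {E : HolBundle.{u} n} {L : ∀ y, Submodule ℂ (E.fiber y)} {x : RiemannSphere}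
  {s : Fin r → ∀ y, E.fiber y} {k : ℤ}

theorem IsFrameAt.exists_transition {f f' : Fin r → ∀ y, E.fiber y} (hf : E.IsFrameAt L f x)
    (hf' : E.IsFrameAt L f' x) :
    ∃ H : RiemannSphere → Matrix (Fin r) (Fin r) ℂ, (∀ i j, HolAt (fun y => H y i j) x) ∧
      (∀ᶠ y in 𝓝 x, ∀ i, f' i y = ∑ j, H y i j • f j y) ∧ (H x).det ≠ 0 := by
  obtain ⟨κ, hκ, hκhol⟩ := exists_coordinates hf.hol hf.linearIndependent.self_of_nhds
  have heq : ∀ᶠ y in 𝓝 x, ∀ i, f' i y = ∑ j, κ y (f' i y) j • f j y := by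
    filter_upwards [hκ, hf.span_eq, hf'.span_eq] with y hκ hspan hspan' i
    obtain ⟨c, hc⟩ := (Submodule.mem_span_range_iff_exists_fun ℂ).1
      (hspan.trans hspan'.symm ▸ mem_span_range_apply f' i y)
    rw [← hc, hκ]
  exact ⟨fun y => Matrix.of fun i => κ y (f' i y),
    fun i => contMDiffAt_pi_space.1 (hκhol.self_of_nhds _ (hf'.hol i)), heq,
    det_ne_zero_of_linearIndependent hf'.linearIndependent.self_of_nhds heq.self_of_nhds⟩

theorem HasDetOrderAt.exists_of_frame (h : E.HasDetOrderAt L s x k)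
    {f : Fin r → ∀ y, E.fiber y} (hf : E.IsFrameAt L f x) :
    ∃ M : RiemannSphere → Matrix (Fin r) (Fin r) ℂ, (∀ i j, MerAt (fun y => M y i j) x) ∧
      (∀ᶠ y in 𝓝[≠] x, ∀ i, s i y = ∑ j, M y i j • f j y) ∧
      orderAt (fun y => (M y).det) x = k := by
  obtain ⟨f', M, hf', hM, hs, hord⟩ := h
  obtain ⟨H, hH, hfH, hdet⟩ := hf.exists_transition hf'
  refine ⟨fun y => M y * H y, fun i j => ?_, ?_, ?_⟩
  · simp only [Matrix.mul_apply]
    exact MerAt.sum fun l _ => (hM i l).mul (HolAt.merAt (hH l j))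
  · filter_upwards [hs, hfH.filter_mono nhdsWithin_le_nhds] with y hs hfH i
    simp only [sum_matrix_mul_smul, hs i, ← hfH]
  · simp only [Matrix.det_mul]
    rw [orderAt_mul (MerAt.det hM) (HolAt.merAt (HolAt.det hH)), hord,
      HolAt.orderAt_eq_zero (HolAt.det hH) hdet, add_zero]

theorem IsFrameAt.hasDetOrderAt_of_eq_smul {f : Fin r → ∀ y, E.fiber y} (hf : E.IsFrameAt L f x)
    {g : Fin r → RiemannSphere → ℂ} (hg : ∀ i, MerAt (g i) x)
    (hs : ∀ᶠ y in 𝓝[≠] x, ∀ i, s i y = g i y • f i y) (hk : ∑ i, orderAt (g i) x = k) :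
    E.HasDetOrderAt L s x k := by
  refine ⟨f, fun y => Matrix.diagonal fun i => g i y, hf, fun i j => ?_, ?_, ?_⟩
  · rcases eq_or_ne i j with rfl | hij
    · simpa only [Matrix.diagonal_apply_eq] using hg i
    · simpa only [Matrix.diagonal_apply_ne _ hij] using merAt_const 0 x
  · filter_upwards [hs] with y hy i
    rw [hy, sum_diagonal_smul]
  · simp only [Matrix.det_diagonal]
    rw [orderAt_prod fun i _ => hg i, hk]

section TwistFactor

variable {y : RiemannSphere}

theorem twistFactor_zero (y : RiemannSphere) : twistFactor 0 y = 1 := by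
  induction y using OnePoint.rec with
  | infty => rfl
  | coe z => exact zpow_zero z

theorem twistFactor_sum {ι : Type*} (s : Finset ι) (d : ι → ℤ)
    (hy : y ≠ ((0 : ℂ) : RiemannSphere)) :
    twistFactor (∑ i ∈ s, d i) y = ∏ i ∈ s, twistFactor (d i) y := by
  classical
  induction s using Finset.induction_on with
  | empty => exact twistFactor_zero y
  | insert a s ha ih => rw [Finset.prod_insert ha, Finset.sum_insert ha, twistFactor_add _ _ hy, ih]

end TwistFactor

namespace IsSplitFrame

variable {b : Fin r → ∀ y, E.fiber y} {d : Fin r → ℤ} {κ : ∀ y, E.fiber y →ₗ[ℂ] (Fin r → ℂ)}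

theorem orderAt_det_coe (h : E.IsSplitFrame L b d) (hκ : ∀ y c, κ y (∑ i, c i • b i y) = c)
    {z : ℂ} (hs : E.HasDetOrderAt L s z k) :
    MerAt (fun y => (Matrix.of fun i => κ y (s i y)).det) z ∧
      orderAt (fun y => (Matrix.of fun i => κ y (s i y)).det) z = k := by
  obtain ⟨M, hM, hsM, hord⟩ := hs.exists_of_frame (h.coe z)
  have heq : ∀ᶠ y in 𝓝[≠] (z : RiemannSphere),
      (M y).det = (Matrix.of fun i => κ y (s i y)).det := by
    filter_upwards [hsM] with y hy
    congr 1
    ext i j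
    rw [Matrix.of_apply, hy, hκ]
  exact ⟨(MerAt.det hM).congr heq, (orderAt_congr heq).symm.trans hord⟩

theorem orderAt_det_infty (h : E.IsSplitFrame L b d) (hκ : ∀ y c, κ y (∑ i, c i • b i y) = c)
    (hs : E.HasDetOrderAt L s OnePoint.infty k) :
    MerAt (fun y => (Matrix.of fun i => κ y (s i y)).det) OnePoint.infty ∧
      orderAt (fun y => (Matrix.of fun i => κ y (s i y)).det) OnePoint.infty =
        (k - ∑ i, d i : ℤ) := by
  obtain ⟨M, hM, hsM, hord⟩ := hs.exists_of_frame h.infty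
  have heq : ∀ᶠ y in 𝓝[≠] (OnePoint.infty : RiemannSphere),
      (M y).det * twistFactor (∑ i, d i) y = (Matrix.of fun i => κ y (s i y)).det := by
    filter_upwards [hsM, eventually_ne_zero_infty.filter_mono nhdsWithin_le_nhds] with y hy h0
    have hmul : (Matrix.of fun i => κ y (s i y)) =
        M y * Matrix.diagonal fun i => twistFactor (d i) y := by
      ext i j
      simp only [Matrix.mul_diagonal, Matrix.of_apply, hy, twist_apply, smul_smul, hκ]
    rw [hmul, Matrix.det_mul, Matrix.det_diagonal, twistFactor_sum _ _ h0]
  refine ⟨((MerAt.det hM).mul (merAt_twistFactor _)).congr heq, ?_⟩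
  rw [← orderAt_congr heq, orderAt_mul (MerAt.det hM) (merAt_twistFactor _), hord,
    orderAt_twistFactor, sub_eq_add_neg, WithTop.coe_add]

/-- In the frame `b` the coefficients of a meromorphic frame `s` form a meromorphic matrix on all of
`ℂℙ¹`, whose determinant is a function, so that its divisor has degree zero. -/
theorem sum_eq (h : E.IsSplitFrame L b d) {D : RiemannSphere →₀ ℤ} (hD : E.IsDetDivisor L r D) :
    (D.sum fun _ k => k) = ∑ i, d i := by
  classical
  obtain ⟨s, hs⟩ := hD
  choose κ hκ using fun y => exists_leftInverse_family (h.linearIndependent y)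
  have hzero := sum_orderAt_eq_zero (g := fun y => (Matrix.of fun i => κ y (s i y)).det)
    (fun x => by
      induction x using OnePoint.rec with
      | infty => exact (h.orderAt_det_infty hκ (hs _)).1
      | coe z => exact (h.orderAt_det_coe hκ (hs z)).1)
    (D - Finsupp.single OnePoint.infty (∑ i, d i)) fun x => by
      induction x using OnePoint.rec with
      | infty => rw [(h.orderAt_det_infty hκ (hs _)).2, Finsupp.sub_apply, Finsupp.single_eq_same]
      | coe z =>
        rw [(h.orderAt_det_coe hκ (hs z)).2, Finsupp.sub_apply,
          Finsupp.single_eq_of_ne (OnePoint.coe_ne_infty z), sub_zero]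
  rw [Finsupp.sum_sub_index fun _ _ _ => rfl, Finsupp.sum_single_index rfl] at hzero
  exact sub_eq_zero.1 hzero

theorem isDetDivisor (h : E.IsSplitFrame L b d) :
    E.IsDetDivisor L r (Finsupp.single OnePoint.infty (∑ i, d i)) := by
  classical
  refine ⟨b, fun x => ?_⟩
  induction x using OnePoint.rec with
  | infty =>
    refine h.infty.hasDetOrderAt_of_eq_smul (fun i => merAt_twistFactor (-d i)) ?_ ?_
    · filter_upwards [eventually_ne_zero_infty.filter_mono nhdsWithin_le_nhds] with y hy i
      rw [twist_apply, smul_smul, ← twistFactor_add _ _ hy, neg_add_cancel, twistFactor_zero,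
        one_smul]
    · simp only [orderAt_twistFactor, neg_neg, Finsupp.single_eq_same]
      norm_cast
  | coe z =>
    refine (h.coe z).hasDetOrderAt_of_eq_smul (fun _ => merAt_const 1 _)
      (Filter.Eventually.of_forall fun y i => (one_smul ℂ _).symm) ?_
    simp only [orderAt_const_one, Finset.sum_const_zero,
      Finsupp.single_eq_of_ne (OnePoint.coe_ne_infty z), WithTop.coe_zero]

theorem subDegree_eq (h : E.IsSplitFrame L b d) : E.subDegree L r = ∑ i, d i := by
  have hex : ∃ D, E.IsDetDivisor L r D := ⟨_, h.isDetDivisor⟩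
  rw [subDegree, dif_pos hex]
  exact h.sum_eq hex.choose_spec

end IsSplitFrame

end HolBundle

theorem exists_finsupp_of_eventually_cofinite {X M : Type*} [Zero M] {P : X → M → Prop}
    (h : ∀ x, ∃ k, P x k) (h0 : ∀ᶠ x in Filter.cofinite, P x 0) : ∃ K : X →₀ M, ∀ x, P x (K x) := by
  classical
  choose k hk using h
  refine ⟨.ofSupportFinite (fun x => if P x 0 then 0 else k x)
    (Set.Finite.subset h0 fun x hne hx => hne (if_pos hx)), fun x => ?_⟩
  rw [Finsupp.ofSupportFinite_coe]
  split_ifs with hx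
  exacts [hx, hk x]

section LinearCombination

variable {F : Type*} [AddCommGroup F] [Module ℂ F] {r : ℕ} {f t : Fin r → F}
  {M : Matrix (Fin r) (Fin r) ℂ}

theorem sum_vecMul_smul (c : Fin r → ℂ) (M : Matrix (Fin r) (Fin r) ℂ) (f : Fin r → F) :
    ∑ j, Matrix.vecMul c M j • f j = ∑ i, c i • ∑ j, M i j • f j := by
  simp only [Matrix.vecMul, dotProduct, Finset.sum_smul, Finset.smul_sum, mul_smul]
  exact Finset.sum_comm

theorem linearIndependent_of_det_ne_zero (hf : LinearIndependent ℂ f)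
    (ht : ∀ i, t i = ∑ j, M i j • f j) (hM : M.det ≠ 0) : LinearIndependent ℂ t := by
  rw [Fintype.linearIndependent_iff]
  intro c hc
  simp only [ht, ← sum_vecMul_smul] at hc
  have hcM : Matrix.vecMul c M = 0 := funext (Fintype.linearIndependent_iff.1 hf _ hc)
  exact congrFun (Matrix.eq_zero_of_vecMul_eq_zero hM hcM)

theorem sum_inv_smul (ht : ∀ i, t i = ∑ j, M i j • f j) (hM : M.det ≠ 0) (j : Fin r) :
    ∑ i, M⁻¹ j i • t i = f j := by
  simp only [ht, ← HolBundle.sum_matrix_mul_smul,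
    Matrix.nonsing_inv_mul _ (isUnit_iff_ne_zero.2 hM), Matrix.one_apply, ite_smul, one_smul,
    zero_smul, Finset.sum_ite_eq, Finset.mem_univ, if_true]

theorem coordinates_eq_vecMul_inv (ht : ∀ i, t i = ∑ j, M i j • f j) (hM : M.det ≠ 0)
    {κ Ψ : F →ₗ[ℂ] (Fin r → ℂ)} (hκ : ∀ c, κ (∑ i, c i • f i) = c)
    (hΨ : ∀ c, Ψ (∑ i, c i • t i) = c) {v : F} (hv : v ∈ Submodule.span ℂ (Set.range f)) :
    Ψ v = Matrix.vecMul (κ v) M⁻¹ := by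
  obtain ⟨c, rfl⟩ := (Submodule.mem_span_range_iff_exists_fun ℂ).1 hv
  rw [hκ, ← hΨ (Matrix.vecMul c M⁻¹), sum_vecMul_smul]
  simp only [sum_inv_smul ht hM]

end LinearCombination

namespace RiemannSphere

theorem eventually_nhdsNE_nhds {x : RiemannSphere} {P : RiemannSphere → Prop}
    (h : ∀ᶠ y in 𝓝[≠] x, P y) : ∀ᶠ y in 𝓝[≠] x, ∀ᶠ y' in 𝓝 y, P y' := by
  filter_upwards [eventually_eventually_nhdsWithin.2 h, self_mem_nhdsWithin] with y hy hyx
  rwa [isOpen_compl_singleton.nhdsWithin_eq hyx] at hy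

theorem eventually_cofinite_of_forall_nhdsNE {P : RiemannSphere → Prop}
    (h : ∀ x, ∀ᶠ y in 𝓝[≠] x, P y) : ∀ᶠ y in Filter.cofinite, P y := by
  obtain ⟨t, ht⟩ := CompactSpace.elim_nhds_subcover (fun x => {y | y ≠ x → P y}) fun x =>
    eventually_nhdsWithin_iff.1 (h x)
  refine t.finite_toSet.subset fun y hy => ?_
  obtain ⟨x, hx, hyx⟩ := mem_iUnion₂.1 (ht.ge (mem_univ y))
  rwa [by_contra fun hne : y ≠ x => hy (hyx hne)]

end RiemannSphere

namespace HolBundle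

open RiemannSphere

variable {n : ℕ} {E : HolBundle.{u} n} {x : RiemannSphere}

section Extension

theorem holAt_twistFactor (e : ℤ) {z : ℂ} (hz : z ≠ 0) :
    HolAt (twistFactor e) (z : RiemannSphere) := by
  rw [holAt_iff]
  simp only [chartInv_coe, twistFactor_coe, chartCenter_coe]
  exact analyticAt_id.zpow hz

variable {s s₀ σ : ∀ y, E.fiber y} {e : ℤ}

theorem SectionHolAt.of_twist {z : ℂ} (hz : z ≠ 0) (h : E.SectionHolAt (twist e s) z) :
    E.SectionHolAt s z := by
  refine (SectionHolAt.smul (holAt_twistFactor (-e) hz) h).congr ?_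
  have hne : (z : RiemannSphere) ≠ ((0 : ℂ) : RiemannSphere) := OnePoint.coe_injective.ne hz
  filter_upwards [isOpen_ne.mem_nhds hne] with y hy
  rw [twist_apply, smul_smul, ← twistFactor_add _ _ hy, neg_add_cancel, twistFactor_zero, one_smul]

theorem SectionHolAt.eventually_of_eq_nhdsNE (hσ : E.SectionHolAt σ x)
    (h : ∀ᶠ y in 𝓝[≠] x, σ y = s₀ y) : ∀ᶠ y in 𝓝[≠] x, E.SectionHolAt s₀ y := by
  filter_upwards [hσ.eventually.filter_mono nhdsWithin_le_nhds, eventually_nhdsNE_nhds h]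
    with y hol heq
  exact hol.congr (heq.mono fun _ => Eq.symm)

theorem eventually_sectionHolAt_of_twist (hσ : E.SectionHolAt σ OnePoint.infty)
    (h : ∀ᶠ y in 𝓝[≠] OnePoint.infty, σ y = twist e s₀ y) :
    ∀ᶠ y in 𝓝[≠] OnePoint.infty, E.SectionHolAt s₀ y := by
  filter_upwards [hσ.eventually_of_eq_nhdsNE h, self_mem_nhdsWithin,
    eventually_ne_zero_infty.filter_mono nhdsWithin_le_nhds] with y hol hinf h0
  induction y using OnePoint.rec with
  | infty => exact absurd rfl hinf
  | coe w => exact hol.of_twist fun hw => h0 (congrArg _ hw)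

theorem exists_extension_coe
    (h : ∀ z : ℂ, ∃ σ, E.SectionHolAt σ z ∧ ∀ᶠ y in 𝓝[≠] (z : RiemannSphere), σ y = s₀ y) :
    ∃ m : ∀ y, E.fiber y, (∀ z : ℂ, E.SectionHolAt m z) ∧
      ∀ z : ℂ, E.SectionHolAt s₀ z → m z = s₀ z := by
  choose σ hσ hσs using h
  have hself : ∀ z : ℂ, E.SectionHolAt s₀ z → σ z z = s₀ z := fun z hz =>
    (hσ z).eq_of_nhdsNE hz (hσs z)
  refine ⟨@OnePoint.rec ℂ E.fiber 0 fun z => σ z z,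
    fun z => (hσ z).congr ?_, hself⟩
  have hpunctured := (hσs z).and ((hσ z).eventually_of_eq_nhdsNE (hσs z))
  rw [eventually_nhdsWithin_iff, eventually_nhds_coe_iff] at hpunctured
  rw [eventually_nhds_coe_iff]
  filter_upwards [hpunctured] with w hw
  rcases eq_or_ne w z with rfl | hwz
  · rfl
  · obtain ⟨heq, hol⟩ := hw (OnePoint.coe_injective.ne hwz)
    exact (hself w hol).trans heq.symm

theorem exists_mem_sectionSpace_of_extends {W : ∀ y, Submodule ℂ (E.fiber y)}
    (h : ∀ z : ℂ, ∃ σ, E.SectionHolAt σ z ∧ ∀ᶠ y in 𝓝[≠] (z : RiemannSphere), σ y = s₀ y)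
    (hinf : ∃ σ, E.SectionHolAt σ OnePoint.infty ∧
      ∀ᶠ y in 𝓝[≠] OnePoint.infty, σ y = twist e s₀ y)
    (hW : ∀ᶠ y in Filter.cofinite, s₀ y ∈ W y) :
    ∃ m ∈ E.sectionSpace W e, (∀ᶠ y in Filter.cofinite, m y = s₀ y) ∧
      ∀ z : ℂ, E.SectionHolAt s₀ z → m z = s₀ z := by
  classical
  obtain ⟨m₀, hm₀, hm₀s⟩ := exists_extension_coe h
  obtain ⟨σ, hσ, hσs⟩ := hinf
  have hm : ∀ z : ℂ, Function.update m₀ OnePoint.infty (σ OnePoint.infty) z = m₀ z := fun z =>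
    Function.update_of_ne (OnePoint.coe_ne_infty z) _ _
  have hgeneric : ∀ᶠ y in Filter.cofinite, E.SectionHolAt s₀ y :=
    eventually_cofinite_of_forall_nhdsNE fun y => by
      induction y using OnePoint.rec with
      | infty => exact eventually_sectionHolAt_of_twist hσ hσs
      | coe z =>
        obtain ⟨σ, hσ, hσs⟩ := h z
        exact hσ.eventually_of_eq_nhdsNE hσs
  have heq : ∀ᶠ y in Filter.cofinite,
      Function.update m₀ OnePoint.infty (σ OnePoint.infty) y = s₀ y := by
    filter_upwards [hgeneric, eventually_cofinite_coe (P := fun y => E.SectionHolAt s₀ y →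
      Function.update m₀ OnePoint.infty (σ OnePoint.infty) y = s₀ y)
      fun z hz => (hm z).trans (hm₀s z hz)] with y hy h using h hy
  refine ⟨_, ⟨fun z => (hm₀ z).congr ?_, hσ.congr ?_, ?_⟩, heq, fun z hz => ?_⟩
  · rw [eventually_nhds_coe_iff]
    exact Filter.Eventually.of_forall hm
  · have hpunctured := hσs.and (heq.filter_mono (nhdsNE_le_cofinite OnePoint.infty))
    rw [eventually_nhdsWithin_iff] at hpunctured
    filter_upwards [hpunctured] with y hy
    rcases eq_or_ne y OnePoint.infty with rfl | hne
    · rw [twist_infty, Function.update_self]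
    · rw [(hy hne).1, twist_apply, (hy hne).2, twist_apply]
  · filter_upwards [heq, hW] with y heq hy
    rwa [heq]
  · rw [hm, hm₀s z hz]

end Extension

section MeromorphicFrame

variable {g c : RiemannSphere → ℂ} {k : ℤ} {t s₀ : Fin n → ∀ y, E.fiber y}

theorem MerAt.eventually_holAt (h : MerAt g x) : ∀ᶠ y in 𝓝[≠] x, HolAt g y := by
  obtain ⟨k, hk⟩ := h.exists_holAt_pow_mul
  filter_upwards [(HolAt.eventually hk).filter_mono nhdsWithin_le_nhds,
    (HolAt.eventually (holAt_localCoord_pow x k)).filter_mono nhdsWithin_le_nhds,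
    eventually_localCoord_ne_zero x, eventually_nhdsNE_nhds (eventually_localCoord_ne_zero x)]
    with y hmul hpow hne hne_near
  refine (HolAt.mul (HolAt.inv hpow (pow_ne_zero k hne)) hmul).congr_of_eventuallyEq ?_
  filter_upwards [hne_near] with y' hy'
  exact (inv_mul_cancel_left₀ (pow_ne_zero k hy') _).symm

theorem merAt_of_eq_pow_mul {k : ℕ} (hg : HolAt g x)
    (h : ∀ᶠ y in 𝓝[≠] x, g y = localCoord x y ^ k * c y) :
    MerAt c x ∧ ((-k : ℤ) : WithTop ℤ) ≤ orderAt c x := by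
  have hpow : MerAt (fun y => localCoord x y ^ k) x := HolAt.merAt (holAt_localCoord_pow x k)
  have heq : ∀ᶠ y in 𝓝[≠] x, (localCoord x y ^ k)⁻¹ * g y = c y := by
    filter_upwards [h, eventually_localCoord_ne_zero x] with y hy hne
    rw [hy, inv_mul_cancel_left₀ (pow_ne_zero k hne)]
  refine ⟨(hpow.inv.mul (HolAt.merAt hg)).congr heq, ?_⟩
  rw [← orderAt_congr heq, orderAt_mul hpow.inv (HolAt.merAt hg), orderAt_inv,
    orderAt_localCoord_pow, WithTop.LinearOrderedAddCommGroup.coe_neg]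
  exact le_add_of_nonneg_right (HolAt.orderAt_nonneg hg)

theorem span_range_eq_top_of_linearIndependent {y : RiemannSphere} {v : Fin n → E.fiber y}
    (h : LinearIndependent ℂ v) : Submodule.span ℂ (Set.range v) = ⊤ := by
  refine Submodule.eq_top_of_finrank_eq ?_
  rw [finrank_span_eq_card h, Fintype.card_fin, finrank_fiber]

namespace HasDetOrderAt

theorem eventually_frame (h : E.HasDetOrderAt (fun _ => ⊤) t x k) :
    ∀ᶠ y in 𝓝[≠] x, (∀ i, E.SectionHolAt (t i) y) ∧ LinearIndependent ℂ fun i => t i y := by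
  obtain ⟨f, M, hf, hM, hs, hord⟩ := h
  have hMhol : ∀ᶠ y in 𝓝[≠] x, ∀ i j, HolAt (fun y => M y i j) y :=
    Filter.eventually_all.2 fun i => Filter.eventually_all.2 fun j => (hM i j).eventually_holAt
  filter_upwards [(MerAt.det hM).eventually_ne_zero (hord.trans_ne WithTop.coe_ne_top), hMhol, hs,
    eventually_nhdsNE_nhds hs, hf.eventually.filter_mono nhdsWithin_le_nhds]
    with y hdet hMy hsy hs_near hfy
  refine ⟨fun i => (SectionHolAt.sum (t := Finset.univ) fun j _ =>
    SectionHolAt.smul (hMy i j) (hfy.hol j)).congr ?_,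
    linearIndependent_of_det_ne_zero hfy.linearIndependent.self_of_nhds hsy hdet⟩
  filter_upwards [hs_near] with y' hy' using hy' i

theorem exists_pow_smul (h : E.HasDetOrderAt (fun _ => ⊤) t x k) :
    ∃ k : ℕ, ∀ i, ∃ σ, E.SectionHolAt σ x ∧
      ∀ᶠ y in 𝓝[≠] x, σ y = localCoord x y ^ k • t i y := by
  obtain ⟨f, M, hf, hM, hs, -⟩ := h
  obtain ⟨k, hk⟩ := exists_forall_holAt_pow_mul (g := fun (ij : Fin n × Fin n) y => M y ij.1 ij.2)
    fun ij => hM ij.1 ij.2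
  refine ⟨k, fun i => ⟨fun y => ∑ j, (localCoord x y ^ k * M y i j) • f j y,
    SectionHolAt.sum fun j _ => SectionHolAt.smul (hk (i, j)) (hf.hol j), ?_⟩⟩
  filter_upwards [hs] with y hy
  simp only [hy, Finset.smul_sum, smul_smul]

theorem exists_coordinates_pole_bound (h : E.HasDetOrderAt (fun _ => ⊤) t x k)
    {Ψ : ∀ y, E.fiber y →ₗ[ℂ] (Fin n → ℂ)}
    (hΨ : ∀ y, (LinearIndependent ℂ fun i => t i y) → ∀ c : Fin n → ℂ, Ψ y (∑ i, c i • t i y) = c) :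
    ∃ k : ℕ, ∀ s, E.SectionHolAt s x → ∀ i,
      MerAt (fun y => Ψ y (s y) i) x ∧
        ((-k : ℤ) : WithTop ℤ) ≤ orderAt (fun y => Ψ y (s y) i) x := by
  have hframe := h.eventually_frame
  obtain ⟨f, M, hf, hM, ht, hord⟩ := h
  obtain ⟨κ, hκ, hκhol⟩ := exists_coordinates hf.hol hf.linearIndependent.self_of_nhds
  obtain ⟨k, hk⟩ := exists_forall_holAt_pow_mul
    (g := fun (ij : Fin n × Fin n) y => (M y)⁻¹ ij.1 ij.2) fun ij => MerAt.matrix_inv hM ij.1 ij.2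
  refine ⟨k, fun s hs i => merAt_of_eq_pow_mul
    (g := fun y => ∑ j, κ y (s y) j * (localCoord x y ^ k * (M y)⁻¹ j i))
    (ContMDiffAt.sum fun j _ => HolAt.mul (contMDiffAt_pi_space.1 (hκhol.self_of_nhds s hs) j)
      (hk (j, i))) ?_⟩
  filter_upwards [ht, (MerAt.det hM).eventually_ne_zero (hord.trans_ne WithTop.coe_ne_top), hframe,
    hκ.filter_mono nhdsWithin_le_nhds, hf.span_eq.filter_mono nhdsWithin_le_nhds]
    with y hty hdet hframey hκy hspan
  rw [coordinates_eq_vecMul_inv hty hdet hκy (hΨ y hframey.2) (hspan.ge trivial), Matrix.vecMul,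
    dotProduct, Finset.mul_sum]
  exact Finset.sum_congr rfl fun j _ => mul_left_comm _ _ _

end HasDetOrderAt

theorem holAt_coordinates (ht : ∀ i, E.SectionHolAt (t i) x)
    (hli : LinearIndependent ℂ fun i => t i x) {Ψ : ∀ y, E.fiber y →ₗ[ℂ] (Fin n → ℂ)}
    (hΨ : ∀ y, (LinearIndependent ℂ fun i => t i y) → ∀ c : Fin n → ℂ, Ψ y (∑ i, c i • t i y) = c)
    {s : ∀ y, E.fiber y} (hs : E.SectionHolAt s x) (i : Fin n) :
    HolAt (fun y => Ψ y (s y) i) x := by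
  obtain ⟨κ, hκ, hκhol⟩ := exists_coordinates ht hli
  refine (contMDiffAt_pi_space.1 (hκhol.self_of_nhds s hs) i).congr_of_eventuallyEq ?_
  filter_upwards [hκ, eventually_linearIndependent ht hli] with y hκy hli_y
  obtain ⟨a, ha⟩ := (Submodule.mem_span_range_iff_exists_fun ℂ).1
    ((span_range_eq_top_of_linearIndependent hli_y).ge (trivial : s y ∈ ⊤))
  rw [← ha, hκy, hΨ y hli_y]

theorem eventually_cofinite_frame {D : RiemannSphere →₀ ℤ}
    (ht : ∀ x, E.HasDetOrderAt (fun _ => ⊤) t x (D x)) :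
    ∀ᶠ y in Filter.cofinite,
      (∀ i, E.SectionHolAt (t i) y) ∧ LinearIndependent ℂ fun i => t i y :=
  eventually_cofinite_of_forall_nhdsNE fun x => (ht x).eventually_frame

theorem IsDetDivisor.exists_coordinates {D : RiemannSphere →₀ ℤ}
    (hD : E.IsDetDivisor (fun _ => ⊤) n D) :
    ∃ (Ψ : ∀ y, E.fiber y →ₗ[ℂ] (Fin n → ℂ)) (K : RiemannSphere →₀ ℕ),
      (∀ x, ∀ᶠ y in 𝓝[≠] x, Function.Injective (Ψ y)) ∧
      ∀ x s, E.SectionHolAt s x → ∀ i, MerAt (fun y => Ψ y (s y) i) x ∧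
        ((-K x : ℤ) : WithTop ℤ) ≤ orderAt (fun y => Ψ y (s y) i) x := by
  obtain ⟨t, ht⟩ := hD
  have hleft : ∀ y, ∃ Ψ : E.fiber y →ₗ[ℂ] (Fin n → ℂ), (LinearIndependent ℂ fun i => t i y) →
      ∀ c : Fin n → ℂ, Ψ (∑ i, c i • t i y) = c := fun y => by
    by_cases h : LinearIndependent ℂ fun i => t i y
    · exact (exists_leftInverse_family h).imp fun _ hκ _ => hκ
    · exact ⟨0, fun h' => absurd h' h⟩
  choose Ψ hΨ using hleft
  obtain ⟨K, hK⟩ := exists_finsupp_of_eventually_cofinite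
    (fun x => (ht x).exists_coordinates_pole_bound hΨ) <| by
      filter_upwards [eventually_cofinite_frame ht] with x hx s hs i
      have hol := holAt_coordinates hx.1 hx.2 hΨ hs i
      exact ⟨HolAt.merAt hol, by simpa using HolAt.orderAt_nonneg hol⟩
  refine ⟨Ψ, K, fun x => ?_, hK⟩
  filter_upwards [(ht x).eventually_frame] with y hy
  refine (injective_iff_map_eq_zero _).2 fun v hv => ?_
  obtain ⟨a, rfl⟩ := (Submodule.mem_span_range_iff_exists_fun ℂ).1
    ((span_range_eq_top_of_linearIndependent hy.2).ge (trivial : v ∈ ⊤))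
  rw [hΨ y hy.2] at hv
  simp only [hv, Pi.zero_apply, zero_smul, Finset.sum_const_zero]

/-- In meromorphic coordinates a section of large order at `∞` becomes a tuple of functions with
more zeros than poles. -/
theorem exists_sectionSpace_eq_bot {D : RiemannSphere →₀ ℤ}
    (hD : E.IsDetDivisor (fun _ => ⊤) n D) :
    ∃ e₀ : ℤ, ∀ W e, e₀ ≤ e → E.sectionSpace W e = ⊥ := by
  obtain ⟨Ψ, K, hinj, hK⟩ := hD.exists_coordinates
  set K' : RiemannSphere →₀ ℤ := K.mapRange (↑) Nat.cast_zero with hK'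
  refine ⟨(K'.sum fun _ k => k) + 1, fun W e he => (Submodule.eq_bot_iff _).2 fun m hm => ?_⟩
  have hsum : ((K' - Finsupp.single OnePoint.infty e).sum fun _ k => k) < 0 := by
    rw [Finsupp.sum_sub_index fun _ _ _ => rfl, Finsupp.sum_single_index rfl]
    lia
  have horder : ∀ i x, MerAt (fun y => Ψ y (m y) i) x ∧
      ((-(K' - Finsupp.single OnePoint.infty e : RiemannSphere →₀ ℤ) x : ℤ) : WithTop ℤ) ≤
        orderAt (fun y => Ψ y (m y) i) x := fun i x => by
    rw [Finsupp.sub_apply, hK', Finsupp.mapRange_apply]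
    induction x using OnePoint.rec with
    | infty =>
      obtain ⟨hmer, hle⟩ := hK OnePoint.infty _ hm.2.1 i
      have heq : ∀ᶠ y in 𝓝[≠] OnePoint.infty,
          twistFactor (-e) y * Ψ y (twist e m y) i = Ψ y (m y) i := by
        filter_upwards [eventually_ne_zero_infty.filter_mono nhdsWithin_le_nhds] with y hy
        rw [twist_apply, map_smul, Pi.smul_apply, smul_eq_mul, ← mul_assoc,
          ← twistFactor_add _ _ hy, neg_add_cancel, twistFactor_zero, one_mul]
      refine ⟨((merAt_twistFactor (-e)).mul hmer).congr heq, ?_⟩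
      rw [← orderAt_congr heq, orderAt_mul (merAt_twistFactor (-e)) hmer, orderAt_twistFactor,
        Finsupp.single_eq_same, neg_sub, sub_eq_add_neg, neg_neg, WithTop.coe_add]
      gcongr
    | coe z =>
      rw [Finsupp.single_eq_of_ne (OnePoint.coe_ne_infty z), sub_zero]
      exact hK z m (hm.1 z) i
  have hzero : ∀ i (z : ℂ), ∀ᶠ y in 𝓝[≠] (z : RiemannSphere), Ψ y (m y) i = 0 := fun i z =>
    eventually_nhdsNE_iff.2 <| meromorphicOrderAt_eq_top_iff.1 <|
      orderAt_eq_top_of_divisor (fun x => (horder i x).1) _ (fun x => (horder i x).2) hsum z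
  refine sectionSpace_eq_zero_of_coe hm fun z => (hm.1 z).eq_zero_of_nhdsNE ?_
  filter_upwards [Filter.eventually_all.2 fun i => hzero i z, hinj z] with y hy hinj_y
  exact (injective_iff_map_eq_zero _).1 hinj_y _ (funext hy)

end MeromorphicFrame

section PolynomialOfDivisor

theorem localCoord_infty_pow {y : RiemannSphere} (hy : y ≠ OnePoint.infty) (k : ℕ) :
    localCoord OnePoint.infty y ^ k = twistFactor (-k) y := by
  induction y using OnePoint.rec with
  | infty => exact absurd rfl hy
  | coe w => rw [localCoord_infty_coe, twistFactor_coe, zpow_neg, zpow_natCast, inv_pow]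

/-- The polynomial with divisor `K` on `ℂ`, as a function on `ℂℙ¹`. -/
noncomputable def divisorPolynomial (K : ℂ →₀ ℕ) (y : RiemannSphere) : ℂ :=
  K.prod fun a k => (coord y - a) ^ k

variable (K : ℂ →₀ ℕ)

theorem holAt_divisorPolynomial (z : ℂ) : HolAt (divisorPolynomial K) (z : RiemannSphere) :=
  ContMDiffAt.prod fun a _ => ((holAt_coord z).sub contMDiffAt_const).pow (K a)

theorem divisorPolynomial_eq_erase_mul (z : ℂ) (y : RiemannSphere) :
    divisorPolynomial K y = divisorPolynomial (K.erase z) y * localCoord z y ^ K z := by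
  have hcoord : localCoord z y = coord y - z := by
    rw [localCoord, chartAt_coe, chartCenter_coe]
    rfl
  rw [divisorPolynomial, ← K.mul_prod_erase' z _ fun _ => pow_zero _, hcoord, mul_comm,
    divisorPolynomial]

theorem exists_holAt_eq_twistFactor_mul_divisorPolynomial :
    ∃ u, HolAt u OnePoint.infty ∧ ∀ᶠ y in 𝓝[≠] OnePoint.infty,
      u y = twistFactor (∑ a ∈ K.support, -(K a : ℤ)) y * divisorPolynomial K y := by
  refine ⟨fun y => K.prod fun a k => (1 - a * localCoord OnePoint.infty y) ^ k,
    ContMDiffAt.prod fun a _ => (contMDiffAt_const.sub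
      (HolAt.mul contMDiffAt_const (holAt_localCoord OnePoint.infty))).pow (K a), ?_⟩
  filter_upwards [self_mem_nhdsWithin, eventually_ne_zero_infty.filter_mono nhdsWithin_le_nhds]
    with y hinf h0
  rw [twistFactor_sum _ _ h0, divisorPolynomial, Finsupp.prod, Finsupp.prod,
    ← Finset.prod_mul_distrib]
  refine Finset.prod_congr rfl fun a _ => ?_
  induction y using OnePoint.rec with
  | infty => exact absurd rfl hinf
  | coe w =>
    have hw : w ≠ 0 := fun h => h0 (congrArg _ h)
    rw [localCoord_infty_coe, twistFactor_coe, coord_coe, zpow_neg, zpow_natCast, ← inv_pow,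
      ← mul_pow, mul_sub, inv_mul_cancel₀ hw, mul_comm a]

theorem eventually_divisorPolynomial_ne_zero :
    ∀ᶠ y in Filter.cofinite, divisorPolynomial K y ≠ 0 := by
  have hfinite : ((↑) '' (K.support : Set ℂ) ∪ {OnePoint.infty} : Set RiemannSphere).Finite :=
    (K.support.finite_toSet.image _).union (Set.finite_singleton _)
  filter_upwards [hfinite.compl_mem_cofinite] with y hy
  induction y using OnePoint.rec with
  | infty => exact absurd (Or.inr rfl) hy
  | coe w =>
    refine Finset.prod_ne_zero_iff.2 fun a ha => pow_ne_zero _ (sub_ne_zero.2 ?_)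
    rintro rfl
    exact hy (Or.inl ⟨w, ha, rfl⟩)

end PolynomialOfDivisor

/-- The poles on `ℂ` of a meromorphic frame are cleared by a polynomial. -/
theorem exists_linearIndependent_sectionSpace {D : RiemannSphere →₀ ℤ}
    (hD : E.IsDetDivisor (fun _ => ⊤) n D) :
    ∃ (e : ℤ) (m : Fin n → ∀ y, E.fiber y), (∀ i, m i ∈ E.sectionSpace (fun _ => ⊤) e) ∧
      ∃ y, LinearIndependent ℂ fun i => m i y := by
  obtain ⟨t, ht⟩ := hD
  have hframe := eventually_cofinite_frame ht
  obtain ⟨K, hK⟩ := exists_finsupp_of_eventually_cofinite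
    (P := fun (z : ℂ) k => ∀ i, ∃ σ, E.SectionHolAt σ z ∧
      ∀ᶠ y in 𝓝[≠] (z : RiemannSphere), σ y = localCoord z y ^ k • t i y)
    (fun z => (ht z).exists_pow_smul) <| by
      filter_upwards [OnePoint.coe_injective.tendsto_cofinite.eventually hframe] with z hz i
      exact ⟨t i, hz.1 i, Filter.Eventually.of_forall fun y => by rw [pow_zero, one_smul]⟩
  obtain ⟨k, hk⟩ := (ht OnePoint.infty).exists_pow_smul
  obtain ⟨u, hu, hu_eq⟩ := exists_holAt_eq_twistFactor_mul_divisorPolynomial K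
  have hclear := fun i => exists_mem_sectionSpace_of_extends (W := fun _ => ⊤)
    (s₀ := fun y => divisorPolynomial K y • t i y)
    (e := -(k : ℤ) + ∑ a ∈ K.support, -(K a : ℤ)) (fun z => ?_) ?_
    (Filter.Eventually.of_forall fun _ => trivial)
  · choose m hm hm_eq _ using hclear
    obtain ⟨y, hy, hne, hm_y⟩ := (hframe.and <| (eventually_divisorPolynomial_ne_zero K).and <|
      Filter.eventually_all.2 hm_eq).exists
    refine ⟨_, m, hm, y, ?_⟩
    simp only [hm_y]
    exact hy.2.units_smul fun _ => Units.mk0 _ hne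
  · obtain ⟨σ, hσ, hσ_eq⟩ := hK z i
    refine ⟨_, SectionHolAt.smul (holAt_divisorPolynomial (K.erase z) z) hσ, ?_⟩
    filter_upwards [hσ_eq] with y hy
    rw [hy, divisorPolynomial_eq_erase_mul K z, mul_smul]
  · obtain ⟨σ, hσ, hσ_eq⟩ := hk i
    refine ⟨_, SectionHolAt.smul hu hσ, ?_⟩
    filter_upwards [hσ_eq, hu_eq, self_mem_nhdsWithin,
      eventually_ne_zero_infty.filter_mono nhdsWithin_le_nhds] with y hy hu_y hinf h0
    rw [hy, hu_y, twist_apply, twistFactor_add _ _ h0, ← localCoord_infty_pow hinf, smul_smul,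
      smul_smul]
    ring_nf

/-- The **Birkhoff–Grothendieck theorem**. -/
theorem exists_isSplitFrame_top {D : RiemannSphere →₀ ℤ} (hD : E.IsDetDivisor (fun _ => ⊤) n D) :
    ∃ (b : Fin n → ∀ y, E.fiber y) (d : Fin n → ℤ), E.IsSplitFrame (fun _ => ⊤) b d ∧
      (∀ e, FiniteDimensional ℂ (E.sectionSpace (fun _ => ⊤) e)) ∧
      ∀ e, Module.finrank ℂ (E.sectionSpace (fun _ => ⊤) e) = ∑ i, (d i - e + 1).toNat := by
  obtain ⟨e₀, he₀⟩ := exists_sectionSpace_eq_bot hD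
  obtain ⟨r, b, d, L, hb, -, hL, hdim⟩ := exists_isSplitFrame (he₀ fun _ => ⊤)
  obtain ⟨e, m, hm, y, hy⟩ := exists_linearIndependent_sectionSpace hD
  have hnr : n ≤ r := by
    have hli : LinearIndependent ℂ fun i => (⟨m i y, hL e _ (hm i) y⟩ : L y) :=
      LinearIndependent.of_comp (L y).subtype hy
    simpa only [Fintype.card_fin, hb.finrank_eq] using hli.fintype_card_le_finrank
  have hrn : r ≤ n := by
    simpa only [hb.finrank_eq, finrank_fiber] using Submodule.finrank_le (L y)
  obtain rfl : r = n := le_antisymm hrn hnr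
  obtain rfl : L = fun _ => ⊤ := funext fun y =>
    Submodule.eq_top_of_finrank_eq (by rw [hb.finrank_eq, finrank_fiber])
  exact ⟨b, d, hb, hdim⟩

end HolBundle

namespace HolBundle

open RiemannSphere

variable {n : ℕ}

section Split

variable (d : Fin n → ℤ) (i : Fin n)

/-- The meromorphic section of `𝒪(d₁) ⊕ ⋯ ⊕ 𝒪(dₙ)` whose only nonzero component is `1` on `ℂ`, in
the summand `i`. -/
def splitSection (y : RiemannSphere) : (split d).fiber y := (Pi.single i 1 : Fin n → ℂ)

theorem splitCore_indexAt_coe (z : ℂ) : (splitCore d).indexAt (z : RiemannSphere) = false := by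
  classical exact decide_eq_false (OnePoint.coe_ne_infty z)

theorem splitCore_indexAt_infty : (splitCore d).indexAt OnePoint.infty = true := by
  classical exact decide_eq_true rfl

variable {d}

theorem sectionHolAt_split_iff {s : RiemannSphere → Fin n → ℂ} {x : RiemannSphere} {j : Bool}
    (hx : x ∈ (splitCore d).baseSet j) : (split d).SectionHolAt s x ↔
      HolAt (fun y k => coord y ^ ((chartIndex ((splitCore d).indexAt y) - chartIndex j) * d k) *
        s y k) x := by
  have : MemTrivializationAtlas ((splitCore d).localTriv j) := ⟨⟨j, rfl⟩⟩
  exact Bundle.Trivialization.contMDiffAt_section_iff (E := (splitCore d).Fiber) (IB := 𝓘(ℂ, ℂ))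
    (n := ω) (s := s) ((splitCore d).localTriv j) hx

theorem sectionHolAt_splitSection (z : ℂ) : (split d).SectionHolAt (splitSection d i) z := by
  refine (sectionHolAt_split_iff (s := fun _ => Pi.single i 1) (j := false)
    (OnePoint.coe_ne_infty z)).2 ?_
  refine (contMDiffAt_const (c := (Pi.single i 1 : Fin n → ℂ))).congr_of_eventuallyEq ?_
  refine eventually_nhds_coe_iff.2 (Filter.Eventually.of_forall fun w => ?_)
  ext k
  beta_reduce
  rw [splitCore_indexAt_coe, sub_self, zero_mul, zpow_zero, one_mul]

theorem sectionHolAt_twist_splitSection :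
    (split d).SectionHolAt (twist (d i) (splitSection d i)) OnePoint.infty := by
  have hinf : OnePoint.infty ∈ (splitCore d).baseSet true := by
    change OnePoint.infty ∈ chartInfty.source
    rw [chartInfty_source]
    exact OnePoint.infty_ne_coe 0
  refine (sectionHolAt_split_iff (s := fun y => twistFactor (d i) y • Pi.single i 1) hinf).2 ?_
  refine (contMDiffAt_const (c := (Pi.single i 1 : Fin n → ℂ))).congr_of_eventuallyEq ?_
  refine eventually_nhds_infty_of_coe_ne_zero ?_ fun w hw => ?_
  · ext k
    beta_reduce
    rw [splitCore_indexAt_infty, sub_self, zero_mul, zpow_zero, one_mul, twistFactor_infty,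
      one_smul]
  · ext k
    beta_reduce
    rw [splitCore_indexAt_coe, Pi.smul_apply, Pi.single_apply]
    split_ifs with hk
    · subst hk
      rw [coord_coe, twistFactor_coe, smul_eq_mul, mul_one, ← zpow_add₀ hw, chartIndex, chartIndex,
        zero_sub, neg_one_mul, neg_add_cancel, zpow_zero]
    · rw [smul_zero, mul_zero]

variable (d) in
theorem isSplitFrame_split : (split d).IsSplitFrame (fun _ => ⊤) (splitSection d) d := by
  have hli : ∀ y, LinearIndependent ℂ fun i => splitSection d i y := fun _ =>
    Pi.linearIndependent_single_one (Fin n) ℂ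
  have htop : (fun y => Submodule.span ℂ (Set.range fun i => splitSection d i y)) = fun _ => ⊤ :=
    funext fun y => span_range_eq_top_of_linearIndependent (hli y)
  exact htop ▸ isSplitFrame_span (E := split d) sectionHolAt_splitSection
    sectionHolAt_twist_splitSection hli

end Split

section Isomorphism

variable {E : HolBundle.{u} n} {F : HolBundle.{v} n} {b : Fin n → ∀ y, E.fiber y}
  {b' : Fin n → ∀ y, F.fiber y} {A : ∀ y, E.fiber y →ₗ[ℂ] F.fiber y} {d : Fin n → ℤ}
  {x : RiemannSphere}

theorem IsFrameAt.homHolAt (hb : E.IsFrameAt (fun _ => ⊤) b x) (hb' : ∀ i, F.SectionHolAt (b' i) x)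
    (hA : ∀ y i, A y (b i y) = b' i y) : HomHolAt E F A x := by
  intro s hs
  obtain ⟨κ, hκ, hκhol⟩ := exists_coordinates hb.hol hb.linearIndependent.self_of_nhds
  refine (SectionHolAt.sum (t := Finset.univ) fun i _ => SectionHolAt.smul
    (contMDiffAt_pi_space.1 (hκhol.self_of_nhds s hs) i) (hb' i)).congr ?_
  filter_upwards [hκ, hb.span_eq] with y hκy hspan
  obtain ⟨c, hc⟩ := (Submodule.mem_span_range_iff_exists_fun ℂ).1
    (hspan.ge (trivial : s y ∈ ⊤))
  rw [← hc, hκy, map_sum]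
  simp only [map_smul, hA]

namespace IsSplitFrame

theorem homHolAt (h : E.IsSplitFrame (fun _ => ⊤) b d) (h' : F.IsSplitFrame (fun _ => ⊤) b' d)
    (hA : ∀ y i, A y (b i y) = b' i y) (x : RiemannSphere) : HomHolAt E F A x := by
  induction x using OnePoint.rec with
  | infty =>
    refine h.infty.homHolAt h'.infty.hol fun y i => ?_
    rw [twist_apply, twist_apply, map_smul, hA]
  | coe z => exact (h.coe z).homHolAt (h'.coe z).hol hA

theorem isIsomorphic (h : E.IsSplitFrame (fun _ => ⊤) b d)
    (h' : F.IsSplitFrame (fun _ => ⊤) b' d) : E.IsIsomorphic F := by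
  let B : ∀ y, Module.Basis (Fin n) ℂ (E.fiber y) := fun y =>
    Module.Basis.mk (h.linearIndependent y) (h.span_eq y).ge
  let B' : ∀ y, Module.Basis (Fin n) ℂ (F.fiber y) := fun y =>
    Module.Basis.mk (h'.linearIndependent y) (h'.span_eq y).ge
  have hA : ∀ y i, (B y).equiv (B' y) (Equiv.refl _) (b i y) = b' i y := fun y i => by
    rw [← Module.Basis.mk_apply (h.linearIndependent y) (h.span_eq y).ge i,
      Module.Basis.equiv_apply, Module.Basis.mk_apply, Equiv.refl_apply]
  exact ⟨fun y => (B y).equiv (B' y) (Equiv.refl _), h.homHolAt h' hA,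
    h'.homHolAt h fun y i => (LinearEquiv.symm_apply_eq _).2 (hA y i).symm⟩

theorem isIsomorphic_split (h : E.IsSplitFrame (fun _ => ⊤) b d) : E.IsIsomorphic (split d) :=
  h.isIsomorphic (isSplitFrame_split d)

end IsSplitFrame

end Isomorphism

end HolBundle

namespace RiemannSphere

theorem eventually_nhdsNE_infty_of_coe_ne_zero {P : RiemannSphere → Prop}
    (h : ∀ z : ℂ, z ≠ 0 → P z) : ∀ᶠ y in 𝓝[≠] (OnePoint.infty : RiemannSphere), P y :=
  eventually_nhdsWithin_iff.2 <|
    eventually_nhds_infty_of_coe_ne_zero (absurd rfl) fun z hz _ => h z hz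

end RiemannSphere

/-- The unit tangent vector in the preferred chart at `y`, which is `∂/∂z` for `y` in `ℂ`. -/
def coordTangent (y : RiemannSphere) : TangentSpace 𝓘(ℂ, ℂ) y := (1 : ℂ)

section DCoord

open RiemannSphere

theorem dCoord_coordTangent {x y : RiemannSphere} (hy : y ∈ (chartAt ℂ x).source) :
    dCoord x y (coordTangent y) =
      fderiv ℂ (fun z => chartAt ℂ x (chartInv y z)) (chartCenter y) 1 := by
  have hcoord : dCoord x y (coordTangent y) = tangentCoordChange 𝓘(ℂ, ℂ) y x y (1 : ℂ) := by
    rw [dCoord, mfderiv_chartAt_eq_tangentCoordChange (I := 𝓘(ℂ, ℂ)) hy]; rfl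
  rw [hcoord, tangentCoordChange_def]
  simp only [mfld_simps, range_id, fderivWithin_univ]
  rfl

theorem dCoord_coe_coe (z w : ℂ) : dCoord (z : RiemannSphere) w (coordTangent w) = 1 := by
  have hid : (fun u : ℂ => chartAt ℂ (z : RiemannSphere) u) = fun u => u := by
    rw [chartAt_coe]
    exact funext coord_coe
  rw [dCoord_coordTangent (by rw [chartAt_coe]; exact OnePoint.coe_ne_infty w)]
  simp only [chartInv_coe, hid, fderiv_fun_id, ContinuousLinearMap.id_apply]

theorem dCoord_infty_coe {z : ℂ} (hz : z ≠ 0) :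
    dCoord OnePoint.infty (z : RiemannSphere) (coordTangent z) = -(z ^ 2)⁻¹ := by
  have hinv : (fun w : ℂ => chartAt ℂ (OnePoint.infty : RiemannSphere) w) = fun w => w⁻¹ :=
    funext fun w => by
      rw [← localCoord_infty_coe, localCoord, chartCenter_infty, sub_zero]
  rw [dCoord_coordTangent]
  · simp only [chartInv_coe, chartCenter_coe]
    rw [hinv, fderiv_inv, ContinuousLinearMap.toSpanSingleton_apply, one_smul]
  · rw [chartAt_infty, chartInfty_source]
    exact fun h => hz (OnePoint.coe_injective h)

theorem twistFactor_two_mul_dCoord {z : ℂ} (hz : z ≠ 0) :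
    twistFactor 2 z * dCoord OnePoint.infty (z : RiemannSphere) (coordTangent z) = -1 := by
  rw [dCoord_infty_coe hz, twistFactor_coe, mul_neg, zpow_ofNat, mul_inv_cancel₀ (pow_ne_zero 2 hz)]

theorem eventually_dCoord_ne_zero (x : RiemannSphere) :
    ∀ᶠ y in 𝓝[≠] x, dCoord x y (coordTangent y) ≠ 0 := by
  induction x using OnePoint.rec with
  | infty =>
    exact eventually_nhdsNE_infty_of_coe_ne_zero fun z hz =>
      right_ne_zero_of_mul (twistFactor_two_mul_dCoord hz ▸ neg_ne_zero.2 one_ne_zero)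
  | coe z =>
    refine (eventually_nhds_coe_iff.2 (Filter.Eventually.of_forall fun w => ?_)).filter_mono
      nhdsWithin_le_nhds
    exact dCoord_coe_coe z w ▸ one_ne_zero

end DCoord

theorem sum_toNat_sub_add_one {r : ℕ} {a : Fin r → ℤ} {e : ℤ} (h : ∀ i, e ≤ a i) :
    ((∑ i, (a i - e + 1).toNat : ℕ) : ℤ) = ∑ i, a i + r * (1 - e) := by
  have hterm : ∀ i, ((a i - e + 1).toNat : ℤ) = a i + (1 - e) := fun i => by
    have := h i
    lia
  rw [Nat.cast_sum, Finset.sum_congr rfl fun i _ => hterm i, Finset.sum_add_distrib,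
    Finset.sum_const, Finset.card_univ, Fintype.card_fin, nsmul_eq_mul]

/-- Letting `e → -∞` compares first the coefficients of `-e` and then the constant terms. -/
theorem add_eq_and_sum_le_of_sum_toNat_le {k l m : ℕ} {a : Fin m → ℤ} {b : Fin k → ℤ}
    {c : Fin l → ℤ} {t : ℤ} (hkl : k + l ≤ m)
    (h : ∀ e, ∑ i, (a i - e + 1).toNat ≤
      ∑ i, (b i - e + 1).toNat + ∑ i, (c i - (e + t) + 1).toNat) :
    k + l = m ∧ ∑ i, a i ≤ ∑ i, b i + ∑ i, c i - t * l := by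
  obtain ⟨B, hB⟩ : ∃ B, ∀ e ≤ B, (∀ i, e ≤ a i) ∧ (∀ i, e ≤ b i) ∧ ∀ i, e + t ≤ c i := by
    obtain ⟨A, hA⟩ := (Set.finite_range a).bddBelow
    obtain ⟨B, hB⟩ := (Set.finite_range b).bddBelow
    obtain ⟨C, hC⟩ := (Set.finite_range c).bddBelow
    refine ⟨min (min A B) (C - t), fun e he => ⟨fun i => ?_, fun i => ?_, fun i => ?_⟩⟩
    · have := hA ⟨i, rfl⟩
      lia
    · have := hB ⟨i, rfl⟩
      lia
    · have := hC ⟨i, rfl⟩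
      lia
  have hlin : ∀ e ≤ B, ∑ i, a i + m * (1 - e) ≤
      ∑ i, b i + k * (1 - e) + (∑ i, c i + l * (1 - (e + t))) := fun e he => by
    obtain ⟨hea, heb, hec⟩ := hB e he
    rw [← sum_toNat_sub_add_one hea, ← sum_toNat_sub_add_one heb, ← sum_toNat_sub_add_one hec]
    exact_mod_cast h e
  have hm : k + l = m := by
    by_contra hne
    have hlt : (k : ℤ) + l + 1 ≤ m := by lia
    set e := min (min B 0) (∑ i, a i - (∑ i, b i + ∑ i, c i - t * l))
    have hmul : ((k : ℤ) + l + 1) * (1 - e) ≤ m * (1 - e) :=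
      mul_le_mul_of_nonneg_right hlt (by lia)
    have := hlin e (by lia)
    have : e ≤ ∑ i, a i - (∑ i, b i + ∑ i, c i - t * l) := min_le_right _ _
    linarith
  refine ⟨hm, ?_⟩
  have hmZ : (m : ℤ) = k + l := by exact_mod_cast hm.symm
  have := hlin B le_rfl
  rw [hmZ] at this
  linarith

theorem finrank_le_finrank_ker_add {K V V' X : Type*} [Field K] [AddCommGroup V] [Module K V]
    [AddCommGroup V'] [Module K V'] [AddCommGroup X] [Module K X] [FiniteDimensional K V]
    [FiniteDimensional K V'] {f : V →ₗ[K] X} {g : V' →ₗ[K] X}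
    (h : LinearMap.range f ≤ LinearMap.range g) :
    Module.finrank K V ≤ Module.finrank K (LinearMap.ker f) + Module.finrank K V' := by
  rw [← LinearMap.finrank_range_add_finrank_ker f, add_comm]
  exact Nat.add_le_add_left ((Submodule.finrank_mono h).trans (LinearMap.finrank_range_le g)) _

namespace HolBundle

open RiemannSphere

variable {m n r s : ℕ} {pt : Fin s → RiemannSphere} {E : HolBundle.{u} m} {F : HolBundle.{v} n}
  {parE : ∀ j, WeightedFlag (E.fiber (pt j))} {parF : ∀ j, WeightedFlag (F.fiber (pt j))}
  {φ : ∀ y, TangentSpace 𝓘(ℂ, ℂ) y →ₗ[ℂ] E.fiber y →ₗ[ℂ] F.fiber y} {x : RiemannSphere}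

/-- The kernels of the homomorphisms `φ (∂/∂z)`. -/
noncomputable def formKer (φ : ∀ y, TangentSpace 𝓘(ℂ, ℂ) y →ₗ[ℂ] E.fiber y →ₗ[ℂ] F.fiber y)
    (y : RiemannSphere) : Submodule ℂ (E.fiber y) :=
  LinearMap.ker (φ y (coordTangent y))

/-- The images of the homomorphisms `φ (∂/∂z)`. -/
noncomputable def formRange (φ : ∀ y, TangentSpace 𝓘(ℂ, ℂ) y →ₗ[ℂ] E.fiber y →ₗ[ℂ] F.fiber y)
    (y : RiemannSphere) : Submodule ℂ (F.fiber y) :=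
  LinearMap.range (φ y (coordTangent y))

/-- At each `pt j` the weights of `F` do not exceed those of `E`, so that a strongly parabolic
logarithmic form from `E` to `F` has zero residues. -/
def ResiduesVanish (parE : ∀ j, WeightedFlag (E.fiber (pt j)))
    (parF : ∀ j, WeightedFlag (F.fiber (pt j))) : Prop :=
  ∀ j, ∃ t, (parE j).filt t = ⊤ ∧ (parF j).above t = ⊥

section LocalStructure

variable {L : ∀ y, Submodule ℂ (F.fiber y)} {f : Fin r → ∀ y, F.fiber y} {σ : ∀ y, E.fiber y}

theorem apply_mem_of_nhdsNE (h : IsParabolicLogForm pt E F parE parF φ) (hx : x ∉ Set.range pt)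
    (hf : F.IsFrameAt L f x) (hσ : E.SectionHolAt σ x)
    (hL : ∀ᶠ y in 𝓝[≠] x, φ y (coordTangent y) (σ y) ∈ L y) (v : TangentSpace 𝓘(ℂ, ℂ) x) :
    φ x v (σ x) ∈ L x := by
  obtain ⟨A, hA, hφ⟩ := h.holomorphic x hx
  rw [hφ.self_of_nhds, LinearMap.smul_apply]
  refine Submodule.smul_mem _ _ (hf.mem_of_nhdsNE (s := fun y => A y (σ y)) (hA σ hσ) ?_)
  filter_upwards [hL, hφ.filter_mono nhdsWithin_le_nhds, eventually_dCoord_ne_zero x]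
    with y hmem hφy hne
  rw [hφy, LinearMap.smul_apply] at hmem
  exact (Submodule.smul_mem_iff _ hne).1 hmem

theorem sectionHolAt_apply_coe (h : IsParabolicLogForm pt E F parE parF φ) {z : ℂ}
    (hz : (z : RiemannSphere) ∉ Set.range pt) (hσ : E.SectionHolAt σ z) :
    F.SectionHolAt (fun y => φ y (coordTangent y) (σ y)) z := by
  obtain ⟨A, hA, hφ⟩ := h.holomorphic z hz
  refine SectionHolAt.congr (hA σ hσ) ?_
  rw [eventually_nhds_coe_iff] at hφ
  refine eventually_nhds_coe_iff.2 (hφ.mono fun w hw => ?_)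
  rw [hw, dCoord_coe_coe, one_smul]

theorem exists_eq_dCoord_smul (h : IsParabolicLogForm pt E F parE parF φ)
    (hres : ResiduesVanish parE parF) (hσ : E.SectionHolAt σ x) :
    ∃ τ, F.SectionHolAt τ x ∧
      ∀ᶠ y in 𝓝[≠] x, ∀ v, φ y v (σ y) = dCoord x y v • τ y := by
  by_cases hx : x ∈ Set.range pt
  · obtain ⟨j, rfl⟩ := hx
    obtain ⟨A, hA, hφ, hpar⟩ := h.residue j
    obtain ⟨t, htop, hbot⟩ := hres j
    have hA0 : A (pt j) (σ (pt j)) = 0 := by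
      rw [← Submodule.mem_bot ℂ, ← hbot]
      exact hpar t (htop ▸ trivial)
    obtain ⟨τ, hτ, hAτ⟩ := (hA σ hσ).exists_eq_localCoord_smul hA0
    refine ⟨τ, hτ, ?_⟩
    filter_upwards [hφ, hAτ.filter_mono nhdsWithin_le_nhds, eventually_localCoord_ne_zero _]
      with y hφy hAy hne v
    rw [hφy, LinearMap.smul_apply, hAy, smul_smul]
    exact congrArg (· • τ y) (div_mul_cancel₀ _ hne)
  · obtain ⟨A, hA, hφ⟩ := h.holomorphic x hx
    refine ⟨_, hA σ hσ, ?_⟩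
    filter_upwards [hφ.filter_mono nhdsWithin_le_nhds] with y hφy v
    rw [hφy, LinearMap.smul_apply]

end LocalStructure

theorem exists_apply_mem_sectionSpace (h : IsParabolicLogForm pt E F parE parF φ)
    (hres : ResiduesVanish parE parF) {e : ℤ} {W : ∀ y, Submodule ℂ (E.fiber y)}
    {σ : ∀ y, E.fiber y} (hσ : σ ∈ E.sectionSpace W e) :
    ∃ τ ∈ F.sectionSpace (formRange φ) (e + 2),
      ∀ z : ℂ, (z : RiemannSphere) ∉ Set.range pt → τ z = φ z (coordTangent z) (σ z) := by
  obtain ⟨τ, hτ, -, heq⟩ := exists_mem_sectionSpace_of_extends (E := F) (e := e + 2)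
    (s₀ := fun y => φ y (coordTangent y) (σ y)) (W := formRange φ)
    (fun z => by
      obtain ⟨τ, hτ, heq⟩ := exists_eq_dCoord_smul h hres (hσ.1 z)
      refine ⟨τ, hτ, ?_⟩
      rw [eventually_nhdsWithin_iff, eventually_nhds_coe_iff] at heq ⊢
      filter_upwards [heq] with w hw hwz
      rw [hw hwz, dCoord_coe_coe, one_smul])
    (by
      obtain ⟨τ, hτ, heq⟩ := exists_eq_dCoord_smul h hres hσ.2.1
      refine ⟨_, hτ.const_smul (-1), ?_⟩
      filter_upwards [heq, eventually_nhdsNE_infty_of_coe_ne_zero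
        (P := fun y => twistFactor 2 y * dCoord OnePoint.infty y (coordTangent y) = -1)
        fun z hz => twistFactor_two_mul_dCoord hz,
        eventually_ne_zero_infty.filter_mono nhdsWithin_le_nhds] with y hy hfactor h0
      rw [twist_apply, add_comm e 2, twistFactor_add _ _ h0, mul_smul, ← map_smul, ← twist_apply,
        hy, smul_smul, hfactor])
    (Filter.Eventually.of_forall fun y => ⟨σ y, rfl⟩)
  exact ⟨τ, hτ, fun z hz => heq z (sectionHolAt_apply_coe h hz (hσ.1 z))⟩

theorem finrank_sectionSpace_le_add (h : IsParabolicLogForm pt E F parE parF φ)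
    (hres : ResiduesVanish parE parF) (e : ℤ) [FiniteDimensional ℂ (E.sectionSpace (fun _ => ⊤) e)]
    [FiniteDimensional ℂ (E.sectionSpace (formKer φ) e)]
    [FiniteDimensional ℂ (F.sectionSpace (formRange φ) (e + 2))] :
    Module.finrank ℂ (E.sectionSpace (fun _ => ⊤) e) ≤
      Module.finrank ℂ (E.sectionSpace (formKer φ) e) +
        Module.finrank ℂ (F.sectionSpace (formRange φ) (e + 2)) := by
  let values : (∀ y, F.fiber y) →ₗ[ℂ]
      ∀ z : {z : ℂ // (z : RiemannSphere) ∉ Set.range pt}, F.fiber (z : ℂ) :=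
    LinearMap.pi fun z => LinearMap.proj ((z : ℂ) : RiemannSphere)
  let Φ : (∀ y, E.fiber y) →ₗ[ℂ] ∀ y, F.fiber y :=
    LinearMap.pi fun y => φ y (coordTangent y) ∘ₗ LinearMap.proj y
  let f := values ∘ₗ Φ ∘ₗ (E.sectionSpace (fun _ => ⊤) e).subtype
  have hrange : LinearMap.range f ≤
      LinearMap.range (values ∘ₗ (F.sectionSpace (formRange φ) (e + 2)).subtype) := by
    rintro _ ⟨σ, rfl⟩
    obtain ⟨τ, hτ, heq⟩ := exists_apply_mem_sectionSpace h hres σ.2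
    exact ⟨⟨τ, hτ⟩, funext fun z => heq z z.2⟩
  have hker : ∀ σ : LinearMap.ker f, σ.1.1 ∈ E.sectionSpace (formKer φ) e := fun σ => by
    refine ⟨σ.1.2.1, σ.1.2.2.1, ?_⟩
    filter_upwards [(Set.finite_range pt).compl_mem_cofinite,
      eventually_cofinite_coe (P := fun y => y ∉ Set.range pt → σ.1.1 y ∈ formKer φ y)
        fun z hz => congrFun (LinearMap.mem_ker.1 σ.2) ⟨z, hz⟩] with y hy hmem using hmem hy
  let ι : LinearMap.ker f →ₗ[ℂ] E.sectionSpace (formKer φ) e :=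
    LinearMap.codRestrict _ ((E.sectionSpace (fun _ => ⊤) e).subtype ∘ₗ (LinearMap.ker f).subtype)
      hker
  have hι : Function.Injective ι := fun σ τ hστ =>
    Subtype.ext (Subtype.ext (congrArg (fun c => c.1) hστ))
  exact (finrank_le_finrank_ker_add hrange).trans
    (Nat.add_le_add_right (LinearMap.finrank_le_finrank_of_injective hι) _)

namespace Subbundle

theorem finrank_eq (N : E.Subbundle r) (y : RiemannSphere) :
    Module.finrank ℂ (N.toSubmodule y) = r := by
  obtain ⟨f, hf⟩ := N.exists_frame y
  rw [← hf.span_eq.self_of_nhds, finrank_span_eq_card hf.linearIndependent.self_of_nhds,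
    Fintype.card_fin]

theorem le_ker (N : E.Subbundle r) (h : IsParabolicLogForm pt E F parE parF φ)
    (hN : ∀ᶠ y in Filter.cofinite, N.toSubmodule y ≤ formKer φ y) (hx : x ∉ Set.range pt)
    (v : TangentSpace 𝓘(ℂ, ℂ) x) : N.toSubmodule x ≤ LinearMap.ker (φ x v) := by
  obtain ⟨f, hf⟩ := N.exists_frame x
  rw [← hf.span_eq.self_of_nhds, Submodule.span_le]
  rintro _ ⟨i, rfl⟩
  refine (Submodule.mem_bot ℂ).1 <|
    apply_mem_of_nhdsNE h hx ((isSplitFrame_bot F).subbundle.exists_frame x).choose_spec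
      (hf.hol i) ?_ v
  filter_upwards [hN.filter_mono (nhdsNE_le_cofinite x),
    hf.span_eq.filter_mono nhdsWithin_le_nhds] with y hy hspan
  exact (Submodule.mem_bot ℂ).2 (hy (hspan ▸ mem_span_range_apply f i y))

theorem range_le (I : F.Subbundle r) (h : IsParabolicLogForm pt E F parE parF φ)
    (hI : ∀ᶠ y in Filter.cofinite, formRange φ y ≤ I.toSubmodule y) (hx : x ∉ Set.range pt)
    (v : TangentSpace 𝓘(ℂ, ℂ) x) : LinearMap.range (φ x v) ≤ I.toSubmodule x := by
  rintro _ ⟨a, rfl⟩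
  obtain ⟨f, hf⟩ := I.exists_frame x
  obtain ⟨σ, hσ, rfl⟩ := exists_sectionHolAt_eq a
  exact apply_mem_of_nhdsNE h hx hf hσ
    ((hI.filter_mono (nhdsNE_le_cofinite x)).mono fun y hy => hy ⟨σ y, rfl⟩) v

end Subbundle

theorem IsSplitFrame.mem_sectionSpace {L : ∀ y, Submodule ℂ (E.fiber y)}
    {b : Fin r → ∀ y, E.fiber y} {d : Fin r → ℤ} (h : E.IsSplitFrame L b d) (i : Fin r) :
    b i ∈ E.sectionSpace L (d i) :=
  ⟨fun z => (h.coe z).hol i, h.infty.hol i, Filter.Eventually.of_forall fun y =>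
    h.span_eq y ▸ mem_span_range_apply b i y⟩

theorem IsSplitFrame.eventually_le {L W : ∀ y, Submodule ℂ (E.fiber y)}
    {b : Fin r → ∀ y, E.fiber y} {d : Fin r → ℤ} (h : E.IsSplitFrame L b d)
    (hb : ∀ i, b i ∈ E.sectionSpace W (d i)) : ∀ᶠ y in Filter.cofinite, L y ≤ W y := by
  filter_upwards [Filter.eventually_all.2 fun i => (hb i).2.2] with y hy
  rw [← h.span_eq y, Submodule.span_le]
  rintro _ ⟨i, rfl⟩
  exact hy i

theorem eventually_formRange_le (h : IsParabolicLogForm pt E F parE parF φ)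
    (hres : ResiduesVanish parE parF) {b : Fin m → ∀ y, E.fiber y} {d : Fin m → ℤ}
    (hb : E.IsSplitFrame (fun _ => ⊤) b d) {I : ∀ y, Submodule ℂ (F.fiber y)}
    (hI : ∀ e, ∀ τ ∈ F.sectionSpace (formRange φ) e, ∀ y, τ y ∈ I y) :
    ∀ᶠ y in Filter.cofinite, formRange φ y ≤ I y := by
  filter_upwards [(Set.finite_range pt).compl_mem_cofinite,
    eventually_cofinite_coe (P := fun y => y ∉ Set.range pt → formRange φ y ≤ I y) fun z hz => by
      rw [formRange, LinearMap.range_eq_map, ← hb.span_eq z, Submodule.map_span_le]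
      rintro _ ⟨i, rfl⟩
      obtain ⟨τ, hτ, heq⟩ := exists_apply_mem_sectionSpace h hres (hb.mem_sectionSpace i)
      exact heq z hz ▸ hI _ τ hτ z] with y hy hle using hle hy

theorem rank_add_rank_le (N : E.Subbundle r) {r' : ℕ} (I : F.Subbundle r')
    (hN : ∀ᶠ y in Filter.cofinite, N.toSubmodule y ≤ formKer φ y)
    (hI : ∀ᶠ y in Filter.cofinite, I.toSubmodule y ≤ formRange φ y) : r + r' ≤ m := by
  obtain ⟨y, hNy, hIy⟩ := ((hN.and hI).filter_mono (nhdsNE_le_cofinite OnePoint.infty)).exists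
  have hker := Submodule.finrank_mono hNy
  have hrange := Submodule.finrank_mono hIy
  rw [N.finrank_eq] at hker
  rw [I.finrank_eq] at hrange
  rw [← finrank_fiber E y, ← LinearMap.finrank_range_add_finrank_ker (φ y (coordTangent y)),
    add_comm]
  exact Nat.add_le_add hrange hker

theorem exists_ker_range_subbundle (h : IsParabolicLogForm pt E F parE parF φ)
    (hres : ResiduesVanish parE parF) {DE DF : RiemannSphere →₀ ℤ}
    (hDE : E.IsDetDivisor (fun _ => ⊤) m DE) (hDF : F.IsDetDivisor (fun _ => ⊤) n DF) :
    ∃ (k l : ℕ) (N : E.Subbundle k) (I : F.Subbundle l),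
      (∀ y, y ∉ Set.range pt → ∀ v, N.toSubmodule y ≤ LinearMap.ker (φ y v)) ∧
      (∀ y, y ∉ Set.range pt → ∀ v, LinearMap.range (φ y v) ≤ I.toSubmodule y) ∧
      k + l = m ∧
      E.degree ≤ E.subDegree N.toSubmodule k + F.subDegree I.toSubmodule l - 2 * l := by
  obtain ⟨_, hE⟩ := exists_sectionSpace_eq_bot hDE
  obtain ⟨_, hF⟩ := exists_sectionSpace_eq_bot hDF
  obtain ⟨b, d, hb, hfin, hdim⟩ := exists_isSplitFrame_top hDE
  obtain ⟨k, bN, dN, N, hN, hNmem, -, hNfin, hNdim⟩ := exists_isSplitFrame (hE (formKer φ))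
  obtain ⟨l, bI, dI, I, hI, hImem, hIall, hIfin, hIdim⟩ := exists_isSplitFrame (hF (formRange φ))
  have hNker := hN.eventually_le hNmem
  obtain ⟨hrank, hsum⟩ := add_eq_and_sum_le_of_sum_toNat_le (a := d) (b := dN) (c := dI) (t := 2)
    (rank_add_rank_le hN.subbundle hI.subbundle hNker (hI.eventually_le hImem)) fun e => by
      rw [← hdim, ← hNdim, ← hIdim]
      have := hfin e
      have := hNfin e
      have := hIfin (e + 2)
      exact finrank_sectionSpace_le_add h hres e
  refine ⟨k, l, hN.subbundle, hI.subbundle, fun y hy => hN.subbundle.le_ker h hNker hy,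
    fun y hy => hI.subbundle.range_le h (eventually_formRange_le h hres hb hIall) hy, hrank, ?_⟩
  change E.degree ≤ E.subDegree N k + F.subDegree I l - 2 * l
  rwa [degree, hb.subDegree_eq, hN.subDegree_eq, hI.subDegree_eq]

end HolBundle

namespace WeightedFlag

variable {W : Type u} [AddCommGroup W] [Module ℂ W] [FiniteDimensional ℂ W] {F : WeightedFlag W}
  {n : ℕ} {w t : ℝ}

theorem HasType.filt_of_le (h : F.HasType fun _ : Fin n => w) (hn : Module.finrank ℂ W = n)
    (ht : t ≤ w) : F.filt t = ⊤ :=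
  Submodule.eq_top_of_finrank_eq (by rw [h t, hn]; simp [ht])

theorem HasType.filt_of_lt (h : F.HasType fun _ : Fin n => w) (ht : w < t) : F.filt t = ⊥ :=
  Submodule.finrank_eq_zero.1 (by rw [h t]; simp [ht.not_ge])

theorem HasType.above_of_lt (h : F.HasType fun _ : Fin n => w) (hn : Module.finrank ℂ W = n)
    (ht : t < w) : F.above t = ⊤ := by
  rw [eq_top_iff, ← h.filt_of_le hn le_rfl]
  exact le_iSup (fun t' : Set.Ioi t => F.filt t') ⟨w, ht⟩

theorem HasType.above_of_le (h : F.HasType fun _ : Fin n => w) (ht : w ≤ t) : F.above t = ⊥ :=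
  iSup_eq_bot.2 fun t' => h.filt_of_lt (ht.trans_lt t'.2)

theorem HasType.weight_eq (h : F.HasType fun _ : Fin n => w) (hn : Module.finrank ℂ W = n)
    (L : Submodule ℂ W) : F.weight L = w * Module.finrank ℂ L := by
  rw [weight, finsum_eq_single _ w]
  · rw [h.filt_of_le hn le_rfl, h.above_of_le le_rfl, top_inf_eq, bot_inf_eq, finrank_bot,
      Nat.cast_zero, sub_zero]
  · intro t ht
    rcases lt_or_gt_of_ne ht with ht | ht
    · rw [h.filt_of_le hn ht.le, h.above_of_lt hn ht, sub_self, mul_zero]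
    · rw [h.filt_of_lt ht, h.above_of_le ht.le, sub_self, mul_zero]

end WeightedFlag

theorem weightNorm_constWeight {s : ℕ} (n : ℕ) (a : Fin s → ℝ) :
    weightNorm (constWeight n a) = n * ∑ j, a j := by
  simp [weightNorm, constWeight, Finset.mul_sum]

theorem mem_intervalJ_iff {s p q : ℕ} {α β : Fin s → ℝ} {x : ℝ} :
    x ∈ intervalJ p q α β ↔ q * ∑ j, β j - p * ∑ j, α j < x ∧
      x < q * ∑ j, β j - p * ∑ j, α j + 2 - (∑ j, β j - ∑ j, α j) := by
  rw [intervalJ, Set.mem_Ioo, weightNorm_constWeight, weightNorm_constWeight, weightGap]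

open Classical in
theorem finsupp_sum_eq_neg_sum {X : Type*} {s : ℕ} {pt : Fin s → X} {c : Fin s → ℝ} {D : X →₀ ℤ}
    (hD : ∀ x, (D x : ℝ) = -∑ j, if pt j = x then c j else 0) :
    ((D.sum fun _ k => k : ℤ) : ℝ) = -∑ j, c j := by
  have hsingle : D.mapRange ((↑) : ℤ → ℝ) Int.cast_zero =
      -∑ j, Finsupp.single (pt j) (c j) := Finsupp.ext fun x => by
    simp only [Finsupp.mapRange_apply, hD, Finsupp.neg_apply, Finsupp.finsetSum_apply,
      Finsupp.single_apply]
  have hsum : (D.mapRange ((↑) : ℤ → ℝ) Int.cast_zero).degree = -∑ j, c j := by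
    rw [hsingle, map_neg, map_sum]
    simp only [Finsupp.degree_single]
  rw [← hsum, Finsupp.sum, Int.cast_sum]
  exact (Finsupp.sum_mapRange_index (h := fun _ k => k) fun _ => rfl).symm

theorem HolBundle.IsDetDivisor.sum_eq_degree {n : ℕ} {E : HolBundle.{u} n} {D : RiemannSphere →₀ ℤ}
    (hD : E.IsDetDivisor (fun _ => ⊤) n D) : (D.sum fun _ k => k) = E.degree := by
  obtain ⟨b, d, hb, -⟩ := exists_isSplitFrame_top hD
  rw [hb.sum_eq hD, degree, hb.subDegree_eq]

namespace ParabolicHiggs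

open HolBundle

variable {s p q m n : ℕ} {pt : Fin s → RiemannSphere} {H : ParabolicHiggs.{u} p q pt}
  {α β : Fin s → ℝ}

theorem HasType.parDegree_eq (h : H.HasType (constWeight p α) (constWeight q β))
    (U' : H.U.Subbundle m) (V' : H.V.Subbundle n) :
    H.parDegree U' V' = H.U.subDegree U'.toSubmodule m + H.V.subDegree V'.toSubmodule n +
      (m * ∑ j, α j + n * ∑ j, β j) := by
  have hweight : ∀ j, (H.parU j).weight (U'.toSubmodule (pt j)) +
      (H.parV j).weight (V'.toSubmodule (pt j)) = m * α j + n * β j := fun j => by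
    rw [(h j).1.weight_eq (finrank_fiber _ _), (h j).2.weight_eq (finrank_fiber _ _),
      U'.finrank_eq, V'.finrank_eq, mul_comm, mul_comm (β j)]
  rw [parDegree, Finset.sum_congr rfl fun j _ => hweight j, Finset.sum_add_distrib,
    Finset.mul_sum, Finset.mul_sum]

theorem HasTrivialDet.degree_add_degree
    (h : H.HasTrivialDet (constWeight p α) (constWeight q β)) :
    (H.U.degree + H.V.degree : ℝ) = -(p * ∑ j, α j + q * ∑ j, β j) := by
  obtain ⟨D₁, D₂, hD₁, hD₂, -, hsum⟩ := h
  have hsupport := finsupp_sum_eq_neg_sum (D := D₁ + D₂) hsum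
  rw [Finsupp.sum_add_index' (fun _ => rfl) fun _ _ _ => rfl, hD₁.sum_eq_degree,
    hD₂.sum_eq_degree, Int.cast_add] at hsupport
  rw [hsupport]
  simp only [constWeight, Finset.sum_const, Finset.card_univ, Fintype.card_fin, nsmul_eq_mul,
    Finset.sum_add_distrib, ← Finset.mul_sum]

theorem HasType.residuesVanish_δ (h : H.HasType (constWeight p α) (constWeight q β))
    (hle : ∀ j, α j ≤ β j) : ResiduesVanish H.parV H.parU := fun j =>
  ⟨β j, (h j).2.filt_of_le (finrank_fiber _ _) le_rfl, (h j).1.above_of_le (hle j)⟩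

namespace RepresentsPointOfModuli

variable {d : ℤ}

theorem subDegree_V_le (h : H.RepresentsPointOfModuli (constWeight p α) (constWeight q β) d)
    (V' : H.V.Subbundle n)
    (hV' : ∀ y, y ∉ Set.range pt → ∀ v, V'.toSubmodule y ≤ LinearMap.ker (H.δ y v)) :
    H.V.subDegree V'.toSubmodule n + n * ∑ j, β j ≤ 0 := by
  have hbot := isSplitFrame_bot H.U
  have hle := h.isSemistable _ _ hbot.subbundle V' fun y hy v =>
    ⟨bot_le, (hV' y hy v).trans (Submodule.comap_mono bot_le)⟩
  have hdeg : H.U.subDegree hbot.subbundle.toSubmodule 0 = 0 := hbot.subDegree_eq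
  rwa [h.hasType.parDegree_eq, hdeg, Int.cast_zero, zero_add, Nat.cast_zero, zero_mul,
    zero_add] at hle

theorem subDegree_U_le (h : H.RepresentsPointOfModuli (constWeight p α) (constWeight q β) d)
    (U' : H.U.Subbundle m)
    (hU' : ∀ y, y ∉ Set.range pt → ∀ v, LinearMap.range (H.δ y v) ≤ U'.toSubmodule y) :
    H.U.subDegree U'.toSubmodule m + H.V.degree + (m * ∑ j, α j + q * ∑ j, β j) ≤ 0 := by
  obtain ⟨-, D, -, hD, -⟩ := h.hasTrivialDet
  obtain ⟨_, _, htop, -⟩ := exists_isSplitFrame_top hD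
  have hle := h.isSemistable _ _ U' htop.subbundle fun y hy v =>
    ⟨le_top, fun a _ => hU' y hy v ⟨a, rfl⟩⟩
  rwa [h.hasType.parDegree_eq] at hle

theorem degree_V_add_mem_Ioo
    (h : H.RepresentsPointOfModuli (constWeight p α) (constWeight q β) d) (hle : ∀ j, α j ≤ β j)
    (hd : (d : ℝ) ∈ intervalJ p q α β) :
    (H.V.degree + q * ∑ j, β j : ℝ) ∈ Set.Ioo (-1) 0 := by
  obtain ⟨hlow, hupp⟩ := mem_intervalJ_iff.1 hd
  have hadd := h.hasTrivialDet.degree_add_degree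
  have hsub : (H.U.degree - H.V.degree : ℝ) = d := by exact_mod_cast h.degree_sub
  have hgap : ∑ j, α j ≤ ∑ j, β j := Finset.sum_le_sum fun j _ => hle j
  constructor <;> linarith

/-- Semistability for `0 ⊕ N` and `I ⊕ V`, where `N` and `I` are the saturations of the kernel and
the image of `δ`, combine to `l * (2 - ε) < 2 - ε` for the rank `l` of `I`. -/
theorem δ_eq_zero (h : H.RepresentsPointOfModuli (constWeight p α) (constWeight q β) d)
    (hle : ∀ j, α j ≤ β j) (hgap : weightGap α β < 2) (hd : (d : ℝ) ∈ intervalJ p q α β)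
    {y : RiemannSphere} (hy : y ∉ Set.range pt) (v : TangentSpace 𝓘(ℂ, ℂ) y) : H.δ y v = 0 := by
  obtain ⟨D₁, D₂, hD₁, hD₂, -⟩ := h.hasTrivialDet
  obtain ⟨k, l, N, I, hker, hrange, hrank, hdeg⟩ := exists_ker_range_subbundle
    H.isParabolicLogForm_δ (h.hasType.residuesVanish_δ hle) hD₂ hD₁
  have hN := h.subDegree_V_le N hker
  have hI := h.subDegree_U_le I hrange
  have hadd := h.hasTrivialDet.degree_add_degree
  have hsub : (H.U.degree - H.V.degree : ℝ) = d := by exact_mod_cast h.degree_sub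
  have hdeg' : (H.V.degree : ℝ) ≤
      H.V.subDegree N.toSubmodule k + H.U.subDegree I.toSubmodule l - 2 * l := by
    exact_mod_cast hdeg
  have hq : (q : ℝ) = k + l := by exact_mod_cast hrank.symm
  have hupp := (mem_intervalJ_iff.1 hd).2
  rw [weightGap] at hgap
  have hmul : l * (2 - (∑ j, β j - ∑ j, α j)) < 1 * (2 - (∑ j, β j - ∑ j, α j)) := by
    rw [hq] at hI hadd hupp
    linarith
  have hl : l = 0 := by
    have : (l : ℝ) < 1 := lt_of_mul_lt_mul_right hmul (by linarith)
    exact Nat.lt_one_iff.1 (by exact_mod_cast this)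
  subst hl
  rw [← LinearMap.range_eq_bot, ← le_bot_iff, ← Submodule.finrank_eq_zero.1 (I.finrank_eq y)]
  exact hrange y hy v

theorem splitting_V_add_le
    (h : H.RepresentsPointOfModuli (constWeight p α) (constWeight q β) d)
    (hδ : ∀ y, y ∉ Set.range pt → ∀ v, H.δ y v = 0) {b : Fin q → ∀ y, H.V.fiber y}
    {e : Fin q → ℤ} (hb : H.V.IsSplitFrame (fun _ => ⊤) b e) (i : Fin q) :
    e i + ∑ j, β j ≤ 0 := by
  have hle := h.subDegree_V_le (hb.single i).subbundle fun y hy v => by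
    rw [hδ y hy v, LinearMap.ker_zero]
    exact le_top
  have hdeg : H.V.subDegree (hb.single i).subbundle.toSubmodule 1 = e i :=
    (hb.single i).subDegree_eq.trans (Fin.sum_univ_one _)
  rwa [hdeg, Nat.cast_one, one_mul] at hle

theorem splitting_U_add_le
    (h : H.RepresentsPointOfModuli (constWeight p α) (constWeight q β) d)
    (hδ : ∀ y, y ∉ Set.range pt → ∀ v, H.δ y v = 0) {b : Fin p → ∀ y, H.U.fiber y}
    {e : Fin p → ℤ} (hb : H.U.IsSplitFrame (fun _ => ⊤) b e) (i : Fin p) :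
    e i + H.V.degree + (∑ j, α j + q * ∑ j, β j) ≤ 0 := by
  have hle := h.subDegree_U_le (hb.single i).subbundle fun y hy v => by
    rw [hδ y hy v, LinearMap.range_zero]
    exact bot_le
  have hdeg : H.U.subDegree (hb.single i).subbundle.toSubmodule 1 = e i :=
    (hb.single i).subDegree_eq.trans (Fin.sum_univ_one _)
  rwa [hdeg, Nat.cast_one, one_mul] at hle

end RepresentsPointOfModuli

end ParabolicHiggs

section Numerics

theorem exists_eq_const_of_neg_one_lt_sum {n : ℕ} {v : Fin n → ℤ} {B : ℝ} (hv : ∀ i, v i + B ≤ 0)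
    (hsum : -1 < ∑ i, (v i : ℝ) + n * B) : ∃ c, v = fun _ => c := by
  have hle : ∀ i j, v j ≤ v i := by
    intro i j
    by_contra! hlt
    have hgap : (v i : ℝ) + 1 ≤ v j := by exact_mod_cast hlt
    have hother : ∑ k ∈ Finset.univ.erase i, ((v k : ℝ) + B) ≤ 0 :=
      Finset.sum_nonpos fun k _ => hv k
    have hsplit : ∑ k, ((v k : ℝ) + B) = ∑ k, (v k : ℝ) + n * B := by
      simp only [Finset.sum_add_distrib, Finset.sum_const, Finset.card_univ, Fintype.card_fin,
        nsmul_eq_mul]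
    rw [← Finset.add_sum_erase _ _ (Finset.mem_univ i)] at hsplit
    linarith [hv j]
  cases n with
  | zero => exact ⟨0, Subsingleton.elim _ _⟩
  | succ n => exact ⟨v 0, funext fun i => le_antisymm (hle 0 i) (hle i 0)⟩

theorem eq_const_of_le_of_sum_eq {n : ℕ} {v : Fin n → ℤ} {c : ℤ} (hv : ∀ i, v i ≤ c)
    (hsum : ∑ i, v i = n * c) : v = fun _ => c := by
  have hsum' : ∑ i, v i = ∑ _i : Fin n, c := by
    simpa only [Finset.sum_const, Finset.card_univ, Fintype.card_fin, nsmul_eq_mul] using hsum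
  exact funext fun i => (Finset.sum_eq_sum_iff_of_le fun i _ => hv i).1 hsum' i (Finset.mem_univ i)

theorem exists_bounded_sum_eq {lo hi : ℕ} (hle : lo ≤ hi) (s N : ℕ) (hlo : s * lo ≤ N)
    (hhi : N ≤ s * hi) : ∃ k : Fin s → ℕ, (∀ j, lo ≤ k j ∧ k j ≤ hi) ∧ ∑ j, k j = N := by
  induction s generalizing N with
  | zero =>
    have hN : 0 = N := by lia
    exact ⟨Fin.elim0, fun j => j.elim0, Finset.sum_empty.trans hN⟩
  | succ s ih =>
    have hmul : s * lo ≤ s * hi := Nat.mul_le_mul_left s hle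
    rw [Nat.add_mul, one_mul] at hlo hhi
    obtain ⟨k, hk, hsum⟩ := ih (N - max lo (N - s * hi)) (by lia) (by lia)
    refine ⟨Fin.cons (max lo (N - s * hi)) k, ?_, ?_⟩
    · rw [Fin.forall_fin_succ]
      simp only [Fin.cons_zero, Fin.cons_succ]
      exact ⟨by lia, hk⟩
    · rw [Fin.sum_univ_succ]
      simp only [Fin.cons_zero, Fin.cons_succ, hsum]
      lia

theorem exists_pos_lt_sum_eq {s : ℕ} {m : Fin s → ℝ} (hm : ∀ j, 0 < m j) (hsum : 1 ≤ ∑ j, m j)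
    {t : ℝ} (ht₀ : 0 < t) (ht₁ : t < 1) :
    ∃ ε : Fin s → ℝ, (∀ j, 0 < ε j) ∧ (∀ j, ε j < m j) ∧ ∑ j, ε j = t := by
  have hpos : 0 < ∑ j, m j := one_pos.trans_le hsum
  refine ⟨fun j => m j * (t / ∑ j, m j), fun j => mul_pos (hm j) (div_pos ht₀ hpos),
    fun j => ?_, ?_⟩
  · exact mul_lt_of_lt_one_right (hm j) ((div_lt_one hpos).2 (ht₁.trans_le hsum))
  · rw [← Finset.sum_mul, mul_div_cancel₀ _ hpos.ne']

end Numerics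

section GapBound

variable {p q : ℕ} {t : ℝ}

theorem two_mul_mul_sub_sub_nonneg (hp : 0 < p) (hq : 0 < q) : (0 : ℝ) ≤ 2 * p * q - p - q := by
  have hp' : (1 : ℝ) ≤ p := by exact_mod_cast hp
  have hq' : (1 : ℝ) ≤ q := by exact_mod_cast hq
  nlinarith

/-- Clearing denominators also covers `p = q = 1`, where the quotient is `0` by convention. -/
theorem mul_one_sub_lt_of_div_lt (hp : 0 < p) (hq : 0 < q)
    (ht : (2 * p * q - 2 * p - 2 * q : ℝ) / (2 * p * q - p - q) < t) :
    (2 * p * q - p - q) * (1 - t) < p + q := by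
  rcases (two_mul_mul_sub_sub_nonneg hp hq).eq_or_lt with hzero | hpos
  · rw [← hzero, zero_mul]
    positivity
  · rw [div_lt_iff₀ hpos] at ht
    linarith

theorem exists_pos_div_lt_lt_one (hp : 0 < p) (hq : 0 < q) :
    ∃ t : ℝ, 0 < t ∧ (2 * p * q - 2 * p - 2 * q : ℝ) / (2 * p * q - p - q) < t ∧ t < 1 := by
  have hlt : (2 * p * q - 2 * p - 2 * q : ℝ) / (2 * p * q - p - q) < 1 := by
    rcases (two_mul_mul_sub_sub_nonneg hp hq).eq_or_lt with hzero | hpos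
    · rw [← hzero, div_zero]
      exact one_pos
    · rw [div_lt_one hpos]
      have : (0 : ℝ) < p := by exact_mod_cast hp
      linarith
  obtain ⟨t, hmax, ht⟩ := exists_between (max_lt one_pos hlt)
  exact ⟨t, (max_lt_iff.1 hmax).1, (max_lt_iff.1 hmax).2, ht⟩

end GapBound

section Weights

variable {s p q : ℕ} {k : Fin s → ℕ} {ε : Fin s → ℝ} {a : ℤ}

/-- The weights `α` of the constant multiweight with `p * α j + q * β j = k j` and
`β j - α j = ε j`. -/
noncomputable def lowerWeight (p q : ℕ) (k : Fin s → ℕ) (ε : Fin s → ℝ) (j : Fin s) : ℝ :=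
  (k j - q * ε j) / (p + q)

/-- The weights `β` of the constant multiweight with `p * α j + q * β j = k j` and
`β j - α j = ε j`. -/
noncomputable def upperWeight (p q : ℕ) (k : Fin s → ℕ) (ε : Fin s → ℝ) (j : Fin s) : ℝ :=
  (k j + p * ε j) / (p + q)

theorem sum_lowerWeight (p q : ℕ) (k : Fin s → ℕ) (ε : Fin s → ℝ) :
    ∑ j, lowerWeight p q k ε j = ((∑ j, k j : ℕ) - q * ∑ j, ε j) / (p + q) := by
  simp only [lowerWeight, ← Finset.sum_div, Finset.sum_sub_distrib, ← Finset.mul_sum, Nat.cast_sum]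

theorem sum_upperWeight (p q : ℕ) (k : Fin s → ℕ) (ε : Fin s → ℝ) :
    ∑ j, upperWeight p q k ε j = ((∑ j, k j : ℕ) + p * ∑ j, ε j) / (p + q) := by
  simp only [upperWeight, ← Finset.sum_div, Finset.sum_add_distrib, ← Finset.mul_sum, Nat.cast_sum]

theorem lowerWeight_lt_upperWeight (hp : 0 < p) (hε : ∀ j, 0 < ε j) (j : Fin s) :
    lowerWeight p q k ε j < upperWeight p q k ε j := by
  have hp' : (0 : ℝ) < p := by exact_mod_cast hp
  refine div_lt_div_of_pos_right ?_ (by positivity)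
  have := mul_pos hp' (hε j)
  have : 0 ≤ q * ε j := mul_nonneg q.cast_nonneg (hε j).le
  linarith

theorem isMultiweight_lowerWeight_upperWeight (hp : 0 < p) (hε : ∀ j, 0 < ε j)
    (hlow : ∀ j, q * ε j ≤ k j) (hupp : ∀ j, p * ε j < p + q - k j) :
    IsMultiweight (constWeight p (lowerWeight p q k ε)) (constWeight q (upperWeight p q k ε)) := by
  have hpq : (0 : ℝ) < p + q := by positivity
  have hlt := lowerWeight_lt_upperWeight (q := q) (k := k) hp hε
  have hnonneg : ∀ j, 0 ≤ lowerWeight p q k ε j := fun j =>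
    div_nonneg (sub_nonneg.2 (hlow j)) hpq.le
  have hlt_one : ∀ j, upperWeight p q k ε j < 1 := fun j => by
    rw [upperWeight, div_lt_one hpq]
    linarith [hupp j]
  refine ⟨fun j _ => ⟨hnonneg j, (hlt j).trans (hlt_one j)⟩,
    fun j _ => ⟨(hnonneg j).trans (hlt j).le, hlt_one j⟩, fun _ _ _ _ => le_rfl,
    fun _ _ _ _ => le_rfl, fun j => ⟨k j, ?_⟩⟩
  simp only [constWeight, Finset.sum_const, Finset.card_univ, Fintype.card_fin, nsmul_eq_mul,
    lowerWeight, upperWeight]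
  field_simp
  ring

theorem isAdapted_lowerWeight_upperWeight (hp : 0 < p) (hq : 0 < q)
    (hk : ((∑ j, k j : ℕ) : ℤ) = (p + q) * a - p) (hε : ∀ j, 0 < ε j)
    (hlow : ∀ j, q * ε j ≤ k j) (hupp : ∀ j, p * ε j < p + q - k j)
    (hgap : (2 * p * q - 2 * p - 2 * q : ℝ) / (2 * p * q - p - q) < ∑ j, ε j)
    (hgap_one : ∑ j, ε j < 1) :
    IsAdapted p q a (lowerWeight p q k ε) (upperWeight p q k ε) := by
  have hpq : (0 : ℝ) < p + q := by positivity
  have hsum : ((∑ j, k j : ℕ) : ℝ) = (p + q) * a - p := by exact_mod_cast hk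
  have hlow_sum := sum_lowerWeight p q k ε
  have hupp_sum := sum_upperWeight p q k ε
  rw [hsum] at hlow_sum hupp_sum
  set t := ∑ j, ε j
  have hdiff : ∑ j, upperWeight p q k ε j - ∑ j, lowerWeight p q k ε j = t := by
    rw [hlow_sum, hupp_sum]
    field_simp
    ring
  have hdefect : q * ∑ j, upperWeight p q k ε j - p * ∑ j, lowerWeight p q k ε j =
      (q - p) * a + p - 2 * p * q * (1 - t) / (p + q) := by
    rw [hlow_sum, hupp_sum]
    field_simp
    ring
  refine ⟨isMultiweight_lowerWeight_upperWeight hp hε hlow hupp,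
    lowerWeight_lt_upperWeight hp hε, ?_, ?_, ?_⟩
  · rw [weightGap, hdiff]
    exact ⟨hgap, hgap_one⟩
  · have hpos : 0 < 2 * p * q * (1 - t) / (p + q) := by
      have : 0 < 1 - t := sub_pos.2 hgap_one
      positivity
    have hlt : 2 * p * q * (1 - t) / (p + q) < 2 - t := by
      rw [div_lt_iff₀ hpq]
      linarith [mul_one_sub_lt_of_div_lt hp hq hgap]
    rw [mem_intervalJ_iff, hdiff, hdefect]
    push_cast
    exact ⟨by linarith, by linarith⟩
  · rw [weightNorm_constWeight, weightNorm_constWeight, hlow_sum, hupp_sum]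
    field_simp
    ring

end Weights

section Existence

variable {s p q : ℕ} {k : Fin s → ℕ} {a : ℤ}

theorem exists_isAdapted_of_bounds (hp : 0 < p) (hq : 0 < q) {m : Fin s → ℝ}
    (hk : ((∑ j, k j : ℕ) : ℤ) = (p + q) * a - p) (hm : ∀ j, 0 < m j)
    (hlow : ∀ j, q * m j ≤ k j) (hupp : ∀ j, p * m j ≤ p + q - k j) (hsum : 1 ≤ ∑ j, m j) :
    ∃ α β : Fin s → ℝ, IsAdapted p q a α β := by
  obtain ⟨t, ht₀, hgap, ht₁⟩ := exists_pos_div_lt_lt_one hp hq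
  obtain ⟨ε, hε, hεm, rfl⟩ := exists_pos_lt_sum_eq hm hsum ht₀ ht₁
  refine ⟨_, _, isAdapted_lowerWeight_upperWeight hp hq hk hε (fun j => ?_) (fun j => ?_) hgap ht₁⟩
  · exact (mul_le_mul_of_nonneg_left (hεm j).le q.cast_nonneg).trans (hlow j)
  · exact (mul_lt_mul_of_pos_left (hεm j) (by exact_mod_cast hp)).trans_le (hupp j)

theorem exists_isAdapted_of_le (hp : 0 < p) (hq : 0 < q)
    (hk : ((∑ j, k j : ℕ) : ℤ) = (p + q) * a - p) (ha : 1 ≤ a) (hk₀ : ∀ j, 0 < k j)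
    (hkq : ∀ j, k j ≤ q) : ∃ α β : Fin s → ℝ, IsAdapted p q a α β := by
  have hq' : (0 : ℝ) < q := by exact_mod_cast hq
  have hkq' : ∀ j, (k j : ℝ) ≤ q := fun j => by exact_mod_cast hkq j
  refine exists_isAdapted_of_bounds hp hq (m := fun j => k j / q) hk
    (fun j => div_pos (by exact_mod_cast hk₀ j) hq') (fun j => (mul_div_cancel₀ _ hq'.ne').le)
    (fun j => ?_) ?_
  · have hle : (p : ℝ) * (k j / q) ≤ p :=
      mul_le_of_le_one_right p.cast_nonneg (div_le_one_of_le₀ (hkq' j) hq'.le)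
    linarith [hkq' j]
  · have hsum : (∑ j, (k j : ℝ)) = (p + q) * a - p := by exact_mod_cast hk
    have ha' : ((p : ℝ) + q) * 1 ≤ (p + q) * a :=
      mul_le_mul_of_nonneg_left (by exact_mod_cast ha) (by positivity)
    rw [← Finset.sum_div, le_div_iff₀ hq', hsum]
    linarith

theorem exists_isAdapted_of_ge (hp : 0 < p) (hq : 0 < q)
    (hk : ((∑ j, k j : ℕ) : ℤ) = (p + q) * a - p) (ha : a ≤ s) (hkq : ∀ j, q ≤ k j)
    (hk₁ : ∀ j, k j < p + q) : ∃ α β : Fin s → ℝ, IsAdapted p q a α β := by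
  have hp' : (0 : ℝ) < p := by exact_mod_cast hp
  have hkq' : ∀ j, (q : ℝ) ≤ k j := fun j => by exact_mod_cast hkq j
  have hpos : ∀ j, (0 : ℝ) < p + q - k j := fun j => sub_pos.2 (by exact_mod_cast hk₁ j)
  refine exists_isAdapted_of_bounds hp hq (m := fun j => (p + q - k j) / p) hk
    (fun j => div_pos (hpos j) hp') (fun j => ?_) (fun j => (mul_div_cancel₀ _ hp'.ne').le) ?_
  · have hle : (q : ℝ) * ((p + q - k j) / p) ≤ q :=
      mul_le_of_le_one_right q.cast_nonneg (div_le_one_of_le₀ (by linarith [hkq' j]) hp'.le)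
    exact hle.trans (hkq' j)
  · have hsum : (∑ j, (k j : ℝ)) = (p + q) * a - p := by exact_mod_cast hk
    have ha' : ((p : ℝ) + q) * a ≤ (p + q) * s :=
      mul_le_mul_of_nonneg_left (by exact_mod_cast ha) (by positivity)
    rw [← Finset.sum_div, le_div_iff₀ hp', Finset.sum_sub_distrib, hsum, Finset.sum_const,
      Finset.card_univ, Fintype.card_fin, nsmul_eq_mul]
    linarith

theorem exists_isAdapted (hp : 0 < p) (hq : 0 < q)
    (ha : (a : ℝ) ∈ Set.Icc ((s + p : ℝ) / (p + q)) (((p + q - 1) * s + p : ℝ) / (p + q))) :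
    ∃ α β : Fin s → ℝ, IsAdapted p q a α β := by
  have hpq : (0 : ℝ) < p + q := by positivity
  have hlow : (s : ℤ) + p ≤ a * (p + q) := by exact_mod_cast (div_le_iff₀ hpq).1 ha.1
  have hupp : a * (p + q) ≤ ((p : ℤ) + q - 1) * s + p := by
    exact_mod_cast (le_div_iff₀ hpq).1 ha.2
  have ha₁ : 1 ≤ a := by
    have : 0 < a * (p + q : ℤ) := by lia
    exact pos_of_mul_pos_left this (by lia)
  have ha_le : a ≤ s := by
    have : a * (p + q : ℤ) < (s + 1) * (p + q) := by nlinarith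
    exact Int.lt_add_one_iff.1 (lt_of_mul_lt_mul_right this (by lia))
  obtain ⟨N, hN⟩ : ∃ N : ℕ, (N : ℤ) = (p + q) * a - p :=
    ⟨((p + q) * a - p).toNat, Int.toNat_of_nonneg (by lia)⟩
  rcases le_total N (s * q) with hNq | hNq
  · obtain ⟨k, hk, rfl⟩ := exists_bounded_sum_eq (lo := 1) hq s N (by zify; linarith) hNq
    exact exists_isAdapted_of_le hp hq hN ha₁ (fun j => (hk j).1) fun j => (hk j).2
  · obtain ⟨k, hk, rfl⟩ := exists_bounded_sum_eq (lo := q) (hi := p + q - 1) (by lia) s N hNq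
      (by zify [show 1 ≤ p + q by lia]; linarith)
    exact exists_isAdapted_of_ge hp hq hN ha_le (fun j => (hk j).1) fun j => by
      have := (hk j).2
      lia

end Existence

theorem IsAdapted.sub_sub_lt {s p q : ℕ} {a : ℤ} {α β : Fin s → ℝ} (h : IsAdapted p q a α β)
    (hp : 0 < p) (hq : 0 < q) : q * a - ∑ j, α j - q * ∑ j, β j < -a + 2 := by
  have hp' : (1 : ℝ) ≤ p := by exact_mod_cast hp
  have hq' : (1 : ℝ) ≤ q := by exact_mod_cast hq
  have hgap := mul_one_sub_lt_of_div_lt hp hq h.gap_mem.1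
  have hnonneg : 0 ≤ p * (q - 1) * (1 - weightGap α β) :=
    mul_nonneg (mul_nonneg p.cast_nonneg (by linarith)) (by linarith [h.gap_mem.2])
  have hnorm := h.norm_add_norm
  rw [weightNorm_constWeight, weightNorm_constWeight] at hnorm
  have hα : (p + q) * ∑ j, α j = (p + q) * a - p - q * weightGap α β := by
    rw [weightGap]
    linarith
  have hβ : ∑ j, β j = ∑ j, α j + weightGap α β := by
    rw [weightGap]
    ring
  rw [hβ]
  refine lt_of_mul_lt_mul_left ?_ (by linarith : (0 : ℝ) ≤ p + q)
  have hmul : (q + 1) * ((p + q) * ∑ j, α j) = (q + 1) * ((p + q) * a - p - q * weightGap α β) :=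
    congrArg _ hα
  linarith

namespace ParabolicHiggs.RepresentsPointOfModuli

open HolBundle

variable {s p q : ℕ} {pt : Fin s → RiemannSphere} {H : ParabolicHiggs.{u} p q pt}
  {α β : Fin s → ℝ} {d a : ℤ}

theorem exists_V_isIsomorphic_split
    (h : H.RepresentsPointOfModuli (constWeight p α) (constWeight q β) d)
    (hle : ∀ j, α j ≤ β j) (hgap : weightGap α β < 2) (hd : (d : ℝ) ∈ intervalJ p q α β) :
    ∃ c : ℤ, H.V.degree = q * c ∧ H.V.IsIsomorphic (HolBundle.split fun _ : Fin q => c) := by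
  obtain ⟨-, D, -, hD, -⟩ := h.hasTrivialDet
  obtain ⟨b, e, hb, -⟩ := exists_isSplitFrame_top hD
  have hdeg : H.V.degree = ∑ i, e i := hb.subDegree_eq
  have hlow := (h.degree_V_add_mem_Ioo hle hd).1
  rw [hdeg, Int.cast_sum] at hlow
  obtain ⟨c, rfl⟩ := exists_eq_const_of_neg_one_lt_sum
    (h.splitting_V_add_le (fun y hy => h.δ_eq_zero hle hgap hd hy) hb) hlow
  refine ⟨c, ?_, hb.isIsomorphic_split⟩
  rw [hdeg, Finset.sum_const, Finset.card_univ, Fintype.card_fin, nsmul_eq_mul]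

theorem exists_pos_V_isIsomorphic_split
    (h : H.RepresentsPointOfModuli (constWeight p α) (constWeight q β) d)
    (hβ : ∀ j, 0 ≤ β j) (hle : ∀ j, α j ≤ β j) (hgap : weightGap α β < 2)
    (hd : (d : ℝ) ∈ intervalJ p q α β) :
    ∃ a : ℤ, 0 < a ∧ H.V.IsIsomorphic (HolBundle.split fun _ : Fin q => -a) := by
  obtain ⟨c, hdeg, hiso⟩ := h.exists_V_isIsomorphic_split hle hgap hd
  refine ⟨-c, neg_pos.2 ?_, by rwa [neg_neg]⟩
  have hupp := (h.degree_V_add_mem_Ioo hle hd).2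
  have hβ_sum : 0 ≤ q * ∑ j, β j :=
    mul_nonneg q.cast_nonneg (Finset.sum_nonneg fun j _ => hβ j)
  have hneg : (q * c : ℤ) < 0 := by
    rw [← hdeg]
    exact_mod_cast (by linarith : (H.V.degree : ℝ) < 0)
  exact neg_of_mul_neg_right hneg (Int.natCast_nonneg q)

theorem degree_eq_of_isAdapted (had : IsAdapted p q a α β)
    (h : H.RepresentsPointOfModuli (constWeight p α) (constWeight q β) ((q - p) * a + p)) :
    H.U.degree = p * (-a + 1) ∧ H.V.degree = q * -a := by
  have hnorm := had.norm_add_norm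
  rw [weightNorm_constWeight, weightNorm_constWeight] at hnorm
  have hadd : H.U.degree + H.V.degree = p - (p + q) * a := by
    have := h.hasTrivialDet.degree_add_degree
    exact_mod_cast (by linarith : (H.U.degree + H.V.degree : ℝ) = p - (p + q) * a)
  have hsub := h.degree_sub
  constructor <;> linarith

theorem U_and_V_isIsomorphic_split (hp : 0 < p) (hq : 0 < q) (had : IsAdapted p q a α β)
    (h : H.RepresentsPointOfModuli (constWeight p α) (constWeight q β) ((q - p) * a + p)) :
    H.U.IsIsomorphic (HolBundle.split fun _ : Fin p => -a + 1) ∧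
      H.V.IsIsomorphic (HolBundle.split fun _ : Fin q => -a) := by
  have hle : ∀ j, α j ≤ β j := fun j => (had.lt j).le
  have hgap : weightGap α β < 2 := had.gap_mem.2.trans one_lt_two
  obtain ⟨hdegU, hdegV⟩ := h.degree_eq_of_isAdapted had
  obtain ⟨D, -, hD, -⟩ := h.hasTrivialDet
  obtain ⟨b, e, hb, -⟩ := exists_isSplitFrame_top hD
  have he_le : ∀ i, e i ≤ -a + 1 := fun i => by
    have hi := h.splitting_U_add_le (fun y hy => h.δ_eq_zero hle hgap had.mem_intervalJ hy) hb i
    rw [hdegV] at hi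
    push_cast at hi
    have : (e i : ℝ) < -a + 2 := by linarith [had.sub_sub_lt hp hq]
    exact Int.lt_add_one_iff.1 (by exact_mod_cast (by linarith : (e i : ℝ) < -a + 1 + 1))
  obtain rfl := eq_const_of_le_of_sum_eq he_le (hb.subDegree_eq.symm.trans hdegU)
  obtain ⟨c, hc, hiso⟩ := h.exists_V_isIsomorphic_split hle hgap had.mem_intervalJ
  obtain rfl : c = -a := mul_left_cancel₀ (by exact_mod_cast hq.ne') (hc.symm.trans hdegV)
  exact ⟨hb.isIsomorphic_split, hiso⟩

end ParabolicHiggs.RepresentsPointOfModuli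

theorem lemmal {s p q : ℕ} (hp : 0 < p) (hq : 0 < q) (pt : Fin s → RiemannSphere)
    (hpt : Function.Injective pt) :
    (∀ (α β : Fin s → ℝ) (d : ℤ),
      IsMultiweight (constWeight p α) (constWeight q β) → (∀ j, α j < β j) →
      weightGap α β < 2 → (d : ℝ) ∈ intervalJ p q α β →
      ∀ H : ParabolicHiggs.{u} p q pt,
        H.RepresentsPointOfModuli (constWeight p α) (constWeight q β) d →
        ∃ a : ℤ, 0 < a ∧ H.V.IsIsomorphic (HolBundle.split fun _ : Fin q => -a)) ∧
    (∀ a : ℤ,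
      (a : ℝ) ∈ Set.Icc ((s + p : ℝ) / (p + q)) (((p + q - 1) * s + p : ℝ) / (p + q)) →
      (∃ α β : Fin s → ℝ, IsAdapted p q a α β) ∧
      ∀ α β : Fin s → ℝ, IsAdapted p q a α β →
        ∀ H : ParabolicHiggs.{u} p q pt,
          H.RepresentsPointOfModuli (constWeight p α) (constWeight q β) ((q - p) * a + p) →
          H.U.IsIsomorphic (HolBundle.split fun _ : Fin p => -a + 1) ∧
          H.V.IsIsomorphic (HolBundle.split fun _ : Fin q => -a)) := by
  refine ⟨fun α β d hw hlt hgap hd H h => ?_, fun a ha =>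
    ⟨exists_isAdapted hp hq ha, fun α β had H h => h.U_and_V_isIsomorphic_split hp hq had⟩⟩
  exact h.exists_pos_V_isIsomorphic_split (fun j => (hw.mem_right j ⟨0, hq⟩).1)
    (fun j => (hlt j).le) hgap hd
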